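/- Call a graph $(\mathrm{bull},\mathsf{E})$-free if it has no induced subgraph isomorphic to the bull (a triangle $abc$ together with two further vertices $d,e$, where $d$ is adjacent only to $a$ and $e$ only to $b$) or to $\mathsf{E}$ (a path $v_1v_2v_3v_4v_5$ together with a further vertex adjacent only to $v_3$). All graphs are finite. For a fixed simple (in particular loopless) graph $H$, an instance of Max Partial $H$-Coloring consists of a simple graph $G$ and a revenue function $\mathsf{rev}:V(G)\times V(H)\to\mathbb{Q}_{\ge 0}$; the task is to output a set $X\subseteq V(G)$ and an $H$-coloring $c$ of $G[X]$ (a map $c:X\to V(H)$ with $c(u)c(v)\in E(H)$ for every edge $uv$ of $G[X]$) for which $\sum_{v\in X}\mathsf{rev}(v,c(v))$ is maximum possible. **Theorem.** There is an absolute constant $\tau$ such that for every simple graph $H$ with at least one vertex there is an algorithm that, given an instance $(G,\mathsf{rev})$ of Max Partial $H$-Coloring where $G$ is $(\mathrm{bull},\mathsf{E})$-free, outputs an optimum solution. If $G$ has $n\ge 2$ vertices and clique number $\omega$, the running time is at most $n^{\tau\,|V(H)|\,\omega\,\log_2 n}$, that is, $n^{\mathcal{O}(|V(H)|\,\omega\log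 n)}$ with an absolute constant in the $\mathcal{O}$; if $n\le 1$, the running time is at most $2^{\tau\,|V(H)|}$. Here arithmetic on the values of the revenue function takes constant time. Concretely, algorithms are programs made of finitely many mutually recursive first-order functions on binary trees whose leaves are $\mathrm{nil}$ or rational numbers, and the running time is the number of elementary operations: reading a local variable, binding a local variable, the constants $\mathrm{nil}$ and $0$, creating a cell, branching on whether a tree is a cell or $\mathrm{nil}$ (and in the first case taking its two components), a function call, and addition, subtraction and comparison of two rational numbers, each of cost one. The input is the adjacency matrix of $G$ and the table of revenues, as lists of rows; the output is the list of the (optional) colors of the vertices. -/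

import Mathlib

open scoped NNRat

namespace MaxPartialHColoring

/-! ### The two forbidden induced subgraphs -/

/-- The bull: a triangle `0, 1, 2` with pendant edges at the two vertices `0` and `1`. -/
def bull : SimpleGraph (Fin 5) :=
  SimpleGraph.fromEdgeSet {s(0, 1), s(1, 2), s(0, 2), s(0, 3), s(1, 4)}

/-- The graph `E`: the path `0 - 1 - 2 - 3 - 4` with a pendant edge at its middle vertex `2`. -/
def graphE : SimpleGraph (Fin 6) :=
  SimpleGraph.fromEdgeSet {s(0, 1), s(1, 2), s(2, 3), s(3, 4), s(2, 5)}

/-! ### The problem -/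

/-- A feasible solution for the graph `G`: a set `X` of vertices of `G` and an `H`-coloring of the
induced subgraph `G[X]`, that is, a graph homomorphism from `G[X]` to `H`. -/
structure PartialColoring {V W : Type} (G : SimpleGraph V) (H : SimpleGraph W) where
  /-- the set of colored vertices -/
  X : Finset V
  /-- the `H`-coloring of `G[X]` -/
  c : G.induce (X : Set V) →g H

namespace PartialColoring

variable {V W : Type} {G : SimpleGraph V} {H : SimpleGraph W}

/-- The total revenue `∑ v ∈ X, rev (v, c v)`. -/
def revenue (S : PartialColoring G H) (rev : V → W → ℚ≥0) : ℚ≥0 :=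
  ∑ v : {v // v ∈ S.X}, rev v.1 (S.c v)

/-- The solution has the maximum possible total revenue. -/
def IsOptimal (S : PartialColoring G H) (rev : V → W → ℚ≥0) : Prop :=
  ∀ S' : PartialColoring G H, S'.revenue rev ≤ S.revenue rev

open Classical in
/-- The color of a vertex, `none` if the vertex is not colored. -/
noncomputable def colorOf (S : PartialColoring G H) (v : V) : Option W :=
  if h : v ∈ S.X then some (S.c ⟨v, h⟩) else none

end PartialColoring

/-! ### The machine model

Programs are finite systems of (mutually) recursive first-order functions over binary trees whose
leaves are `nil` or rational numbers.  The primitive operations are: reading a local variable,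
creating a cell, inspecting a cell, testing for `nil`, calling a function, and, on the numbers,
the constant `0`, addition, subtraction and comparison.  Every operation costs one time unit: a tree
is represented by a pointer to its root cell and subtrees are shared, so that a random access
machine performs each of them in constant time, arithmetic on the rational input numbers being
performed in constant time.  There is no other way to access a number (no multiplication, no
rounding, no access to its digits), and trees cannot be compared in one step. -/

/-- The data that programs operate on. -/
inductive Value : Type
  | nil : Value
  | pair (a b : Value) : Value
  | num (q : ℚ) : Value

/-- Expressions.  Local variables are referred to by their position (de Bruijn index) in the list
of local variables. -/
inductive Term : Type
  /-- the `i`-th local variable -/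
  | var (i : ℕ) : Term
  | nil : Term
  /-- create a cell -/
  | pair (s t : Term) : Term
  /-- if `c` is a cell, evaluate `s` with its two components as new local variables `0` and `1`;
  if `c` is `nil`, evaluate `t` -/
  | matchPair (c s t : Term) : Term
  /-- the number `0` -/
  | zero : Term
  | add (s t : Term) : Term
  | sub (s t : Term) : Term
  /-- compare the numbers `a` and `b`; evaluate `s` if `a ≤ b`, and `t` otherwise -/
  | ifLe (a b s t : Term) : Term
  /-- evaluate `t` with the value of `s` as new local variable `0` -/
  | letIn (s t : Term) : Term
  /-- call the `f`-th function of the program with the value of `s` as its only argument -/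
  | call (f : ℕ) (s : Term) : Term

/-- A program is the list of the bodies of its functions; the function `0` is the main one.  In a
function body the argument is local variable `0`. -/
abbrev Program : Type := List Term

/-- `Eval P ρ e v t`: in the program `P`, with list `ρ` of local variables, the evaluation of the
expression `e` terminates with the value `v` after exactly `t` steps. -/
inductive Eval (P : Program) : List Value → Term → Value → ℕ → Prop
  | var {ρ : List Value} {i : ℕ} {v : Value} (h : ρ[i]? = some v) : Eval P ρ (.var i) v 1
  | nil {ρ : List Value} : Eval P ρ .nil .nil 1
  | pair {ρ : List Value} {s t : Term} {a b : Value} {m n : ℕ}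
      (hs : Eval P ρ s a m) (ht : Eval P ρ t b n) :
      Eval P ρ (.pair s t) (.pair a b) (m + n + 1)
  | matchPair {ρ : List Value} {c s t : Term} {a b v : Value} {m n : ℕ}
      (hc : Eval P ρ c (.pair a b) m) (hs : Eval P (a :: b :: ρ) s v n) :
      Eval P ρ (.matchPair c s t) v (m + n + 1)
  | matchNil {ρ : List Value} {c s t : Term} {v : Value} {m n : ℕ}
      (hc : Eval P ρ c .nil m) (ht : Eval P ρ t v n) :
      Eval P ρ (.matchPair c s t) v (m + n + 1)
  | zero {ρ : List Value} : Eval P ρ .zero (.num 0) 1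
  | add {ρ : List Value} {s t : Term} {p q : ℚ} {m n : ℕ}
      (hs : Eval P ρ s (.num p) m) (ht : Eval P ρ t (.num q) n) :
      Eval P ρ (.add s t) (.num (p + q)) (m + n + 1)
  | sub {ρ : List Value} {s t : Term} {p q : ℚ} {m n : ℕ}
      (hs : Eval P ρ s (.num p) m) (ht : Eval P ρ t (.num q) n) :
      Eval P ρ (.sub s t) (.num (p - q)) (m + n + 1)
  | ifLe {ρ : List Value} {a b s t : Term} {p q : ℚ} {v : Value} {l m n : ℕ}
      (ha : Eval P ρ a (.num p) l) (hb : Eval P ρ b (.num q) m) (hpq : p ≤ q)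
      (hs : Eval P ρ s v n) : Eval P ρ (.ifLe a b s t) v (l + m + n + 1)
  | ifNotLe {ρ : List Value} {a b s t : Term} {p q : ℚ} {v : Value} {l m n : ℕ}
      (ha : Eval P ρ a (.num p) l) (hb : Eval P ρ b (.num q) m) (hpq : ¬ p ≤ q)
      (ht : Eval P ρ t v n) : Eval P ρ (.ifLe a b s t) v (l + m + n + 1)
  | letIn {ρ : List Value} {s t : Term} {a v : Value} {m n : ℕ}
      (hs : Eval P ρ s a m) (ht : Eval P (a :: ρ) t v n) :
      Eval P ρ (.letIn s t) v (m + n + 1)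
  | call {ρ : List Value} {f : ℕ} {s body : Term} {a v : Value} {m n : ℕ}
      (hf : P[f]? = some body) (hs : Eval P ρ s a m) (hb : Eval P [a] body v n) :
      Eval P ρ (.call f s) v (m + n + 1)

/-- Programs are deterministic: the result and the number of steps are determined. -/
theorem Eval.deterministic {P : Program} {ρ : List Value} {e : Term} {v v' : Value} {t t' : ℕ}
    (h : Eval P ρ e v t) (h' : Eval P ρ e v' t') : v = v' ∧ t = t' := by
  induction h generalizing v' t' <;> cases h' <;> grind

/-- The program `P`, started on the input `x`, halts with the output `y` after exactly `t` steps. -/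
def Program.Runs (P : Program) (x y : Value) (t : ℕ) : Prop :=
  Eval P [x] (.call 0 (.var 0)) y t

/-! ### Encoding of inputs and outputs -/

/-- A list is encoded as a `nil`-terminated chain of cells. -/
def encodeList : List Value → Value
  | [] => .nil
  | a :: l => .pair a (encodeList l)

/-- Truth values: `nil` for false and a cell for true. -/
def encodeBool : Bool → Value
  | false => .nil
  | true => .pair .nil .nil

/-- Natural numbers are encoded in unary, as a list of `nil`s. -/
def encodeNat (m : ℕ) : Value := encodeList (List.replicate m .nil)

/-- An optional color: `nil` for no color, and a cell with first component `i` for color `i`. -/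
def encodeColor {k : ℕ} : Option (Fin k) → Value
  | none => .nil
  | some i => .pair (encodeNat i) .nil

open Classical in
/-- The input: the adjacency matrix of `G` together with the table of revenues, both row by row. -/
noncomputable def encodeInstance {n k : ℕ} (G : SimpleGraph (Fin n)) (rev : Fin n → Fin k → ℚ≥0) :
    Value :=
  .pair
    (encodeList (List.ofFn fun u : Fin n =>
      encodeList (List.ofFn fun v : Fin n => encodeBool (decide (G.Adj u v)))))
    (encodeList (List.ofFn fun u : Fin n =>
      encodeList (List.ofFn fun i : Fin k => .num (rev u i : ℚ))))

/-- The output: the list of the optional colors of all vertices. -/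
noncomputable def encodeSolution {n k : ℕ} {G : SimpleGraph (Fin n)} {H : SimpleGraph (Fin k)}
    (S : PartialColoring G H) : Value :=
  encodeList (List.ofFn fun v : Fin n => encodeColor (S.colorOf v))

end MaxPartialHColoring

/-! The algorithm is divide and conquer. For a vertex set V with at least two elements it computes
at most three cuts (A, B), pairs of disjoint subsets of V, such that after deletion of all edges
between A and B, for every cut, each component of G[V] has at most |V|/2 vertices (`pieces_halved`).
To this end a clique K is grown greedily as long as its common neighborhood D keeps more than |V|/2
vertices. The first cut is (D, V \ D), and maximality says that no vertex has more than |V|/2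
neighbors in D if it lies in D. If G[D] still has a component with more than |V|/2 vertices, a
Gyárfás path is grown inside it. It ends in a vertex u with a connected set C of more than |V|/2
vertices such that the path before u has no neighbor in C, every vertex of D \ C with a neighbor in
C is adjacent to the path before u, and C without the closed neighborhood of u has no large
component (`pathPart_spec`). The other two cuts are (D \ C, C) and (N(u) ∩ C, C \ N(u)).

To make the components independent, the interaction across each cut (A, B) is guessed for each color
a. Among the vertices of A colored a by a fixed solution, take a minimal set X that has the same
neighbors in B. Then X is stable, since H has no loops, and each of its vertices has a private
neighbor in B. Given X, all pairs (vertex, color) that contradict the guess are discarded. For the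
right guess nothing of the solution is lost (`exists_compatible`), and for any guess all surviving
pairs satisfy the constraints of H along the edges that cross the cut (`adj_of_mem_refinements`).
Hence the components can be solved separately and their solutions united (`optimal_solveAll`,
`optimal_solve`).

The forbidden subgraphs bound the number of guesses. If three pairwise nonadjacent vertices of A
have private neighbors in B, these private neighbors are adjacent, as otherwise a bull or an `E`
appears (`adj_private_of_clique`, `adj_private_of_path`, `good_of_mem_cuts`). So private neighbors
of a set X of size at least 3 form a clique, |X| ≤ ω + 2 (`length_le_of_irredundant`), and there are
at most (n+1)^(ω+2) candidates for X. With at most 3|V(H)| pairs of a cut and a color, one instance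
branches into n^O(|V(H)|ω) instances on components of half the size, and the depth of the recursion
is logarithmic.

The rest is the implementation. A weakest precondition calculus (`wp_sound`) reduces each function
of the program to a functional specification with a bound Q * M ^ j, where M is polynomial in n and
|V(H)| and Q collects the factors L for the number of guesses. `solve_spec` solves the recurrence,
and `steps_le` and `two_pow_le_rpow` bring the result into the required form. -/

namespace MaxPartialHColoring

/-! ### Weakest preconditions -/

/-- The number of nodes of an expression. -/
def Term.size : Term → ℕ
  | .var _ => 1
  | .nil => 1
  | .pair s t => s.size + t.size + 1
  | .matchPair c s t => c.size + s.size + t.size + 1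
  | .zero => 1
  | .add s t => s.size + t.size + 1
  | .sub s t => s.size + t.size + 1
  | .ifLe a b s t => a.size + b.size + s.size + t.size + 1
  | .letIn s t => s.size + t.size + 1
  | .call _ s => s.size + 1

/-- The function `f` of `P` maps `a` to `v` in at most `B` steps. -/
def Calls (P : Program) (B f : ℕ) (a v : Value) : Prop :=
  ∃ body t, P[f]? = some body ∧ Eval P [a] body v t ∧ t ≤ B

theorem Calls.mono {P : Program} {B B' f : ℕ} {a v : Value} (h : Calls P B f a v) (hB : B ≤ B') :
    Calls P B' f a v := by
  obtain ⟨b, t, h1, h2, h3⟩ := h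
  exact ⟨b, t, h1, h2, h3.trans hB⟩

/-- The `i`-th local variable exists and satisfies `Q`. -/
def look : List Value → ℕ → (Value → Prop) → Prop
  | [], _, _ => False
  | a :: _, 0, Q => Q a
  | _ :: ρ, i + 1, Q => look ρ i Q

theorem exists_of_look {ρ : List Value} {i : ℕ} {Q : Value → Prop} (h : look ρ i Q) :
    ∃ v, ρ[i]? = some v ∧ Q v := by
  induction ρ generalizing i with
  | nil => exact h.elim
  | cons a ρ ih =>
    cases i with
    | zero => exact ⟨a, rfl, h⟩
    | succ i => exact ih h

/-- The evaluation of an expression with calls of at most `B` steps each succeeds, with a value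
satisfying the postcondition. -/
def wp (P : Program) (B : ℕ) : Term → List Value → (Value → Prop) → Prop
  | .var i, ρ, Q => look ρ i Q
  | .nil, _, Q => Q .nil
  | .pair s t, ρ, Q => wp P B s ρ fun a => wp P B t ρ fun b => Q (.pair a b)
  | .matchPair c s t, ρ, Q => wp P B c ρ fun a =>
      match a with
      | .pair a b => wp P B s (a :: b :: ρ) Q
      | .nil => wp P B t ρ Q
      | .num _ => False
  | .zero, _, Q => Q (.num 0)
  | .add s t, ρ, Q => wp P B s ρ fun a => wp P B t ρ fun b =>
      ∃ p q, a = .num p ∧ b = .num q ∧ Q (.num (p + q))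
  | .sub s t, ρ, Q => wp P B s ρ fun a => wp P B t ρ fun b =>
      ∃ p q, a = .num p ∧ b = .num q ∧ Q (.num (p - q))
  | .ifLe a b s t, ρ, Q => wp P B a ρ fun x => wp P B b ρ fun y =>
      ∃ p q, x = .num p ∧ y = .num q ∧ (p ≤ q → wp P B s ρ Q) ∧ (¬ p ≤ q → wp P B t ρ Q)
  | .letIn s t, ρ, Q => wp P B s ρ fun a => wp P B t (a :: ρ) Q
  | .call f s, ρ, Q => wp P B s ρ fun a => ∃ v, Calls P B f a v ∧ Q v

theorem wp.mono {P : Program} {B : ℕ} {e : Term} {ρ : List Value} {Q Q' : Value → Prop}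
    (h : wp P B e ρ Q) (hQ : ∀ v, Q v → Q' v) : wp P B e ρ Q' := by
  induction e generalizing ρ Q Q' with
  | var i =>
    simp only [wp] at h ⊢
    induction ρ generalizing i with
    | nil => exact h
    | cons a ρ ih =>
      cases i with
      | zero => exact hQ _ h
      | succ i => exact ih i h
  | nil => exact hQ _ h
  | zero => exact hQ _ h
  | pair s t ihs iht => exact ihs h fun a ha => iht ha fun b hb => hQ _ hb
  | matchPair c s t ihc ihs iht =>
    refine ihc h fun a ha => ?_
    cases a with
    | nil => exact iht ha hQ
    | pair x y => exact ihs ha hQ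
    | num q => exact ha
  | add s t ihs iht =>
    exact ihs h fun a ha => iht ha fun b ⟨p, q, hp, hq, hb⟩ => ⟨p, q, hp, hq, hQ _ hb⟩
  | sub s t ihs iht =>
    exact ihs h fun a ha => iht ha fun b ⟨p, q, hp, hq, hb⟩ => ⟨p, q, hp, hq, hQ _ hb⟩
  | ifLe a b s t iha ihb ihs iht =>
    exact iha h fun x hx => ihb hx fun y ⟨p, q, hp, hq, h1, h2⟩ =>
      ⟨p, q, hp, hq, fun h => ihs (h1 h) hQ, fun h => iht (h2 h) hQ⟩
  | letIn s t ihs iht => exact ihs h fun a ha => iht ha hQ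
  | call f s ihs => exact ihs h fun a ⟨v, hv, h⟩ => ⟨v, hv, hQ _ h⟩

/-- Expressions contain no loops: each node is evaluated at most once, and pays one step for itself
and at most B steps for a call. Repetition only arises from calls, which `wp` treats as given. -/
theorem wp_sound {P : Program} {B : ℕ} {e : Term} {ρ : List Value} {Q : Value → Prop}
    (h : wp P B e ρ Q) : ∃ v t, Q v ∧ Eval P ρ e v t ∧ t ≤ e.size * (B + 1) := by
  induction e generalizing ρ Q with
  | var i =>
    obtain ⟨v, h1, h2⟩ := exists_of_look h
    exact ⟨v, 1, h2, .var h1, by simp [Term.size]⟩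
  | nil => exact ⟨_, 1, h, .nil, by simp [Term.size]⟩
  | zero => exact ⟨_, 1, h, .zero, by simp [Term.size]⟩
  | pair s t ihs iht =>
    obtain ⟨a, m, h1, e1, b1⟩ := ihs h
    obtain ⟨b, l, h2, e2, b2⟩ := iht h1
    exact ⟨_, _, h2, .pair e1 e2, by simp only [Term.size]; nlinarith⟩
  | matchPair c s t ihc ihs iht =>
    obtain ⟨a, m, h1, e1, b1⟩ := ihc h
    cases a with
    | nil =>
      obtain ⟨b, l, h2, e2, b2⟩ := iht h1
      exact ⟨_, _, h2, .matchNil e1 e2, by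
        simp only [Term.size]; nlinarith [Nat.zero_le (s.size * (B + 1))]⟩
    | pair x y =>
      obtain ⟨b, l, h2, e2, b2⟩ := ihs h1
      exact ⟨_, _, h2, .matchPair e1 e2, by
        simp only [Term.size]; nlinarith [Nat.zero_le (t.size * (B + 1))]⟩
    | num q => exact h1.elim
  | add s t ihs iht =>
    obtain ⟨a, m, h1, e1, b1⟩ := ihs h
    obtain ⟨b, l, ⟨p, q, rfl, rfl, h2⟩, e2, b2⟩ := iht h1
    exact ⟨_, _, h2, .add e1 e2, by simp only [Term.size]; nlinarith⟩
  | sub s t ihs iht =>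
    obtain ⟨a, m, h1, e1, b1⟩ := ihs h
    obtain ⟨b, l, ⟨p, q, rfl, rfl, h2⟩, e2, b2⟩ := iht h1
    exact ⟨_, _, h2, .sub e1 e2, by simp only [Term.size]; nlinarith⟩
  | ifLe a b s t iha ihb ihs iht =>
    obtain ⟨x, m, h1, e1, b1⟩ := iha h
    obtain ⟨y, l, ⟨p, q, rfl, rfl, h2, h3⟩, e2, b2⟩ := ihb h1
    by_cases hpq : p ≤ q
    · obtain ⟨v, r, h4, e3, b3⟩ := ihs (h2 hpq)
      exact ⟨_, _, h4, .ifLe e1 e2 hpq e3, by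
        simp only [Term.size]; nlinarith [Nat.zero_le (t.size * (B + 1))]⟩
    · obtain ⟨v, r, h4, e3, b3⟩ := iht (h3 hpq)
      exact ⟨_, _, h4, .ifNotLe e1 e2 hpq e3, by
        simp only [Term.size]; nlinarith [Nat.zero_le (s.size * (B + 1))]⟩
  | letIn s t ihs iht =>
    obtain ⟨a, m, h1, e1, b1⟩ := ihs h
    obtain ⟨b, l, h2, e2, b2⟩ := iht h1
    exact ⟨_, _, h2, .letIn e1 e2, by simp only [Term.size]; nlinarith⟩
  | call f s ihs =>
    obtain ⟨a, m, ⟨v, ⟨body, t, hf, e2, b2⟩, hQ⟩, e1, b1⟩ := ihs h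
    exact ⟨_, _, hQ, .call hf e1 e2, by simp only [Term.size]; nlinarith⟩

theorem Calls.of_wp {P : Program} {B B' f : ℕ} {a y : Value} {body : Term}
    (hf : P[f]? = some body) (hB : body.size * (B + 1) ≤ B')
    (h : wp P B body [a] (fun v => v = y)) : Calls P B' f a y := by
  obtain ⟨v, t, rfl, e, b⟩ := wp_sound h
  exact ⟨body, t, hf, e, b.trans hB⟩

/-! ### Encodings -/

/-- Types whose elements are represented by values. -/
class Enc (α : Type) where
  /-- the representation -/
  enc : α → Value

open Enc

instance : Enc Unit := ⟨fun _ => .nil⟩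
instance : Enc ℚ := ⟨.num⟩
instance : Enc Bool := ⟨encodeBool⟩
instance : Enc ℕ := ⟨encodeNat⟩
instance {n : ℕ} : Enc (Fin n) := ⟨fun i => encodeNat i⟩
instance {α : Type} [Enc α] : Enc (List α) := ⟨fun l => encodeList (l.map enc)⟩
instance {α β : Type} [Enc α] [Enc β] : Enc (α × β) := ⟨fun p => .pair (enc p.1) (enc p.2)⟩

/-- Unary numbers are lists, so the functions on lists also do the arithmetic on indices. -/
theorem enc_fin {n : ℕ} (i : Fin n) : enc i = enc (List.replicate i.val ()) := by
  change encodeNat i = encodeList _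
  rw [List.map_replicate]; rfl

/-! ### Recursion over lists -/

/-- The body of the function `self` that, applied to the pair of `e` and a list, folds the list from
the right.  In `step`, the local variables are the result for the tail, the head, the tail and `e`;
in `base`, the first local variable is `e`. -/
def foldT (self : ℕ) (step base : Term) : Term :=
  .matchPair (.var 0)
    (.matchPair (.var 1) (.letIn (.call self (.pair (.var 2) (.var 1))) step) base) .nil

/-- Induction on the list. The hypothesis on `step` is restricted to suffixes `a :: t` of `l`, so
that membership and length bounds known for `l` are available for head and tail. The summand 10 pays
for the case distinctions, the recursive call and its argument. -/
theorem Calls.fold {α β : Type} [Enc α] [Enc β] {P : Program} {B f : ℕ} {step base : Term}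
    {e : Value} {l : List α} {S : α → β → β} {z : β} (hf : P[f]? = some (foldT f step base))
    (hbase : ∀ ρ, wp P B base (e :: ρ) (fun v => v = enc z))
    (hstep : ∀ a t, a :: t <:+ l → ∀ ρ,
      wp P B step (enc (t.foldr S z) :: enc a :: enc t :: e :: ρ)
        (fun v => v = enc (S a (t.foldr S z)))) :
    Calls P ((l.length + 1) * ((step.size + base.size + 10) * (B + 1))) f (.pair e (enc l))
      (enc (l.foldr S z)) := by
  induction l with
  | nil =>
    obtain ⟨v, t, rfl, h, b⟩ := wp_sound (hbase [.nil, .pair e .nil])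
    refine ⟨_, _, hf, .matchPair (.var rfl) (.matchNil (.var rfl) h), ?_⟩
    simp only [List.length_nil]
    nlinarith [Nat.zero_le (step.size * (B + 1))]
  | cons a l ih =>
    obtain ⟨b1, t1, h1, h2, h3⟩ := ih fun a t h => hstep a t (h.trans (List.suffix_cons _ _))
    obtain ⟨v, t, rfl, h, b⟩ := wp_sound (hstep a l List.suffix_rfl
      [enc (a :: l), .pair e (enc (a :: l))])
    refine ⟨_, _, hf, .matchPair (.var rfl) (.matchPair (.var rfl)
      (.letIn (.call h1 (.pair (.var rfl) (.var rfl)) h2) h)), ?_⟩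
    simp only [List.length_cons]
    nlinarith [Nat.zero_le (base.size * (B + 1))]

/-! ### Bounds -/

/-- Bounds on the number of steps have the form `Q * M ^ j`, where `M` bounds the sizes of all
polynomially long lists. -/
theorem Calls.up {P : Program} {Q M i f : ℕ} {a v : Value} (j : ℕ) (h : Calls P (Q * M ^ i) f a v)
    (hM : 1000 ≤ M) (hij : i ≤ j) : Calls P (Q * M ^ j) f a v :=
  h.mono (Nat.mul_le_mul_left _ (Nat.pow_le_pow_right (by omega) hij))

/-- A function without a loop of its own costs one more factor M: its body has at most 500 nodes and
B + 1 ≤ 2 * B, which explains the requirement 1000 ≤ M. -/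
theorem Calls.body {P : Program} {Q M f : ℕ} {a y : Value} (j : ℕ) {body : Term}
    (hf : P[f]? = some body) (hM : 1000 ≤ M) (hQ : 1 ≤ Q) (hs : body.size ≤ 500)
    (h : wp P (Q * M ^ j) body [a] (fun v => v = y)) : Calls P (Q * M ^ (j + 1)) f a y := by
  refine Calls.of_wp hf ?_ h
  have h1 : 1 ≤ Q * M ^ j := Nat.mul_pos hQ (Nat.pow_pos (by omega))
  calc body.size * (Q * M ^ j + 1) ≤ 500 * (2 * (Q * M ^ j)) := Nat.mul_le_mul hs (by omega)
    _ = 1000 * (Q * M ^ j) := by ring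
    _ ≤ M * (Q * M ^ j) := Nat.mul_le_mul_right _ hM
    _ = _ := by ring

/-- The factor L for the length of the list is kept apart from the powers of M because the lists of
guesses are not polynomially long. For short lists, `Calls.foldPoly` replaces it by another M. -/
theorem Calls.foldBig {α β : Type} [Enc α] [Enc β] {P : Program} {L Q M f : ℕ} (j : ℕ)
    {step base : Term} {e : Value} {l : List α} {S : α → β → β} {z : β}
    (hf : P[f]? = some (foldT f step base)) (hM : 1000 ≤ M) (hQ : 1 ≤ Q)
    (hs : step.size + base.size ≤ 490) (hl : l.length + 1 ≤ L)
    (hbase : ∀ ρ, wp P (Q * M ^ j) base (e :: ρ) (fun v => v = enc z))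
    (hstep : ∀ a t, a :: t <:+ l → ∀ ρ,
      wp P (Q * M ^ j) step (enc (t.foldr S z) :: enc a :: enc t :: e :: ρ)
        (fun v => v = enc (S a (t.foldr S z)))) :
    Calls P (L * Q * M ^ (j + 1)) f (.pair e (enc l)) (enc (l.foldr S z)) := by
  refine (Calls.fold hf hbase hstep).mono ?_
  have h1 : 1 ≤ Q * M ^ j := Nat.mul_pos hQ (Nat.pow_pos (by omega))
  calc (l.length + 1) * ((step.size + base.size + 10) * (Q * M ^ j + 1))
      ≤ L * (500 * (2 * (Q * M ^ j))) :=
        Nat.mul_le_mul hl (Nat.mul_le_mul (by omega) (by omega))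
    _ = L * (1000 * (Q * M ^ j)) := by ring
    _ ≤ L * (M * (Q * M ^ j)) := Nat.mul_le_mul_left _ (Nat.mul_le_mul_right _ hM)
    _ = _ := by ring

theorem Calls.foldPoly {α β : Type} [Enc α] [Enc β] {P : Program} {Q M f : ℕ} (j : ℕ)
    {step base : Term} {e : Value} {l : List α} {S : α → β → β} {z : β}
    (hf : P[f]? = some (foldT f step base)) (hM : 1000 ≤ M) (hQ : 1 ≤ Q)
    (hs : step.size + base.size ≤ 490) (hl : l.length + 1 ≤ M)
    (hbase : ∀ ρ, wp P (Q * M ^ j) base (e :: ρ) (fun v => v = enc z))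
    (hstep : ∀ a t, a :: t <:+ l → ∀ ρ,
      wp P (Q * M ^ j) step (enc (t.foldr S z) :: enc a :: enc t :: e :: ρ)
        (fun v => v = enc (S a (t.foldr S z)))) :
    Calls P (Q * M ^ (j + 2)) f (.pair e (enc l)) (enc (l.foldr S z)) :=
  (Calls.foldBig j hf hM hQ hs hl hbase hstep).mono (le_of_eq (by ring))

/-! ### Derived expressions -/

/-- The first component of a cell. -/
def fstT (s : Term) : Term := .matchPair s (.var 0) .nil

/-- The second component of a cell. -/
def sndT (s : Term) : Term := .matchPair s (.var 1) .nil

/-- The truth value `true`. -/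
def trueT : Term := .pair .nil .nil

/-- Negation. -/
def notT (s : Term) : Term := .matchPair s .nil trueT

/-- Disjunction. -/
def orT (s t : Term) : Term := .matchPair s trueT t

/-- Conjunction. -/
def andT (s t : Term) : Term := notT (orT (notT s) (notT t))

section

variable {P : Program} {B : ℕ} {s t : Term} {ρ : List Value}

theorem wp_not {a : Bool} (hs : wp P B s ρ (fun v => v = enc a)) :
    wp P B (notT s) ρ (fun v => v = enc (!a)) := by
  refine hs.mono ?_
  rintro _ rfl
  cases a <;> rfl

theorem wp_or {a b : Bool} (hs : wp P B s ρ (fun v => v = enc a))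
    (ht : wp P B t ρ (fun v => v = enc b)) :
    wp P B (orT s t) ρ (fun v => v = enc (a || b)) := by
  refine hs.mono ?_
  rintro _ rfl
  cases a
  · exact ht
  · rfl

theorem wp_and {a b : Bool} (hs : wp P B s ρ (fun v => v = enc a))
    (ht : wp P B t ρ (fun v => v = enc b)) :
    wp P B (andT s t) ρ (fun v => v = enc (a && b)) := by
  have h := wp_not (wp_or (wp_not hs) (wp_not ht))
  rwa [show (!(!a || !b)) = (a && b) by cases a <;> cases b <;> rfl] at h

theorem wp_isNil {α : Type} [Enc α] {l : List α} (hs : wp P B s ρ (fun v => v = enc l)) :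
    wp P B (notT s) ρ (fun v => v = enc l.isEmpty) := by
  refine hs.mono ?_
  rintro _ rfl
  cases l <;> rfl

/-- A step of a fold that filters a list. -/
def filterStep (c : Term) : Term := .matchPair c (.pair (.var 3) (.var 2)) (.var 0)

/-- A step of a fold that looks for an element of a list. -/
def anyStep (c : Term) : Term := orT c (.var 0)

/-- A step of a fold that maps a function over a list. -/
def mapStep (c : Term) : Term := .pair c (.var 0)

end

section

variable {α β : Type} [Enc α] [Enc β] {P : Program} {Q M f : ℕ} (j : ℕ) {c : Term}
  {e : Value} {l : List α}

theorem Calls.filter {p : α → Bool} (hf : P[f]? = some (foldT f (filterStep c) .nil))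
    (hM : 1000 ≤ M) (hQ : 1 ≤ Q) (hs : c.size ≤ 480) (hl : l.length + 1 ≤ M)
    (hc : ∀ a ∈ l, ∀ r t ρ, wp P (Q * M ^ j) c (r :: enc a :: t :: e :: ρ)
      (fun v => v = enc (p a))) :
    Calls P (Q * M ^ (j + 2)) f (.pair e (enc l)) (enc (l.filter p)) := by
  have h : l.filter p = l.foldr (fun a r => if p a then a :: r else r) [] := by
    induction l with
    | nil => rfl
    | cons a l ih =>
      simp [List.filter_cons, ← ih (by simp at hl; omega) fun b hb => hc b (by simp [hb])]
  rw [h]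
  refine Calls.foldPoly j hf hM hQ (by simp only [filterStep, Term.size]; omega) hl
    (fun ρ => rfl) fun a t hat ρ => ?_
  refine (hc a (hat.subset (by simp)) _ _ _).mono ?_
  rintro _ rfl
  cases p a <;> rfl

theorem Calls.any {p : α → Bool} (hf : P[f]? = some (foldT f (anyStep c) .nil))
    (hM : 1000 ≤ M) (hQ : 1 ≤ Q) (hs : c.size ≤ 480) (hl : l.length + 1 ≤ M)
    (hc : ∀ a ∈ l, ∀ r t ρ, wp P (Q * M ^ j) c (r :: enc a :: t :: e :: ρ)
      (fun v => v = enc (p a))) :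
    Calls P (Q * M ^ (j + 2)) f (.pair e (enc l)) (enc (l.any p)) := by
  have h : l.any p = l.foldr (fun a r => p a || r) false := by
    induction l with
    | nil => rfl
    | cons a l ih =>
      simp [List.any_cons, ← ih (by simp at hl; omega) fun b hb => hc b (by simp [hb])]
  rw [h]
  refine Calls.foldPoly j hf hM hQ (by simp only [anyStep, orT, trueT, Term.size]; omega) hl
    (fun ρ => rfl) fun a t hat ρ => ?_
  exact wp_or (hc a (hat.subset (by simp)) _ _ _) rfl

theorem Calls.mapBig {L : ℕ} {g : α → β} (hf : P[f]? = some (foldT f (mapStep c) .nil))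
    (hM : 1000 ≤ M) (hQ : 1 ≤ Q) (hs : c.size ≤ 480) (hl : l.length + 1 ≤ L)
    (hc : ∀ a ∈ l, ∀ r t ρ, wp P (Q * M ^ j) c (r :: enc a :: t :: e :: ρ)
      (fun v => v = enc (g a))) :
    Calls P (L * Q * M ^ (j + 1)) f (.pair e (enc l)) (enc (l.map g)) := by
  have h : l.map g = l.foldr (fun a r => g a :: r) [] := by
    clear hl hc
    induction l with
    | nil => rfl
    | cons a l ih => simp [← ih]
  rw [h]
  refine Calls.foldBig j hf hM hQ (by simp only [mapStep, Term.size]; omega) hl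
    (fun ρ => rfl) fun a t hat ρ => ?_
  refine (hc a (hat.subset (by simp)) _ _ _).mono ?_
  rintro _ rfl
  rfl

theorem Calls.map {g : α → β} (hf : P[f]? = some (foldT f (mapStep c) .nil))
    (hM : 1000 ≤ M) (hQ : 1 ≤ Q) (hs : c.size ≤ 480) (hl : l.length + 1 ≤ M)
    (hc : ∀ a ∈ l, ∀ r t ρ, wp P (Q * M ^ j) c (r :: enc a :: t :: e :: ρ)
      (fun v => v = enc (g a))) :
    Calls P (Q * M ^ (j + 2)) f (.pair e (enc l)) (enc (l.map g)) :=
  (Calls.mapBig j hf hM hQ hs hl hc).mono (le_of_eq (by ring))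

end

/-! ### The algorithm -/

section

variable {n k : ℕ} (adj : Fin n → Fin n → Bool) (hadj : Fin k → Fin k → Bool)
  (rv : Fin n → Fin k → ℚ)

/-- The neighbors of `u` in `D`. -/
def nb (u : Fin n) (D : List (Fin n)) : List (Fin n) := D.filter fun w => adj u w

/-- The vertices of `D` other than `u` that are not adjacent to `u`. -/
def nonNb (u : Fin n) (D : List (Fin n)) : List (Fin n) :=
  D.filter fun w => !adj u w && !decide (u = w)

/-- The vertices of `D` outside `C`. -/
def diff (C D : List (Fin n)) : List (Fin n) := D.filter fun w => !decide (w ∈ C)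

/-- More than half as many vertices as in `V`. -/
def big (V W : List (Fin n)) : Bool := !((W ++ W).drop V.length).isEmpty

/-- The vertices of `D'` with more than `|V| / 2` neighbors in `D`. -/
def bigNb (V D D' : List (Fin n)) : List (Fin n) := D'.filter fun v => big V (nb adj v D)

/-- Restrict the common neighborhood `D` of a clique to the neighborhood of another vertex, if more
than `|V| / 2` vertices remain. -/
def cliqueStep (V D : List (Fin n)) : List (Fin n) :=
  match bigNb adj V D D with
  | [] => D
  | v :: _ => nb adj v D

/-- Iterate a function, as many times as the length of a list. -/
def iter {σ α : Type} (f : σ → σ) (s : σ) (l : List α) : σ := l.foldr (fun _ r => f r) s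

/-- A cut consists of two sets of vertices; the edges between them are considered as deleted. -/
abbrev Cut (n : ℕ) : Type := List (Fin n) × List (Fin n)

/-- The cut separates `u` from `v`, with `u` on the first side. -/
def Cut.sep (c : Cut n) (u v : Fin n) : Bool := decide (u ∈ c.1) && decide (v ∈ c.2)

/-- Adjacency in the graph without the edges of the cuts. -/
def adjCut (cs : List (Cut n)) (u v : Fin n) : Bool :=
  adj u v && !cs.any fun c => c.sep u v || c.sep v u

/-- The vertices of `V` that are in `S` or adjacent to `S` in the graph without the cuts. -/
def expand (cs : List (Cut n)) (V S : List (Fin n)) : List (Fin n) :=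
  V.filter fun w => decide (w ∈ S) || S.any fun s => adjCut adj cs s w

/-- The component of `v` in the graph on `V` without the cuts. -/
def reach (cs : List (Cut n)) (V : List (Fin n)) (v : Fin n) : List (Fin n) :=
  iter (expand adj cs V) [v] V

/-- The components of the graph on `V` without the cuts that meet `V'`. -/
def piecesOf (cs : List (Cut n)) (V V' : List (Fin n)) : List (List (Fin n)) :=
  V'.foldr (fun v ps => if ps.any (fun W => decide (v ∈ W)) then ps else reach adj cs V v :: ps) []

/-- The elements of `ps` with more than `|V| / 2` vertices. -/
def bigs (V : List (Fin n)) (ps : List (List (Fin n))) : List (List (Fin n)) :=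
  ps.filter fun W => big V W

/-- The vertices of `D` with a neighbor in `C`. -/
def touching (C D : List (Fin n)) : List (Fin n) := D.filter fun w => !(nb adj w C).isEmpty

/-- The components of `C` without the closed neighborhood of `u` with more than `|V| / 2`
vertices. -/
def bigComps (V C : List (Fin n)) : List (List (Fin n)) := bigs V (piecesOf adj [] C C)

/-- Extend the path ending with `s.2` towards a component of `s.1` without the closed neighborhood
of `s.2` that has more than `|V| / 2` vertices. -/
def pathStep (V : List (Fin n)) (s : List (Fin n) × Fin n) : List (Fin n) × Fin n :=
  match bigComps adj V (nonNb adj s.2 s.1) with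
  | [] => s
  | C :: _ =>
    match touching adj C (nb adj s.2 s.1) with
    | [] => s
    | w :: _ => (C, w)

/-- The common neighborhood of a maximal clique with more than `|V| / 2` common neighbors. -/
def cliquePart (V : List (Fin n)) : List (Fin n) := iter (cliqueStep adj V) V V

/-- The end of the path in the component `C` and what it does not dominate. -/
def pathPart (V C : List (Fin n)) (u : Fin n) : List (Fin n) × Fin n :=
  iter (pathStep adj V) (C, u) V

/-- The cuts inside the common neighborhood `D` of a clique. -/
def innerCuts (V D : List (Fin n)) : List (Cut n) :=
  match bigComps adj V D with
  | [] => []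
  | [] :: _ => []
  | (u :: C) :: _ =>
    [(diff (pathPart adj V (u :: C) u).1 D, (pathPart adj V (u :: C) u).1),
      (nb adj (pathPart adj V (u :: C) u).2 (pathPart adj V (u :: C) u).1,
        diff (nb adj (pathPart adj V (u :: C) u).2 (pathPart adj V (u :: C) u).1)
          (pathPart adj V (u :: C) u).1)]

/-- The cuts of the graph on `V`. -/
def cuts (V : List (Fin n)) : List (Cut n) :=
  (cliquePart adj V, diff (cliquePart adj V) V) :: innerCuts adj V (cliquePart adj V)

/-- An element of `X` other than `a` is adjacent to `q`. -/
def otherAdj (X : List (Fin n)) (a q : Fin n) : Bool :=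
  X.any fun b => !decide (a = b) && adj b q

/-- The vertex `a` of `X` has a private neighbor in `Q`. -/
def hasPrivate (Q X : List (Fin n)) (a : Fin n) : Bool :=
  Q.any fun q => adj a q && !otherAdj adj X a q

/-- All elements of `X'` have a private neighbor in `Q`, as elements of `X`, and no neighbor
in `X`. -/
def irredundant (Q X X' : List (Fin n)) : Bool :=
  !X'.any fun a => !((nb adj a X).isEmpty && hasPrivate adj Q X a)

/-- The irredundant sets obtained by adding `u` to an element of `Xs`. -/
def addVertex (Q : List (Fin n)) (u : Fin n) (Xs : List (List (Fin n))) : List (List (Fin n)) :=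
  Xs.foldr (fun X r => if irredundant adj Q (u :: X) (u :: X) then (u :: X) :: r else r) []

/-- All stable subsets of `P` such that each vertex has a private neighbor in `Q`. -/
def irredundantSets (Q P : List (Fin n)) : List (List (Fin n)) :=
  P.foldr (fun u r => addVertex adj Q u r ++ r) [[]]

/-- An option assigns a color to a vertex. -/
abbrev Opt (n k : ℕ) : Type := Fin n × Fin k

/-- A neighbor of `v` in `Q` has no neighbor in `X`. -/
def undominated (Q X : List (Fin n)) (v : Fin n) : Bool :=
  Q.any fun q => adj v q && (nb adj q X).isEmpty

/-- The option is compatible with the guess that, in the solution, the vertices of the first side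
of the cut with color `a` have the same neighbors on the second side as `X`. -/
def compatible (c : Cut n) (a : Fin k) (X : List (Fin n)) (o : Opt n k) : Bool :=
  !((decide (o.1 ∈ c.2) && !(nb adj o.1 X).isEmpty && !hadj a o.2) ||
    (decide (o.1 ∈ c.1) && decide (o.2 = a) && undominated adj c.2 X o.1))

/-- The options that are compatible with a guess. -/
def refine (c : Cut n) (a : Fin k) (X : List (Fin n)) (O : List (Opt n k)) : List (Opt n k) :=
  O.filter (compatible adj hadj c a X)

/-- Refine several lists of options. -/
def refineAll (c : Cut n) (a : Fin k) (X : List (Fin n)) (Os : List (List (Opt n k))) :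
    List (List (Opt n k)) :=
  Os.map (refine adj hadj c a X)

/-- Refine several lists of options for all guesses in `Xs`. -/
def refineSets (c : Cut n) (a : Fin k) (Os : List (List (Opt n k))) (Xs : List (List (Fin n))) :
    List (List (Opt n k)) :=
  Xs.foldr (fun X r => refineAll adj hadj c a X Os ++ r) []

/-- All refinements of `O`, one for each sequence of guesses. -/
def refinements (O : List (Opt n k)) (ts : List (Cut n × Fin k)) : List (List (Opt n k)) :=
  ts.foldr (fun t r => refineSets adj hadj t.1 t.2 r (irredundantSets adj t.1.2 t.1.1)) [O]

/-- The pairs of an element of `l` and an element of `m`. -/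
def product {α β : Type} (m : List β) (l : List α) : List (α × β) :=
  l.foldr (fun a r => m.map (fun b => (a, b)) ++ r) []

/-- The options for the vertices of `W`. -/
def optionsOn (W : List (Fin n)) (O : List (Opt n k)) : List (Opt n k) :=
  O.filter fun o => decide (o.1 ∈ W)

/-- The revenue of a list of options. -/
def value (S : List (Opt n k)) : ℚ := S.foldr (fun o r => rv o.1 o.2 + r) 0

/-- An element of the list of largest revenue. -/
def best (Ss : List (List (Opt n k))) : List (Opt n k) :=
  Ss.foldr (fun S r => if value rv S ≤ value rv r then r else S) []

/-- Solve the problem on each of the sets in `ps` and take the union. -/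
def solveAll (sol : List (Fin n) → List (Opt n k) → List (Opt n k)) (O : List (Opt n k))
    (ps : List (List (Fin n))) : List (Opt n k) :=
  ps.foldr (fun W r => sol W (optionsOn W O) ++ r) []

/-- The pieces in which the cuts divide `V`. -/
def pieces (V : List (Fin n)) : List (List (Fin n)) := piecesOf adj (cuts adj V) V V

/-- A solution of largest revenue with options from `O`, for a set `V` of at most `2 ^ d`
vertices. -/
def solve : ℕ → List (Fin n) → List (Opt n k) → List (Opt n k)
  | 0, _, O => best rv (O.map fun o => [o])
  | d + 1, V, O =>
    if V.length ≤ 1 then best rv (O.map fun o => [o])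
    else best rv ((refinements adj hadj O (product (List.finRange k) (cuts adj V))).map
      fun O' => solveAll (solve d) O' (pieces adj V))

/-- The color of `v` in the solution `S`. -/
def colorIn (S : List (Opt n k)) (v : Fin n) : Option (Fin k) :=
  S.foldr (fun o r => if v = o.1 then some o.2 else r) none

end

/-! ### The program -/

/-- These numbers are the positions of the bodies in `prog`; the lookups in the specifications hold
by `rfl` for this reason. -/
def iMain : ℕ := 0
def iDrop : ℕ := 1
def iNth : ℕ := 2
def iAdj : ℕ := 3
def iHadj : ℕ := 4
def iRev : ℕ := 5
def iEq : ℕ := 6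
def iMem : ℕ := 7
def iApp : ℕ := 8
def iNb : ℕ := 9
def iNonNb : ℕ := 10
def iDiff : ℕ := 11
def iBig : ℕ := 12
def iBigNb : ℕ := 13
def iCliqueStep : ℕ := 14
def iCliqueIter : ℕ := 15
def iSep : ℕ := 16
def iSepAny : ℕ := 17
def iAdjCut : ℕ := 18
def iAdjAny : ℕ := 19
def iExpand : ℕ := 20
def iReach : ℕ := 21
def iInAny : ℕ := 22
def iPieces : ℕ := 23
def iBigs : ℕ := 24
def iTouching : ℕ := 25
def iBigComps : ℕ := 26
def iPathStep : ℕ := 27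
def iPathIter : ℕ := 28
def iCuts : ℕ := 29
def iOther : ℕ := 30
def iPrivate : ℕ := 31
def iRedundant : ℕ := 32
def iAddVertex : ℕ := 33
def iIrrSets : ℕ := 34
def iUndom : ℕ := 35
def iCompat : ℕ := 36
def iRefine : ℕ := 37
def iRefineAll : ℕ := 38
def iRefineSets : ℕ := 39
def iRefinements : ℕ := 40
def iPairs : ℕ := 41
def iProduct : ℕ := 42
def iOptionsOn : ℕ := 43
def iValue : ℕ := 44
def iBest : ℕ := 45
def iSingletons : ℕ := 46
def iSolve : ℕ := 47
def iSolveAll : ℕ := 48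
def iMapSolve : ℕ := 49
def iSucc : ℕ := 50
def iRange : ℕ := 51
def iColor : ℕ := 52
def iOut : ℕ := 53
def iTable : ℕ := 54

def mainBody : Term :=
  .letIn (.pair (fstT (.var 0)) (.pair (sndT (.var 0)) (.call iTable .nil))) (.letIn (.call
  iRange (.pair .nil (fstT (.var 0)))) (.letIn (.call iRange (.pair .nil (sndT (sndT (.var
  1))))) (.call iOut (.pair (.call iSolve (.pair (.pair (.var 2) (.var 0)) (.pair (.var 1)
  (.call iProduct (.pair (.var 0) (.var 1)))))) (.var 1)))))

/-- The list that is folded over only serves as a unary counter. The tail of `nil` is `nil`, so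
dropping too much is harmless. -/
def dropBody : Term :=
  foldT iDrop (sndT (.var 0)) (.var 0)

def nthBody : Term :=
  fstT (.call iDrop (.var 0))

def adjBody : Term :=
  .call iNth (.pair (.call iNth (.pair (fstT (fstT (.var 0))) (fstT (sndT (.var 0))))) (sndT
  (sndT (.var 0))))

def hadjBody : Term :=
  .call iNth (.pair (.call iNth (.pair (sndT (sndT (fstT (.var 0)))) (fstT (sndT (.var 0)))))
  (sndT (sndT (.var 0))))

def revBody : Term :=
  .call iNth (.pair (.call iNth (.pair (fstT (sndT (fstT (.var 0)))) (fstT (sndT (.var 0)))))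
  (sndT (sndT (.var 0))))

/-- Without a primitive for equality, two unary numbers are compared by dropping each from the other
and testing that nothing remains. -/
def eqBody : Term :=
  andT (notT (.call iDrop (.pair (fstT (.var 0)) (sndT (.var 0))))) (notT (.call iDrop (.pair
  (sndT (.var 0)) (fstT (.var 0)))))

def memBody : Term :=
  foldT iMem (anyStep (.call iEq (.pair (.var 3) (.var 1)))) .nil

def appBody : Term :=
  foldT iApp (.pair (.var 1) (.var 0)) (.var 0)

def nbBody : Term :=
  foldT iNb (filterStep (.call iAdj (.pair (fstT (.var 3)) (.pair (sndT (.var 3)) (.var 1)))))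
  .nil

def nonNbBody : Term :=
  foldT iNonNb (filterStep (andT (notT (.call iAdj (.pair (fstT (.var 3)) (.pair (sndT (.var 3))
  (.var 1))))) (notT (.call iEq (.pair (sndT (.var 3)) (.var 1)))))) .nil

def diffBody : Term :=
  foldT iDiff (filterStep (notT (.call iMem (.pair (.var 1) (.var 3))))) .nil

/-- The inequality |V| < 2|W| is tested without numbers: something remains when |V| elements are
dropped from two copies of W. -/
def bigBody : Term :=
  notT (notT (.call iDrop (.pair (.call iApp (.pair (sndT (.var 0)) (sndT (.var 0)))) (fstT
  (.var 0)))))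

def bigNbBody : Term :=
  foldT iBigNb (filterStep (.call iBig (.pair (fstT (sndT (.var 3))) (.call iNb (.pair (.pair
  (fstT (.var 3)) (.var 1)) (sndT (sndT (.var 3)))))))) .nil

def cliqueStepBody : Term :=
  .matchPair (.call iBigNb (.pair (.pair (fstT (fstT (.var 0))) (.pair (sndT (fstT (.var 0)))
  (sndT (.var 0)))) (sndT (.var 0)))) (.call iNb (.pair (.pair (fstT (fstT (.var 2))) (.var 0))
  (sndT (.var 2)))) (sndT (.var 0))

def cliqueIterBody : Term :=
  foldT iCliqueIter (.call iCliqueStep (.pair (fstT (.var 3)) (.var 0))) (sndT (.var 0))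

def sepBody : Term :=
  andT (.call iMem (.pair (fstT (fstT (.var 0))) (fstT (sndT (.var 0))))) (.call iMem (.pair
  (sndT (fstT (.var 0))) (sndT (sndT (.var 0)))))

def sepAnyBody : Term :=
  foldT iSepAny (anyStep (orT (.call iSep (.pair (.var 3) (.var 1))) (.call iSep (.pair (.pair
  (sndT (.var 3)) (fstT (.var 3))) (.var 1))))) .nil

def adjCutBody : Term :=
  andT (.call iAdj (.pair (fstT (fstT (.var 0))) (sndT (.var 0)))) (notT (.call iSepAny (.pair
  (sndT (.var 0)) (sndT (fstT (.var 0))))))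

def adjAnyBody : Term :=
  foldT iAdjAny (anyStep (.call iAdjCut (.pair (fstT (.var 3)) (.pair (.var 1) (sndT (.var
  3)))))) .nil

def expandBody : Term :=
  foldT iExpand (filterStep (orT (.call iMem (.pair (.var 1) (sndT (.var 3)))) (.call iAdjAny
  (.pair (.pair (fstT (.var 3)) (.var 1)) (sndT (.var 3)))))) .nil

def reachBody : Term :=
  foldT iReach (.call iExpand (.pair (.pair (fstT (fstT (.var 3))) (.var 0)) (sndT (fstT (.var
  3))))) (sndT (.var 0))

def inAnyBody : Term :=
  foldT iInAny (anyStep (.call iMem (.pair (.var 3) (.var 1)))) .nil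

def piecesBody : Term :=
  foldT iPieces (.matchPair (notT (.call iInAny (.pair (.var 1) (.var 0)))) (.pair (.call iReach
  (.pair (.pair (.var 5) (.pair (.var 3) .nil)) (sndT (.var 5)))) (.var 2)) (.var 0)) .nil

def bigsBody : Term :=
  foldT iBigs (filterStep (.call iBig (.pair (.var 3) (.var 1)))) .nil

def touchingBody : Term :=
  foldT iTouching (filterStep (notT (notT (.call iNb (.pair (.pair (fstT (.var 3)) (.var 1))
  (sndT (.var 3))))))) .nil

def bigCompsBody : Term :=
  .call iBigs (.pair (sndT (fstT (.var 0))) (.call iPieces (.pair (.pair (.pair (fstT (fstT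
  (.var 0))) .nil) (sndT (.var 0))) (sndT (.var 0)))))

def pathStepBody : Term :=
  .matchPair (.call iBigComps (.pair (fstT (.var 0)) (.call iNonNb (.pair (.pair (fstT (fstT
  (.var 0))) (sndT (sndT (.var 0)))) (fstT (sndT (.var 0))))))) (.matchPair (.call iTouching
  (.pair (.pair (fstT (fstT (.var 2))) (.var 0)) (.call iNb (.pair (.pair (fstT (fstT (.var 2)))
  (sndT (sndT (.var 2)))) (fstT (sndT (.var 2))))))) (.pair (.var 2) (.var 0)) (sndT (.var 2)))
  (sndT (.var 0))

def pathIterBody : Term :=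
  foldT iPathIter (.call iPathStep (.pair (fstT (.var 3)) (.var 0))) (sndT (.var 0))

def cutsBody : Term :=
  .letIn (.call iCliqueIter (.pair (.pair (.var 0) (sndT (.var 0))) (sndT (.var 0)))) (.pair
  (.pair (.var 0) (.call iDiff (.pair (.var 0) (sndT (.var 1))))) (.matchPair (.call iBigComps
  (.pair (.var 1) (.var 0))) (.matchPair (.var 0) (.letIn (.call iPathIter (.pair (.pair (.var
  5) (.pair (.var 2) (.var 0))) (sndT (.var 5)))) (.letIn (.call iNb (.pair (.pair (fstT (.var
  6)) (sndT (.var 0))) (fstT (.var 0)))) (.pair (.pair (.call iDiff (.pair (fstT (.var 1)) (.var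
  6))) (fstT (.var 1))) (.pair (.pair (.var 0) (.call iDiff (.pair (.var 0) (fstT (.var 1)))))
  .nil)))) .nil) .nil))

def otherBody : Term :=
  foldT iOther (anyStep (andT (notT (.call iEq (.pair (fstT (sndT (.var 3))) (.var 1)))) (.call
  iAdj (.pair (fstT (.var 3)) (.pair (.var 1) (sndT (sndT (.var 3)))))))) .nil

def privateBody : Term :=
  foldT iPrivate (anyStep (andT (.call iAdj (.pair (fstT (.var 3)) (.pair (fstT (sndT (.var 3)))
  (.var 1)))) (notT (.call iOther (.pair (.pair (fstT (.var 3)) (.pair (fstT (sndT (.var 3)))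
  (.var 1))) (sndT (sndT (.var 3)))))))) .nil

def redundantBody : Term :=
  foldT iRedundant (anyStep (notT (andT (notT (.call iNb (.pair (.pair (fstT (.var 3)) (.var 1))
  (sndT (sndT (.var 3)))))) (.call iPrivate (.pair (.pair (fstT (.var 3)) (.pair (.var 1) (sndT
  (sndT (.var 3))))) (fstT (sndT (.var 3)))))))) .nil

def addVertexBody : Term :=
  foldT iAddVertex (.matchPair (.call iRedundant (.pair (.pair (fstT (fstT (.var 3))) (.pair
  (sndT (fstT (.var 3))) (.pair (sndT (.var 3)) (.var 1)))) (.pair (sndT (.var 3)) (.var 1))))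
  (.var 2) (.pair (.pair (sndT (.var 3)) (.var 1)) (.var 0))) .nil

def irrSetsBody : Term :=
  foldT iIrrSets (.call iApp (.pair (.var 0) (.call iAddVertex (.pair (.pair (.var 3) (.var 1))
  (.var 0))))) (.pair .nil .nil)

def undomBody : Term :=
  foldT iUndom (anyStep (andT (.call iAdj (.pair (fstT (.var 3)) (.pair (fstT (sndT (.var 3)))
  (.var 1)))) (notT (.call iNb (.pair (.pair (fstT (.var 3)) (.var 1)) (sndT (sndT (.var
  3)))))))) .nil

def compatBody : Term :=
  notT (orT (andT (andT (.call iMem (.pair (fstT (sndT (.var 0))) (sndT (fstT (fstT (sndT (fstT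
  (.var 0)))))))) (notT (notT (.call iNb (.pair (.pair (fstT (fstT (.var 0))) (fstT (sndT (.var
  0)))) (sndT (sndT (fstT (.var 0))))))))) (notT (.call iHadj (.pair (fstT (fstT (.var 0)))
  (.pair (sndT (fstT (sndT (fstT (.var 0))))) (sndT (sndT (.var 0)))))))) (andT (andT (.call
  iMem (.pair (fstT (sndT (.var 0))) (fstT (fstT (fstT (sndT (fstT (.var 0)))))))) (.call iEq
  (.pair (sndT (sndT (.var 0))) (sndT (fstT (sndT (fstT (.var 0)))))))) (.call iUndom (.pair
  (.pair (fstT (fstT (.var 0))) (.pair (fstT (sndT (.var 0))) (sndT (sndT (fstT (.var 0))))))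
  (sndT (fstT (fstT (sndT (fstT (.var 0))))))))))

def refineBody : Term :=
  foldT iRefine (filterStep (.call iCompat (.pair (.var 3) (.var 1)))) .nil

def refineAllBody : Term :=
  foldT iRefineAll (mapStep (.call iRefine (.pair (.var 3) (.var 1)))) .nil

def refineSetsBody : Term :=
  foldT iRefineSets (.call iApp (.pair (.var 0) (.call iRefineAll (.pair (.pair (fstT (.var 3))
  (.pair (fstT (sndT (.var 3))) (.var 1))) (sndT (sndT (.var 3))))))) .nil

def refinementsBody : Term :=
  foldT iRefinements (.call iRefineSets (.pair (.pair (fstT (.var 3)) (.pair (.var 1) (.var 0)))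
  (.call iIrrSets (.pair (.pair (fstT (.var 3)) (sndT (fstT (.var 1)))) (fstT (fstT (.var
  1))))))) (.pair (sndT (.var 0)) .nil)

def pairsBody : Term :=
  foldT iPairs (mapStep (.pair (.var 3) (.var 1))) .nil

def productBody : Term :=
  foldT iProduct (.call iApp (.pair (.var 0) (.call iPairs (.pair (.var 1) (.var 3))))) .nil

def optionsOnBody : Term :=
  foldT iOptionsOn (filterStep (.call iMem (.pair (fstT (.var 1)) (.var 3)))) .nil

def valueBody : Term :=
  foldT iValue (.add (.call iRev (.pair (.var 3) (.var 1))) (.var 0)) .zero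

def bestBody : Term :=
  foldT iBest (.ifLe (.call iValue (.pair (.var 3) (.var 1))) (.call iValue (.pair (.var 3)
  (.var 0))) (.var 0) (.var 1)) .nil

def singletonsBody : Term :=
  foldT iSingletons (mapStep (.pair (.var 1) .nil)) .nil

/-- There is no counter for the depth here, in contrast to `solve`: the two nested matches stop the
recursion at lists with at most one vertex. -/
def solveBody : Term :=
  .matchPair (fstT (sndT (.var 0))) (.matchPair (.var 1) (.letIn (.call iCuts (.pair (fstT (fstT
  (.var 4))) (fstT (sndT (.var 4))))) (.call iBest (.pair (fstT (fstT (.var 5))) (.call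
  iMapSolve (.pair (.pair (fstT (.var 5)) (.call iPieces (.pair (.pair (.pair (fstT (fstT (.var
  5))) (.var 0)) (fstT (sndT (.var 5)))) (fstT (sndT (.var 5)))))) (.call iRefinements (.pair
  (.pair (fstT (fstT (.var 5))) (sndT (sndT (.var 5)))) (.call iProduct (.pair (sndT (fstT (.var
  5))) (.var 0)))))))))) (.call iBest (.pair (fstT (fstT (.var 2))) (.call iSingletons (.pair
  .nil (sndT (sndT (.var 2)))))))) (.call iBest (.pair (fstT (fstT (.var 0))) (.call iSingletons
  (.pair .nil (sndT (sndT (.var 0)))))))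

def solveAllBody : Term :=
  foldT iSolveAll (.call iApp (.pair (.var 0) (.call iSolve (.pair (fstT (.var 3)) (.pair (.var
  1) (.call iOptionsOn (.pair (.var 1) (sndT (.var 3))))))))) .nil

def mapSolveBody : Term :=
  foldT iMapSolve (mapStep (.call iSolveAll (.pair (.pair (fstT (.var 3)) (.var 1)) (sndT (.var
  3))))) .nil

def succBody : Term :=
  foldT iSucc (mapStep (.pair .nil (.var 1))) .nil

def rangeBody : Term :=
  foldT iRange (.pair .nil (.call iSucc (.pair .nil (.var 0)))) .nil

def colorBody : Term :=
  foldT iColor (.matchPair (notT (.call iEq (.pair (.var 3) (fstT (.var 1))))) (.var 2) (.pair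
  (sndT (.var 1)) .nil)) .nil

def outBody : Term :=
  foldT iOut (mapStep (.call iColor (.pair (.var 1) (.var 3)))) .nil

/-- The expression without variables whose value is the given tree. -/
def constT : Value → Term
  | .nil => .nil
  | .pair a b => .pair (constT a) (constT b)
  | .num _ => .zero

/-- The table of a function of two arguments. -/
def matrix {m n : ℕ} {α : Type} [Enc α] (f : Fin m → Fin n → α) : Value :=
  encodeList (List.ofFn fun u => encodeList (List.ofFn fun v => enc (f u v)))

/-- The program. -/
def prog {k : ℕ} (hadj : Fin k → Fin k → Bool) : Program :=
  [mainBody, dropBody, nthBody, adjBody, hadjBody, revBody, eqBody, memBody, appBody, nbBody,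
  nonNbBody, diffBody, bigBody, bigNbBody, cliqueStepBody, cliqueIterBody, sepBody, sepAnyBody,
  adjCutBody, adjAnyBody, expandBody, reachBody, inAnyBody, piecesBody, bigsBody, touchingBody,
  bigCompsBody, pathStepBody, pathIterBody, cutsBody, otherBody, privateBody, redundantBody,
  addVertexBody, irrSetsBody, undomBody, compatBody, refineBody, refineAllBody, refineSetsBody,
  refinementsBody, pairsBody, productBody, optionsOnBody, valueBody, bestBody, singletonsBody,
  solveBody, solveAllBody, mapSolveBody, succBody, rangeBody, colorBody, outBody, constT (matrix
  hadj)]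
/-! ### What the functions of the program compute -/

/-- The parameters of the bounds on the number of steps. -/
structure Bounds (n k M Q : ℕ) : Prop where
  hM : 1000 ≤ M
  hQ : 1 ≤ Q
  hn : n < M
  hk : k < M

/-- The tables that all functions of the program have access to. -/
def env {n k : ℕ} (adj : Fin n → Fin n → Bool) (hadj : Fin k → Fin k → Bool)
    (rv : Fin n → Fin k → ℚ) : Value :=
  .pair (matrix adj) (.pair (matrix rv) (matrix hadj))

/-! ### Rules of the calculus for expressions with a known value -/

section

variable {P : Program} {B : ℕ} {s t : Term} {ρ : List Value} {a b : Value}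

theorem wp_call {f : ℕ} (hs : wp P B s ρ (fun v => v = a)) (h : Calls P B f a b) :
    wp P B (.call f s) ρ (fun v => v = b) :=
  hs.mono fun _ hv => ⟨b, hv ▸ h, rfl⟩

theorem wp_pair (hs : wp P B s ρ (fun v => v = a)) (ht : wp P B t ρ (fun v => v = b)) :
    wp P B (.pair s t) ρ (fun v => v = .pair a b) :=
  hs.mono fun _ hv => ht.mono fun _ hw => by rw [hv, hw]

theorem wp_let {Q : Value → Prop} (hs : wp P B s ρ (fun v => v = a)) (ht : wp P B t (a :: ρ) Q) :
    wp P B (.letIn s t) ρ Q :=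
  hs.mono fun _ hv => hv ▸ ht

theorem wp_ite {c : Term} {β : Bool} {Q : Value → Prop} (hc : wp P B c ρ (fun v => v = enc β))
    (hs : β = true → wp P B s (.nil :: .nil :: ρ) Q) (ht : β = false → wp P B t ρ Q) :
    wp P B (.matchPair c s t) ρ Q := by
  refine hc.mono ?_
  rintro _ rfl
  cases β
  · exact ht rfl
  · exact hs rfl

theorem wp_match {α : Type} [Enc α] {c : Term} {l : List α} {Q : Value → Prop}
    (hc : wp P B c ρ (fun v => v = enc l))
    (hs : ∀ a l', l = a :: l' → wp P B s (enc a :: enc l' :: ρ) Q) (ht : l = [] → wp P B t ρ Q) :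
    wp P B (.matchPair c s t) ρ Q := by
  refine hc.mono ?_
  rintro _ rfl
  cases l
  · exact ht rfl
  · exact hs _ _ rfl

end

/-! ### Specifications: tables, vertex sets, components and cuts -/

section

variable {n k M Q : ℕ} {adj : Fin n → Fin n → Bool} {hadj : Fin k → Fin k → Bool}
  {rv : Fin n → Fin k → ℚ}

theorem drop_spec (h : Bounds n k M Q) {α β : Type} [Enc α] [Enc β] (l : List α) (i : List β)
    (hi : i.length < M) :
    Calls (prog hadj) (Q * M ^ 2) iDrop (.pair (enc l) (enc i)) (enc (l.drop i.length)) := by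
  have h1 : l.drop i.length = i.foldr (fun _ r => r.tail) l := by
    clear hi
    induction i with
    | nil => rfl
    | cons a i ih => rw [List.foldr_cons, ← ih]; simp
  rw [h1]
  refine Calls.foldPoly 0 rfl h.hM h.hQ (by decide) hi (fun ρ => rfl) fun a t _ ρ => ?_
  generalize t.foldr _ l = r
  cases r <;> rfl

theorem nth_spec (h : Bounds n k M Q) {α : Type} [Enc α] {m : ℕ} (l : List α) (i : Fin m)
    (hi : i.val < l.length) (hm : m ≤ M) :
    Calls (prog hadj) (Q * M ^ 3) iNth (.pair (enc l) (enc i)) (enc l[i.val]) := by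
  refine Calls.body 2 rfl h.hM h.hQ (by decide) ?_
  have h1 := drop_spec (hadj := hadj) h l (List.replicate i.val ()) (by simp; omega)
  rw [← enc_fin, List.length_replicate, List.drop_eq_getElem_cons hi] at h1
  exact ⟨_, h1, rfl⟩

theorem matrix_eq {m m' : ℕ} {α : Type} [Enc α] (f : Fin m → Fin m' → α) :
    matrix f = enc (List.ofFn fun u => List.ofFn fun v => f u v) := by
  simp only [matrix, enc, List.map_ofFn, Function.comp_def]

theorem table_spec (h : Bounds n k M Q) {m m' : ℕ} {α : Type} [Enc α] (f : Fin m → Fin m' → α)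
    (u : Fin m) (v : Fin m') (hm : m < M) (hm' : m' < M) {ρ : List Value} {s t r : Term}
    (hs : wp (prog hadj) (Q * M ^ 3) s ρ (fun x => x = matrix f))
    (ht : wp (prog hadj) (Q * M ^ 3) t ρ (fun x => x = enc u))
    (hr : wp (prog hadj) (Q * M ^ 3) r ρ (fun x => x = enc v)) :
    wp (prog hadj) (Q * M ^ 3) (.call iNth (.pair (.call iNth (.pair s t)) r)) ρ
      (fun x => x = enc (f u v)) := by
  have h1 := nth_spec (hadj := hadj) h (List.ofFn fun u => List.ofFn fun v => f u v) u (by simp)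
    hm.le
  have h2 := nth_spec (hadj := hadj) h (List.ofFn fun v => f u v) v (by simp) hm'.le
  rw [List.getElem_ofFn] at h1 h2
  rw [matrix_eq] at hs
  exact wp_call (wp_pair (wp_call (wp_pair hs ht) h1) hr) h2

theorem adj_spec (h : Bounds n k M Q) (u v : Fin n) :
    Calls (prog hadj) (Q * M ^ 4) iAdj (.pair (env adj hadj rv) (.pair (enc u) (enc v)))
      (enc (adj u v)) :=
  Calls.body 3 rfl h.hM h.hQ (by decide) (table_spec h adj u v h.hn h.hn rfl rfl rfl)

theorem hadj_spec (h : Bounds n k M Q) (u v : Fin k) :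
    Calls (prog hadj) (Q * M ^ 4) iHadj (.pair (env adj hadj rv) (.pair (enc u) (enc v)))
      (enc (hadj u v)) :=
  Calls.body 3 rfl h.hM h.hQ (by decide) (table_spec h hadj u v h.hk h.hk rfl rfl rfl)

theorem rev_spec (h : Bounds n k M Q) (u : Fin n) (v : Fin k) :
    Calls (prog hadj) (Q * M ^ 4) iRev (.pair (env adj hadj rv) (.pair (enc u) (enc v)))
      (enc (rv u v)) :=
  Calls.body 3 rfl h.hM h.hQ (by decide) (table_spec h rv u v h.hn h.hk rfl rfl rfl)

theorem eq_spec (h : Bounds n k M Q) {m : ℕ} (u v : Fin m) (hm : m ≤ M) :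
    Calls (prog hadj) (Q * M ^ 3) iEq (.pair (enc u) (enc v)) (enc (decide (u = v))) := by
  refine Calls.body 2 rfl h.hM h.hQ (by decide) ?_
  have h1 := drop_spec (hadj := hadj) h (List.replicate u.val ()) (List.replicate v.val ())
    (by simp; omega)
  have h2 := drop_spec (hadj := hadj) h (List.replicate v.val ()) (List.replicate u.val ())
    (by simp; omega)
  rw [← enc_fin, ← enc_fin] at h1 h2
  have h3 := wp_and (ρ := [.pair (enc u) (enc v)])
    (wp_isNil (wp_call (s := .pair (fstT (.var 0)) (sndT (.var 0))) rfl h1))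
    (wp_isNil (wp_call (s := .pair (sndT (.var 0)) (fstT (.var 0))) rfl h2))
  refine h3.mono fun x hx => hx.trans (congrArg (enc (α := Bool)) ?_)
  rw [Bool.eq_iff_iff]
  simp [Fin.ext_iff]
  omega

theorem mem_spec (h : Bounds n k M Q) {m : ℕ} (u : Fin m) (l : List (Fin m)) (hm : m ≤ M)
    (hl : l.length < M) :
    Calls (prog hadj) (Q * M ^ 5) iMem (.pair (enc u) (enc l)) (enc (decide (u ∈ l))) := by
  have h1 : decide (u ∈ l) = l.any fun w => decide (u = w) := by
    rw [Bool.eq_iff_iff]; simp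
  rw [h1]
  exact Calls.any 3 rfl h.hM h.hQ (by decide) hl fun w hw r t ρ => wp_call rfl (eq_spec h u w hm)

theorem appBig_spec (h : Bounds n k M Q) {α : Type} [Enc α] {L : ℕ} (l l' : List α)
    (hl : l.length < L) :
    Calls (prog hadj) (L * Q * M ^ 1) iApp (.pair (enc l') (enc l)) (enc (l ++ l')) := by
  have h1 : l ++ l' = l.foldr (fun a r => a :: r) l' := by simp
  rw [h1]
  exact Calls.foldBig 0 rfl h.hM h.hQ (by decide) hl (fun ρ => rfl) fun a t _ ρ => rfl

theorem app_spec (h : Bounds n k M Q) {α : Type} [Enc α] (l l' : List α)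
    (hl : l.length < M) :
    Calls (prog hadj) (Q * M ^ 2) iApp (.pair (enc l') (enc l)) (enc (l ++ l')) :=
  (appBig_spec h l l' hl).mono (le_of_eq (by ring))

theorem nb_spec (h : Bounds n k M Q) (u : Fin n) (D : List (Fin n)) (hD : D.length < M) :
    Calls (prog hadj) (Q * M ^ 6) iNb (.pair (.pair (env adj hadj rv) (enc u)) (enc D))
      (enc (nb adj u D)) :=
  Calls.filter 4 rfl h.hM h.hQ (by decide) hD fun w _ r t ρ => wp_call rfl (adj_spec h u w)

theorem nonNb_spec (h : Bounds n k M Q) (u : Fin n) (D : List (Fin n)) (hD : D.length < M) :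
    Calls (prog hadj) (Q * M ^ 6) iNonNb (.pair (.pair (env adj hadj rv) (enc u)) (enc D))
      (enc (nonNb adj u D)) :=
  Calls.filter 4 rfl h.hM h.hQ (by decide) hD fun w _ r t ρ =>
    wp_and (wp_not (wp_call rfl (adj_spec h u w)))
      (wp_not (wp_call rfl ((eq_spec h u w h.hn.le).up 4 h.hM (by decide))))

theorem diff_spec (h : Bounds n k M Q) (C D : List (Fin n)) (hC : C.length < M)
    (hD : D.length < M) :
    Calls (prog hadj) (Q * M ^ 7) iDiff (.pair (enc C) (enc D)) (enc (diff C D)) :=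
  Calls.filter 5 rfl h.hM h.hQ (by decide) hD fun w _ r t ρ =>
    wp_not (wp_call rfl (mem_spec h w C h.hn.le hC))

theorem big_spec (h : Bounds n k M Q) (V W : List (Fin n)) (hV : V.length < M)
    (hW : W.length < M) :
    Calls (prog hadj) (Q * M ^ 3) iBig (.pair (enc V) (enc W)) (enc (big V W)) :=
  Calls.body 2 rfl h.hM h.hQ (by decide)
    (wp_not (wp_isNil (wp_call (wp_pair (wp_call rfl (app_spec h W W hW)) rfl)
      (drop_spec h (W ++ W) V hV))))

theorem bigNb_spec (h : Bounds n k M Q) (V D D' : List (Fin n)) (hV : V.length < M)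
    (hD : D.length < M) (hD' : D'.length < M) :
    Calls (prog hadj) (Q * M ^ 8) iBigNb
      (.pair (.pair (env adj hadj rv) (.pair (enc V) (enc D))) (enc D'))
      (enc (bigNb adj V D D')) :=
  Calls.filter 6 rfl h.hM h.hQ (by decide) hD' fun v _ r t ρ =>
    wp_call (wp_pair rfl (wp_call rfl (nb_spec h v D hD)))
      ((big_spec h V _ hV ((List.length_filter_le _ _).trans_lt hD)).up 6 h.hM (by decide))

theorem length_cliqueStep (V D : List (Fin n)) : (cliqueStep adj V D).length ≤ D.length := by
  unfold cliqueStep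
  split
  · rfl
  · exact List.length_filter_le _ _

theorem cliqueStep_spec (h : Bounds n k M Q) (V D : List (Fin n)) (hV : V.length < M)
    (hD : D.length < M) :
    Calls (prog hadj) (Q * M ^ 9) iCliqueStep
      (.pair (.pair (env adj hadj rv) (enc V)) (enc D)) (enc (cliqueStep adj V D)) := by
  refine Calls.body 8 rfl h.hM h.hQ (by decide) ?_
  refine wp_match (wp_call rfl (bigNb_spec h V D D hV hD hD)) (fun v l hl => ?_) fun hl => ?_
  · rw [show cliqueStep adj V D = nb adj v D by simp only [cliqueStep, hl]]
    exact wp_call rfl ((nb_spec h v D hD).up 8 h.hM (by decide))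
  · rw [show cliqueStep adj V D = D by simp only [cliqueStep, hl]]
    rfl

theorem length_foldr_cliqueStep {α : Type} (V : List (Fin n)) (t : List α) :
    (t.foldr (fun _ r => cliqueStep adj V r) V).length ≤ V.length := by
  induction t with
  | nil => exact le_rfl
  | cons b t ih => exact (length_cliqueStep _ _).trans ih

theorem cliqueIter_spec (h : Bounds n k M Q) (V : List (Fin n)) (hV : V.length < M) :
    Calls (prog hadj) (Q * M ^ 11) iCliqueIter
      (.pair (.pair (.pair (env adj hadj rv) (enc V)) (enc V)) (enc V))
      (enc (cliquePart adj V)) :=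
  Calls.foldPoly 9 rfl h.hM h.hQ (by decide) hV (fun ρ => rfl) fun a t _ ρ =>
    wp_call rfl (cliqueStep_spec h V _ hV ((length_foldr_cliqueStep V t).trans_lt hV))

theorem sep_spec (h : Bounds n k M Q) (u v : Fin n) (c : Cut n) (h1 : c.1.length < M)
    (h2 : c.2.length < M) :
    Calls (prog hadj) (Q * M ^ 6) iSep (.pair (.pair (enc u) (enc v)) (enc c))
      (enc (c.sep u v)) :=
  Calls.body 5 rfl h.hM h.hQ (by decide)
    (wp_and (wp_call rfl (mem_spec h u c.1 h.hn.le h1)) (wp_call rfl (mem_spec h v c.2 h.hn.le h2)))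

/-- The lists that describe the cuts are short. -/
def SmallCuts (M : ℕ) (cs : List (Cut n)) : Prop :=
  cs.length < M ∧ ∀ c ∈ cs, c.1.length < M ∧ c.2.length < M

theorem sepAny_spec (h : Bounds n k M Q) (u v : Fin n) (cs : List (Cut n)) (hcs : SmallCuts M cs) :
    Calls (prog hadj) (Q * M ^ 8) iSepAny (.pair (.pair (enc u) (enc v)) (enc cs))
      (enc (cs.any fun c => c.sep u v || c.sep v u)) :=
  Calls.any 6 rfl h.hM h.hQ (by decide) hcs.1 fun c hc r t ρ =>
    wp_or (wp_call rfl (sep_spec h u v c (hcs.2 c hc).1 (hcs.2 c hc).2))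
      (wp_call rfl (sep_spec h v u c (hcs.2 c hc).1 (hcs.2 c hc).2))

theorem adjCut_spec (h : Bounds n k M Q) (u v : Fin n) (cs : List (Cut n))
    (hcs : SmallCuts M cs) :
    Calls (prog hadj) (Q * M ^ 9) iAdjCut
      (.pair (.pair (env adj hadj rv) (enc cs)) (.pair (enc u) (enc v)))
      (enc (adjCut adj cs u v)) :=
  Calls.body 8 rfl h.hM h.hQ (by decide)
    (wp_and (wp_call rfl ((adj_spec h u v).up 8 h.hM (by decide)))
      (wp_not (wp_call rfl (sepAny_spec h u v cs hcs))))

theorem adjAny_spec (h : Bounds n k M Q) (w : Fin n) (S : List (Fin n)) (cs : List (Cut n))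
    (hcs : SmallCuts M cs) (hS : S.length < M) :
    Calls (prog hadj) (Q * M ^ 11) iAdjAny
      (.pair (.pair (.pair (env adj hadj rv) (enc cs)) (enc w)) (enc S))
      (enc (S.any fun s => adjCut adj cs s w)) :=
  Calls.any 9 rfl h.hM h.hQ (by decide) hS fun s _ r t ρ =>
    wp_call rfl (adjCut_spec h s w cs hcs)

theorem expand_spec (h : Bounds n k M Q) (V S : List (Fin n)) (cs : List (Cut n))
    (hcs : SmallCuts M cs) (hS : S.length < M) (hV : V.length < M) :
    Calls (prog hadj) (Q * M ^ 13) iExpand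
      (.pair (.pair (.pair (env adj hadj rv) (enc cs)) (enc S)) (enc V))
      (enc (expand adj cs V S)) :=
  Calls.filter 11 rfl h.hM h.hQ (by decide) hV fun w _ r t ρ =>
    wp_or (wp_call rfl ((mem_spec h w S h.hn.le hS).up 11 h.hM (by decide)))
      (wp_call rfl (adjAny_spec h w S cs hcs hS))

/-- The 1 in the maximum is the length of the initial list `[v]`, which remains if no iteration
takes place. -/
theorem length_foldr_expand {α : Type} (cs : List (Cut n)) (V : List (Fin n)) (v : Fin n)
    (t : List α) : (t.foldr (fun _ r => expand adj cs V r) [v]).length ≤ max 1 V.length := by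
  cases t with
  | nil => exact le_max_left _ _
  | cons b t => exact (List.length_filter_le _ _).trans (le_max_right _ _)

theorem reach_spec (h : Bounds n k M Q) (V : List (Fin n)) (v : Fin n) (cs : List (Cut n))
    (hcs : SmallCuts M cs) (hV : V.length < M) :
    Calls (prog hadj) (Q * M ^ 15) iReach
      (.pair (.pair (.pair (.pair (env adj hadj rv) (enc cs)) (enc V)) (.pair (enc v) .nil)) (enc V))
      (enc (reach adj cs V v)) :=
  Calls.foldPoly 13 rfl h.hM h.hQ (by decide) hV (fun ρ => rfl) fun a t _ ρ =>
    wp_call rfl (expand_spec h V _ cs hcs ((length_foldr_expand cs V v t).trans_lt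
      (max_lt (by have := h.hM; omega) hV)) hV)

theorem length_piecesOf (cs : List (Cut n)) (V V' : List (Fin n)) :
    (piecesOf adj cs V V').length ≤ V'.length := by
  induction V' with
  | nil => exact le_rfl
  | cons v t ih =>
    simp only [piecesOf, List.foldr_cons] at ih ⊢
    split
    · exact ih.trans (Nat.le_succ _)
    · exact Nat.succ_le_succ ih

theorem length_of_mem_piecesOf {cs : List (Cut n)} {V V' W : List (Fin n)}
    (hW : W ∈ piecesOf adj cs V V') : W.length ≤ max 1 V.length := by
  induction V' with
  | nil => simp [piecesOf] at hW
  | cons v t ih =>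
    simp only [piecesOf, List.foldr_cons] at ih hW
    split at hW
    · exact ih hW
    · rcases List.mem_cons.1 hW with rfl | hW
      · exact length_foldr_expand cs V v V
      · exact ih hW

theorem inAny_spec (h : Bounds n k M Q) (v : Fin n) (ps : List (List (Fin n)))
    (hps : ps.length < M) (hps' : ∀ W ∈ ps, W.length < M) :
    Calls (prog hadj) (Q * M ^ 7) iInAny (.pair (enc v) (enc ps))
      (enc (ps.any fun W => decide (v ∈ W))) :=
  Calls.any 5 rfl h.hM h.hQ (by decide) hps fun W hW r t ρ =>
    wp_call rfl (mem_spec h v W h.hn.le (hps' W hW))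

theorem pieces_spec (h : Bounds n k M Q) (V V' : List (Fin n)) (cs : List (Cut n))
    (hcs : SmallCuts M cs) (hV : V.length < M) (hV' : V'.length < M) :
    Calls (prog hadj) (Q * M ^ 17) iPieces
      (.pair (.pair (.pair (env adj hadj rv) (enc cs)) (enc V)) (enc V'))
      (enc (piecesOf adj cs V V')) := by
  refine Calls.foldPoly 15 rfl h.hM h.hQ (by decide) hV' (fun ρ => rfl) fun v t hvt ρ => ?_
  have ht : t.length < M := by have := hvt.length_le; simp at this; omega
  change wp _ _ _ _ fun x => x = enc (if (piecesOf adj cs V t).any fun W => decide (v ∈ W) then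
    piecesOf adj cs V t else reach adj cs V v :: piecesOf adj cs V t)
  refine wp_ite (wp_not (wp_call rfl ((inAny_spec h v _ ((length_piecesOf cs V t).trans_lt ht)
    fun W hW => (length_of_mem_piecesOf hW).trans_lt
      (max_lt (by have := h.hM; omega) hV)).up 15 h.hM (by decide)))) (fun hb => ?_) fun hb => ?_
  · rw [if_neg (by simpa using hb)]
    exact wp_pair (wp_call rfl (reach_spec h V v cs hcs hV)) rfl
  · rw [if_pos (by simpa using hb)]
    rfl

theorem bigs_spec (h : Bounds n k M Q) (V : List (Fin n)) (ps : List (List (Fin n)))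
    (hV : V.length < M) (hps : ps.length < M) (hps' : ∀ W ∈ ps, W.length < M) :
    Calls (prog hadj) (Q * M ^ 5) iBigs (.pair (enc V) (enc ps)) (enc (bigs V ps)) :=
  Calls.filter 3 rfl h.hM h.hQ (by decide) hps fun W hW r t ρ =>
    wp_call rfl (big_spec h V W hV (hps' W hW))

theorem touching_spec (h : Bounds n k M Q) (C D : List (Fin n)) (hC : C.length < M)
    (hD : D.length < M) :
    Calls (prog hadj) (Q * M ^ 8) iTouching (.pair (.pair (env adj hadj rv) (enc C)) (enc D))
      (enc (touching adj C D)) :=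
  Calls.filter 6 rfl h.hM h.hQ (by decide) hD fun w _ r t ρ =>
    wp_not (wp_isNil (wp_call rfl (nb_spec h w C hC)))

theorem bigComps_spec (h : Bounds n k M Q) (V C : List (Fin n)) (hV : V.length < M)
    (hC : C.length < M) :
    Calls (prog hadj) (Q * M ^ 18) iBigComps (.pair (.pair (env adj hadj rv) (enc V)) (enc C))
      (enc (bigComps adj V C)) := by
  have h0 : SmallCuts M ([] : List (Cut n)) := ⟨by have := h.hM; simp; omega, by simp⟩
  refine Calls.body 17 rfl h.hM h.hQ (by decide) (wp_call (wp_pair rfl (wp_call rfl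
    (pieces_spec h C C [] h0 hC hC))) ((bigs_spec h V _ hV ?_ ?_).up 17 h.hM (by decide)))
  · exact (length_piecesOf _ _ _).trans_lt hC
  · exact fun W hW => (length_of_mem_piecesOf hW).trans_lt (max_lt (by have := h.hM; omega) hC)

theorem length_of_mem_bigComps {V C W : List (Fin n)} (hW : W ∈ bigComps adj V C) :
    W.length ≤ max 1 C.length :=
  length_of_mem_piecesOf (List.mem_of_mem_filter hW)

theorem length_pathStep (V : List (Fin n)) (s : List (Fin n) × Fin n) :
    (pathStep adj V s).1.length ≤ max 1 s.1.length := by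
  unfold pathStep
  split
  · exact le_max_right _ _
  · rename_i C l hC
    split
    · exact le_max_right _ _
    · exact (length_of_mem_bigComps (hC ▸ List.mem_cons_self)).trans
        (max_le_max le_rfl (List.length_filter_le _ _))

theorem pathStep_spec (h : Bounds n k M Q) (V : List (Fin n)) (s : List (Fin n) × Fin n)
    (hV : V.length < M) (hs : s.1.length < M) :
    Calls (prog hadj) (Q * M ^ 19) iPathStep
      (.pair (.pair (env adj hadj rv) (enc V)) (enc s)) (enc (pathStep adj V s)) := by
  refine Calls.body 18 rfl h.hM h.hQ (by decide) ?_
  have hs' : (nonNb adj s.2 s.1).length < M := (List.length_filter_le _ _).trans_lt hs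
  refine wp_match (wp_call (wp_pair rfl (wp_call rfl ((nonNb_spec h s.2 s.1 hs).up 18 h.hM
    (by decide)))) (bigComps_spec h V _ hV hs')) (fun C l hC => ?_) fun hC => ?_
  · have hC' : C.length < M := (length_of_mem_bigComps (hC ▸ List.mem_cons_self)).trans_lt
      (max_lt (by have := h.hM; omega) hs')
    refine wp_match (l := touching adj C (nb adj s.2 s.1)) (wp_call (wp_pair rfl (wp_call rfl
      ((nb_spec h s.2 s.1 hs).up 18 h.hM
      (by decide)))) ((touching_spec h C _ hC' ((List.length_filter_le _ _).trans_lt hs)).up 18 h.hM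
      (by decide))) (fun w l' hw => ?_) fun hw => ?_
    · rw [show pathStep adj V s = (C, w) by simp only [pathStep, hC, hw]]
      rfl
    · rw [show pathStep adj V s = s by simp only [pathStep, hC, hw]]
      rfl
  · rw [show pathStep adj V s = s by simp only [pathStep, hC]]
    rfl

theorem length_foldr_pathStep {α : Type} (V C : List (Fin n)) (u : Fin n) (t : List α) :
    (t.foldr (fun _ r => pathStep adj V r) (C, u)).1.length ≤ max 1 C.length := by
  induction t with
  | nil => exact le_max_right _ _
  | cons b t ih => exact (length_pathStep _ _).trans (max_le (le_max_left _ _) ih)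

theorem pathIter_spec (h : Bounds n k M Q) (V C : List (Fin n)) (u : Fin n)
    (hV : V.length < M) (hC : C.length < M) :
    Calls (prog hadj) (Q * M ^ 21) iPathIter
      (.pair (.pair (.pair (env adj hadj rv) (enc V)) (.pair (enc C) (enc u))) (enc V))
      (enc (pathPart adj V C u)) :=
  Calls.foldPoly 19 rfl h.hM h.hQ (by decide) hV (fun ρ => rfl) fun a t _ ρ =>
    wp_call rfl (pathStep_spec h V _ hV ((length_foldr_pathStep V C u t).trans_lt
      (max_lt (by have := h.hM; omega) hC)))

theorem cuts_spec (h : Bounds n k M Q) (V : List (Fin n)) (hV : V.length < M) :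
    Calls (prog hadj) (Q * M ^ 22) iCuts (.pair (env adj hadj rv) (enc V))
      (enc (cuts adj V)) := by
  refine Calls.body 21 rfl h.hM h.hQ (by decide) ?_
  refine wp_let (wp_call rfl ((cliqueIter_spec h V hV).up 21 h.hM (by decide))) ?_
  have hD : (cliquePart adj V).length < M := (length_foldr_cliqueStep V V).trans_lt hV
  change wp _ _ _ _ fun x => x = .pair (.pair (enc (cliquePart adj V))
    (enc (diff (cliquePart adj V) V))) (enc (innerCuts adj V (cliquePart adj V)))
  refine wp_pair (wp_pair rfl (wp_call rfl ((diff_spec h _ V hD hV).up 21 h.hM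
    (by decide)))) ?_
  refine wp_match (wp_call rfl ((bigComps_spec h V _ hV hD).up 21 h.hM (by decide)))
    (fun C l hC => ?_) fun hC => ?_
  · have hCM : C.length < M := (length_of_mem_bigComps (hC ▸ List.mem_cons_self)).trans_lt
      (max_lt (by have := h.hM; omega) hD)
    simp only [innerCuts, hC]
    refine wp_match (l := C) rfl (fun u C' hu => ?_) fun hu => ?_
    · subst hu
      refine wp_let (wp_call rfl (pathIter_spec h V _ u hV hCM)) ?_
      have h2 : (pathPart adj V (u :: C') u).1.length < M :=
        (length_foldr_pathStep V _ u V).trans_lt (max_lt (by have := h.hM; omega) hCM)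
      have h3 := fun p => (List.length_filter_le p _).trans_lt h2
      refine wp_let (wp_call rfl ((nb_spec h _ _ h2).up 21 h.hM (by decide))) ?_
      exact wp_pair (wp_pair (wp_call rfl ((diff_spec h _ _ h2 hD).up 21 h.hM (by decide))) rfl)
        (wp_pair (wp_pair rfl (wp_call rfl ((diff_spec h _ _ (h3 _) h2).up 21 h.hM (by decide)))) rfl)
    · subst hu
      rfl
  · simp only [innerCuts, hC]
    rfl

end

/-! ### Specifications: guesses, options, solutions and output -/

section

variable {n k M Q : ℕ} {adj : Fin n → Fin n → Bool} {hadj : Fin k → Fin k → Bool}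
  {rv : Fin n → Fin k → ℚ}

theorem other_spec (h : Bounds n k M Q) (a q : Fin n) (X : List (Fin n)) (hX : X.length < M) :
    Calls (prog hadj) (Q * M ^ 6) iOther
      (.pair (.pair (env adj hadj rv) (.pair (enc a) (enc q))) (enc X))
      (enc (otherAdj adj X a q)) :=
  Calls.any 4 rfl h.hM h.hQ (by decide) hX fun b _ r t ρ =>
    wp_and (wp_not (wp_call rfl ((eq_spec h a b h.hn.le).up 4 h.hM (by decide))))
      (wp_call rfl (adj_spec h b q))

theorem private_spec (h : Bounds n k M Q) (a : Fin n) (X Y : List (Fin n)) (hX : X.length < M)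
    (hY : Y.length < M) :
    Calls (prog hadj) (Q * M ^ 8) iPrivate
      (.pair (.pair (env adj hadj rv) (.pair (enc a) (enc X))) (enc Y))
      (enc (hasPrivate adj Y X a)) :=
  Calls.any 6 rfl h.hM h.hQ (by decide) hY fun q _ r t ρ =>
    wp_and (wp_call rfl ((adj_spec h a q).up 6 h.hM (by decide)))
      (wp_not (wp_call rfl (other_spec h a q X hX)))

theorem redundant_spec (h : Bounds n k M Q) (X X' Y : List (Fin n)) (hX : X.length < M)
    (hX' : X'.length < M) (hY : Y.length < M) :
    Calls (prog hadj) (Q * M ^ 10) iRedundant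
      (.pair (.pair (env adj hadj rv) (.pair (enc Y) (enc X))) (enc X'))
      (enc (X'.any fun a => !((nb adj a X).isEmpty && hasPrivate adj Y X a))) :=
  Calls.any 8 rfl h.hM h.hQ (by decide) hX' fun a _ r t ρ =>
    wp_not (wp_and (wp_isNil (wp_call rfl ((nb_spec h a X hX).up 8 h.hM (by decide))))
      (wp_call rfl (private_spec h a X Y hX hY)))

theorem addVertex_spec (h : Bounds n k M Q) {L : ℕ} (u : Fin n) (Xs : List (List (Fin n)))
    (Y : List (Fin n)) (hXs : Xs.length < L) (hX : ∀ X ∈ Xs, X.length + 1 < M)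
    (hY : Y.length < M) :
    Calls (prog hadj) (L * Q * M ^ 11) iAddVertex
      (.pair (.pair (.pair (env adj hadj rv) (enc Y)) (enc u)) (enc Xs))
      (enc (addVertex adj Y u Xs)) := by
  refine Calls.foldBig 10 rfl h.hM h.hQ (by decide) hXs (fun ρ => rfl) fun X t hX' ρ => ?_
  have hX1 : (u :: X).length < M := hX X (hX'.subset (by simp))
  refine wp_ite (wp_call rfl (redundant_spec h (u :: X) (u :: X) Y hX1 hX1 hY)) (fun hb => ?_)
    fun hb => ?_
  · rw [if_neg (by rw [irredundant, hb]; decide)]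
    rfl
  · rw [if_pos (by rw [irredundant, hb]; decide)]
    rfl

theorem exists_of_mem_addVertex {Y : List (Fin n)} {u : Fin n} {Xs : List (List (Fin n))}
    {X : List (Fin n)} (hX : X ∈ addVertex adj Y u Xs) : ∃ X' ∈ Xs, X = u :: X' := by
  induction Xs with
  | nil => simp [addVertex] at hX
  | cons Z Xs ih =>
    simp only [addVertex, List.foldr_cons] at hX ih
    split at hX
    · rcases List.mem_cons.1 hX with rfl | hX
      · exact ⟨Z, by simp, rfl⟩
      · obtain ⟨X', h1, h2⟩ := ih hX
        exact ⟨X', by simp [h1], h2⟩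
    · obtain ⟨X', h1, h2⟩ := ih hX
      exact ⟨X', by simp [h1], h2⟩

theorem length_addVertex (Y : List (Fin n)) (u : Fin n) (Xs : List (List (Fin n))) :
    (addVertex adj Y u Xs).length ≤ Xs.length := by
  induction Xs with
  | nil => exact le_rfl
  | cons Z Xs ih =>
    simp only [addVertex, List.foldr_cons]
    split
    · exact Nat.succ_le_succ ih
    · exact ih.trans (Nat.le_succ _)

theorem sublist_of_mem_irredundantSets {Y P X : List (Fin n)}
    (hX : X ∈ irredundantSets adj Y P) : X.Sublist P := by
  induction P generalizing X with
  | nil => simp [irredundantSets] at hX; simp [hX]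
  | cons u P ih =>
    rcases List.mem_append.1 (show X ∈ addVertex adj Y u (irredundantSets adj Y P) ++
      irredundantSets adj Y P from hX) with hX | hX
    · obtain ⟨X', h1, rfl⟩ := exists_of_mem_addVertex hX
      exact (ih h1).cons_cons u
    · exact (ih hX).cons u

/-- The fold that builds the sets passes through all suffixes of the list; monotonicity bounds its
intermediate results by the final one. -/
theorem length_irredundantSets_mono {Y P P' : List (Fin n)} (hP : P' <:+ P) :
    (irredundantSets adj Y P').length ≤ (irredundantSets adj Y P).length := by
  obtain ⟨l, rfl⟩ := hP
  induction l with
  | nil => exact le_rfl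
  | cons u l ih =>
    refine ih.trans ?_
    simp [irredundantSets]

/-- The inner functions run over up to L sets, while the outer fold runs over a short list of
vertices. Absorbing L into the parameter Q makes the polynomial fold rule applicable. -/
theorem irrSets_spec (h : Bounds n k M Q) {L : ℕ} (Y P : List (Fin n))
    (hP : P.length + 1 < M) (hY : Y.length < M) (hL : (irredundantSets adj Y P).length < L) :
    Calls (prog hadj) (L * Q * M ^ 13) iIrrSets
      (.pair (.pair (env adj hadj rv) (enc Y)) (enc P)) (enc (irredundantSets adj Y P)) := by
  have hLQ : Bounds n k M (L * Q) := ⟨h.hM, Nat.mul_pos (by omega) h.hQ, h.hn, h.hk⟩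
  refine Calls.foldPoly 11 rfl hLQ.hM hLQ.hQ (by decide) (by omega) (fun ρ => rfl)
    fun u t hut ρ => ?_
  have ht : (irredundantSets adj Y t).length < L :=
    (length_irredundantSets_mono ((List.suffix_cons _ _).trans hut)).trans_lt hL
  refine wp_call (wp_pair rfl (wp_call rfl (addVertex_spec h u (irredundantSets adj Y t) Y ht
    (fun X hX => ?_) hY))) ((appBig_spec h _ _ ((length_addVertex _ _ _).trans_lt ht)).up 11 h.hM
      (by decide))
  have h1 := (sublist_of_mem_irredundantSets hX).length_le
  have h2 := hut.length_le
  simp at h2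
  omega

theorem undom_spec (h : Bounds n k M Q) (v : Fin n) (X Y : List (Fin n)) (hX : X.length < M)
    (hY : Y.length < M) :
    Calls (prog hadj) (Q * M ^ 8) iUndom
      (.pair (.pair (env adj hadj rv) (.pair (enc v) (enc X))) (enc Y))
      (enc (undominated adj Y X v)) :=
  Calls.any 6 rfl h.hM h.hQ (by decide) hY fun q _ r t ρ =>
    wp_and (wp_call rfl ((adj_spec h v q).up 6 h.hM (by decide)))
      (wp_isNil (wp_call rfl (nb_spec h q X hX)))

theorem compat_spec (h : Bounds n k M Q) (c : Cut n) (a : Fin k) (X : List (Fin n)) (o : Opt n k)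
    (h1 : c.1.length < M) (h2 : c.2.length < M) (hX : X.length < M) :
    Calls (prog hadj) (Q * M ^ 9) iCompat
      (.pair (.pair (env adj hadj rv) (.pair (.pair (enc c) (enc a)) (enc X))) (enc o))
      (enc (compatible adj hadj c a X o)) :=
  Calls.body 8 rfl h.hM h.hQ (by decide) (wp_not (wp_or
    (wp_and (wp_and (wp_call rfl ((mem_spec h o.1 c.2 h.hn.le h2).up 8 h.hM (by decide)))
      (wp_not (wp_isNil (wp_call rfl ((nb_spec h o.1 X hX).up 8 h.hM (by decide))))))
      (wp_not (wp_call rfl ((hadj_spec h a o.2).up 8 h.hM (by decide)))))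
    (wp_and (wp_and (wp_call rfl ((mem_spec h o.1 c.1 h.hn.le h1).up 8 h.hM (by decide)))
      (wp_call rfl ((eq_spec h o.2 a h.hk.le).up 8 h.hM (by decide))))
      (wp_call rfl (undom_spec h o.1 X c.2 hX h2)))))

theorem refine_spec (h : Bounds n k M Q) (c : Cut n) (a : Fin k) (X : List (Fin n))
    (O : List (Opt n k)) (h1 : c.1.length < M) (h2 : c.2.length < M) (hX : X.length < M)
    (hO : O.length < M) :
    Calls (prog hadj) (Q * M ^ 11) iRefine
      (.pair (.pair (env adj hadj rv) (.pair (.pair (enc c) (enc a)) (enc X))) (enc O))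
      (enc (refine adj hadj c a X O)) :=
  Calls.filter 9 rfl h.hM h.hQ (by decide) hO fun o _ r t ρ =>
    wp_call rfl (compat_spec h c a X o h1 h2 hX)

theorem refineAll_spec (h : Bounds n k M Q) {L : ℕ} (c : Cut n) (a : Fin k) (X : List (Fin n))
    (Os : List (List (Opt n k))) (h1 : c.1.length < M) (h2 : c.2.length < M) (hX : X.length < M)
    (hL : Os.length < L) (hO : ∀ O ∈ Os, O.length < M) :
    Calls (prog hadj) (L * Q * M ^ 12) iRefineAll
      (.pair (.pair (env adj hadj rv) (.pair (.pair (enc c) (enc a)) (enc X))) (enc Os))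
      (enc (refineAll adj hadj c a X Os)) :=
  Calls.mapBig 11 rfl h.hM h.hQ (by decide) hL fun O hOs r t ρ =>
    wp_call rfl (refine_spec h c a X O h1 h2 hX (hO O hOs))

/-- One factor L counts the guesses, the other one the lists of options that are refined for each
guess. -/
theorem refineSets_spec (h : Bounds n k M Q) {L : ℕ} (c : Cut n) (a : Fin k)
    (Os : List (List (Opt n k))) (Xs : List (List (Fin n))) (h1 : c.1.length < M)
    (h2 : c.2.length < M) (hX : ∀ X ∈ Xs, X.length < M) (hXs : Xs.length < L)
    (hL : Os.length < L) (hO : ∀ O ∈ Os, O.length < M) :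
    Calls (prog hadj) (L * (L * Q) * M ^ 13) iRefineSets
      (.pair (.pair (env adj hadj rv) (.pair (.pair (enc c) (enc a)) (enc Os))) (enc Xs))
      (enc (refineSets adj hadj c a Os Xs)) := by
  have hLQ : 1 ≤ L * Q := Nat.mul_pos (by omega) h.hQ
  refine Calls.foldBig 12 rfl h.hM hLQ (by decide) hXs (fun ρ => rfl) fun X t hXt ρ => ?_
  refine wp_call (wp_pair rfl (wp_call rfl (refineAll_spec h c a X Os h1 h2
    (hX X (hXt.subset (by simp))) hL hO))) ((appBig_spec h _ _ ?_).up 12 h.hM (by decide))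
  simpa [refineAll] using hL

theorem exists_of_mem_refineSets {c : Cut n} {a : Fin k} {Os : List (List (Opt n k))}
    {Xs : List (List (Fin n))} {O : List (Opt n k)} :
    O ∈ refineSets adj hadj c a Os Xs ↔ ∃ X ∈ Xs, ∃ O' ∈ Os, O = refine adj hadj c a X O' := by
  induction Xs with
  | nil => simp [refineSets]
  | cons X Xs ih =>
    have h1 : O ∈ refineSets adj hadj c a Os (X :: Xs) ↔
      O ∈ refineAll adj hadj c a X Os ++ refineSets adj hadj c a Os Xs := Iff.rfl
    rw [h1, List.mem_append, ih]
    simp [refineAll, eq_comm]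

theorem sublist_of_mem_refinements {O O' : List (Opt n k)} {ts : List (Cut n × Fin k)}
    (h : O' ∈ refinements adj hadj O ts) : O'.Sublist O := by
  induction ts generalizing O' with
  | nil => simp [refinements] at h; simp [h]
  | cons t ts ih =>
    obtain ⟨X, _, O1, h1, rfl⟩ := exists_of_mem_refineSets.1 h
    exact List.filter_sublist.trans (ih h1)

/-- The length bound is assumed for every suffix of `ts` because all partial sequences of guesses
occur as intermediate results of the fold. -/
theorem refinements_spec (h : Bounds n k M Q) {L : ℕ} (O : List (Opt n k))
    (ts : List (Cut n × Fin k)) (hO : O.length < M) (hts : ts.length < M)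
    (hc : ∀ t ∈ ts, t.1.1.length + 1 < M ∧ t.1.2.length < M)
    (hX : ∀ t ∈ ts, (irredundantSets adj t.1.2 t.1.1).length < L)
    (hL : ∀ ts', ts' <:+ ts → (refinements adj hadj O ts').length < L) :
    Calls (prog hadj) (L * (L * Q) * M ^ 15) iRefinements
      (.pair (.pair (env adj hadj rv) (enc O)) (enc ts)) (enc (refinements adj hadj O ts)) := by
  have hL0 : 1 ≤ L := by have := hL ts List.suffix_rfl; omega
  have hLQ : 1 ≤ L * (L * Q) := Nat.mul_pos hL0 (Nat.mul_pos hL0 h.hQ)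
  refine Calls.foldPoly 13 rfl h.hM hLQ (by decide) hts (fun ρ => rfl) fun t ts' ht ρ => ?_
  have htm : t ∈ ts := ht.subset (by simp)
  refine wp_call (wp_pair rfl (wp_call rfl ((irrSets_spec h t.1.2 t.1.1 (hc t htm).1
    (hc t htm).2 (hX t htm)).mono ?_))) (refineSets_spec h t.1 t.2 _ _ (by have := hc t htm; omega)
      (hc t htm).2 (fun X hX' => ?_) (hX t htm) (hL ts' ((List.suffix_cons _ _).trans ht))
      fun O' hO' => ?_)
  · exact Nat.mul_le_mul_right _ (Nat.le_mul_of_pos_left _ hL0)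
  · have := (sublist_of_mem_irredundantSets hX').length_le
    have := (hc t htm).1
    omega
  · exact (sublist_of_mem_refinements hO').length_le.trans_lt hO

theorem pairs_spec (h : Bounds n k M Q) {α β : Type} [Enc α] [Enc β] (a : α) (m : List β)
    (hm : m.length < M) :
    Calls (prog hadj) (Q * M ^ 2) iPairs (.pair (enc a) (enc m))
      (enc (m.map fun b => (a, b))) :=
  Calls.map 0 rfl h.hM h.hQ (by decide) hm fun b _ r t ρ => rfl

theorem product_spec (h : Bounds n k M Q) {α β : Type} [Enc α] [Enc β] (m : List β) (l : List α)
    (hm : m.length < M) (hl : l.length < M) :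
    Calls (prog hadj) (Q * M ^ 4) iProduct (.pair (enc m) (enc l)) (enc (product m l)) :=
  Calls.foldPoly 2 rfl h.hM h.hQ (by decide) hl (fun ρ => rfl) fun a t _ ρ =>
    wp_call (wp_pair rfl (wp_call rfl (pairs_spec h a m hm)))
      (app_spec h _ _ (by simpa using hm))

theorem optionsOn_spec (h : Bounds n k M Q) (W : List (Fin n)) (O : List (Opt n k))
    (hW : W.length < M) (hO : O.length < M) :
    Calls (prog hadj) (Q * M ^ 7) iOptionsOn (.pair (enc W) (enc O)) (enc (optionsOn W O)) :=
  Calls.filter 5 rfl h.hM h.hQ (by decide) hO fun o _ r t ρ =>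
    wp_call rfl (mem_spec h o.1 W h.hn.le hW)

theorem value_spec (h : Bounds n k M Q) (S : List (Opt n k)) (hS : S.length < M) :
    Calls (prog hadj) (Q * M ^ 6) iValue (.pair (env adj hadj rv) (enc S)) (enc (value rv S)) :=
  Calls.foldPoly 4 rfl h.hM h.hQ (by decide) hS (fun ρ => rfl) fun o t _ ρ =>
    ⟨_, rev_spec h o.1 o.2, _, _, rfl, rfl, rfl⟩

theorem best_mem (Ss : List (List (Opt n k))) : best rv Ss ∈ [] :: Ss := by
  induction Ss with
  | nil => simp [best]
  | cons S Ss ih =>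
    simp only [best, List.foldr_cons, List.mem_cons] at ih ⊢
    split
    · tauto
    · simp

theorem best_spec (h : Bounds n k M Q) {L : ℕ} (Ss : List (List (Opt n k))) (hL : Ss.length < L)
    (hS : ∀ S ∈ Ss, S.length < M) :
    Calls (prog hadj) (L * Q * M ^ 7) iBest (.pair (env adj hadj rv) (enc Ss))
      (enc (best rv Ss)) := by
  refine Calls.foldBig 6 rfl h.hM h.hQ (by decide) hL (fun ρ => rfl) fun S t ht ρ => ?_
  have h1 : (best rv t).length < M := by
    rcases List.mem_cons.1 (best_mem (rv := rv) t) with h1 | h1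
    · rw [h1]; have := h.hM; simp; omega
    · exact hS _ (ht.subset (by simp [h1]))
  refine ⟨_, value_spec h S (hS S (ht.subset (by simp))), _, value_spec h _ h1, _, _, rfl, rfl,
    fun hb => ?_, fun hb => ?_⟩
  · rw [if_pos hb]; rfl
  · rw [if_neg hb]; rfl

theorem singletons_spec (h : Bounds n k M Q) (O : List (Opt n k)) (hO : O.length < M) :
    Calls (prog hadj) (Q * M ^ 2) iSingletons (.pair .nil (enc O)) (enc (O.map fun o => [o])) :=
  Calls.map 0 rfl h.hM h.hQ (by decide) hO fun b _ r t ρ => rfl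

theorem succ_spec (h : Bounds n k M Q) (l : List ℕ) (hl : l.length < M) :
    Calls (prog hadj) (Q * M ^ 2) iSucc (.pair .nil (enc l)) (enc (l.map Nat.succ)) :=
  Calls.map 0 rfl h.hM h.hQ (by decide) hl fun b _ r t ρ => rfl

theorem enc_finRange (m : ℕ) : enc (List.finRange m) = enc (List.range m) := by
  rw [← List.map_coe_finRange_eq_range]
  simp only [enc, List.map_map]
  rfl

theorem range_spec (h : Bounds n k M Q) {α : Type} [Enc α] (l : List α) (hl : l.length < M) :
    Calls (prog hadj) (Q * M ^ 4) iRange (.pair .nil (enc l)) (enc (List.finRange l.length)) := by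
  have h1 : ∀ l : List α,
      List.range l.length = l.foldr (fun _ r => 0 :: r.map Nat.succ) [] := by
    intro l
    induction l with
    | nil => rfl
    | cons a l ih => rw [List.foldr_cons, ← ih, List.length_cons, List.range_succ_eq_map]
  rw [enc_finRange, h1]
  refine Calls.foldPoly 2 rfl h.hM h.hQ (by decide) hl (fun ρ => rfl) fun a t ht ρ => ?_
  refine wp_pair rfl (wp_call rfl (succ_spec h _ ?_))
  rw [← h1, List.length_range]
  have := ht.length_le
  simp at this
  omega

instance : Enc (Option (Fin k)) := ⟨encodeColor⟩

theorem color_spec (h : Bounds n k M Q) (v : Fin n) (S : List (Opt n k)) (hS : S.length < M) :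
    Calls (prog hadj) (Q * M ^ 5) iColor (.pair (enc v) (enc S)) (enc (colorIn S v)) := by
  refine Calls.foldPoly 3 rfl h.hM h.hQ (by decide) hS (fun ρ => rfl) fun o t _ ρ => ?_
  refine wp_ite (wp_not (wp_call rfl (eq_spec h v o.1 h.hn.le))) (fun hb => ?_) fun hb => ?_
  · rw [if_neg (by simpa using hb)]; rfl
  · rw [if_pos (by simpa using hb)]; rfl

theorem out_spec (h : Bounds n k M Q) (S : List (Opt n k)) (V : List (Fin n)) (hS : S.length < M)
    (hV : V.length < M) :
    Calls (prog hadj) (Q * M ^ 7) iOut (.pair (enc S) (enc V)) (enc (V.map (colorIn S))) :=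
  Calls.map 5 rfl h.hM h.hQ (by decide) hV fun v _ r t ρ => wp_call rfl (color_spec h v S hS)

end

/-! ### Private neighbors in graphs without bulls and `E`s -/

section

variable {V : Type} {G : SimpleGraph V}

/-- Different vertices of the bull, and of `E`, have different neighborhoods. This spares the proof
that the vertices of a forbidden configuration are distinct. -/
theorem injective_of_adj_iff {m : ℕ} {F : SimpleGraph (Fin m)} {f : Fin m → V}
    (hf : ∀ x y, G.Adj (f x) (f y) ↔ F.Adj x y)
    (hF : ∀ x y, (∀ z, F.Adj x z ↔ F.Adj y z) → x = y) : Function.Injective f :=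
  fun x y hxy => hF x y fun z => by rw [← hf, ← hf, hxy]

theorem isIndContained_of_adj_iff {m : ℕ} {F : SimpleGraph (Fin m)} {f : Fin m → V}
    (hf : ∀ x y, G.Adj (f x) (f y) ↔ F.Adj x y)
    (hF : ∀ x y, (∀ z, F.Adj x z ↔ F.Adj y z) → x = y) : F.IsIndContained G :=
  ⟨⟨⟨f, injective_of_adj_iff hf hF⟩, fun {x y} => hf x y⟩⟩

instance : DecidableRel bull.Adj := fun a b =>
  decidable_of_iff ((a, b) ∈ [((0 : Fin 5), (1 : Fin 5)), (1, 0), (1, 2), (2, 1), (0, 2), (2, 0),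
    (0, 3), (3, 0), (1, 4), (4, 1)]) (by fin_cases a <;> fin_cases b <;> simp [bull])

instance : DecidableRel graphE.Adj := fun a b =>
  decidable_of_iff ((a, b) ∈ [((0 : Fin 6), (1 : Fin 6)), (1, 0), (1, 2), (2, 1), (2, 3), (3, 2),
    (3, 4), (4, 3), (2, 5), (5, 2)]) (by fin_cases a <;> fin_cases b <;> simp [graphE])

theorem not_bull (hb : ¬ bull.IsIndContained G) {a b c d e : V} (hab : G.Adj a b)
    (hbc : G.Adj b c) (hac : G.Adj a c) (had : G.Adj a d) (hbe : G.Adj b e) (hae : ¬ G.Adj a e)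
    (hbd : ¬ G.Adj b d) (hcd : ¬ G.Adj c d) (hce : ¬ G.Adj c e) (hde : ¬ G.Adj d e) : False := by
  refine hb (isIndContained_of_adj_iff (f := ![a, b, c, d, e]) (fun x y => ?_) (by decide))
  rcases lt_trichotomy x y with h | rfl | h
  · fin_cases x <;> fin_cases y <;> first | (exact absurd h (by decide)) |
      exact iff_of_true (by assumption) (by decide) | exact iff_of_false (by assumption) (by decide)
  · exact iff_of_false (G.loopless.irrefl _) (bull.loopless.irrefl _)
  · rw [G.adj_comm, bull.adj_comm]
    fin_cases x <;> fin_cases y <;> first | (exact absurd h (by decide)) |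
      exact iff_of_true (by assumption) (by decide) | exact iff_of_false (by assumption) (by decide)

theorem not_graphE (he : ¬ graphE.IsIndContained G) {a b c d e f : V} (hab : G.Adj a b)
    (hbc : G.Adj b c) (hcd : G.Adj c d) (hde : G.Adj d e) (hcf : G.Adj c f) (hac : ¬ G.Adj a c)
    (had : ¬ G.Adj a d) (hae : ¬ G.Adj a e) (haf : ¬ G.Adj a f) (hbd : ¬ G.Adj b d)
    (hbe : ¬ G.Adj b e) (hbf : ¬ G.Adj b f) (hce : ¬ G.Adj c e) (hdf : ¬ G.Adj d f)
    (hef : ¬ G.Adj e f) : False := by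
  refine he (isIndContained_of_adj_iff (f := ![a, b, c, d, e, f]) (fun x y => ?_) (by decide))
  rcases lt_trichotomy x y with h | rfl | h
  · fin_cases x <;> fin_cases y <;> first | (exact absurd h (by decide)) |
      exact iff_of_true (by assumption) (by decide) | exact iff_of_false (by assumption) (by decide)
  · exact iff_of_false (G.loopless.irrefl _) (graphE.loopless.irrefl _)
  · rw [G.adj_comm, graphE.adj_comm]
    fin_cases x <;> fin_cases y <;> first | (exact absurd h (by decide)) |
      exact iff_of_true (by assumption) (by decide) | exact iff_of_false (by assumption) (by decide)

/-- Private neighbors of vertices that are complete to a clique, if they are not. -/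
theorem adj_private_of_clique (hb : ¬ bull.IsIndContained G) (he : ¬ graphE.IsIndContained G)
    {K : Set V} (hK : G.IsClique K) {a b c p q : V} (ha : ∀ s ∈ K, G.Adj a s)
    (hbK : ∀ s ∈ K, G.Adj b s) (hc : ∀ s ∈ K, G.Adj c s) (hab : ¬ G.Adj a b) (hac : ¬ G.Adj a c)
    (hbc : ¬ G.Adj b c) (hap : G.Adj a p) (hbp : ¬ G.Adj b p) (hcp : ¬ G.Adj c p)
    (haq : ¬ G.Adj a q) (hbq : G.Adj b q) (hcq : ¬ G.Adj c q) (hp : ∃ s ∈ K, ¬ G.Adj p s)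
    (hq : ∃ s ∈ K, ¬ G.Adj q s) : G.Adj p q := by
  by_contra hpq
  -- Otherwise p - a - s - b - q together with c attached to s is an induced `E`.
  have key : ∀ s ∈ K, ¬ G.Adj p s → G.Adj q s := fun s hs hps => by
    by_contra hqs
    exact not_graphE he hap.symm (ha s hs) (hbK s hs).symm hbq (hc s hs).symm hps
      (fun h => hbp h.symm) hpq (fun h => hcp h.symm) hab haq hac (fun h => hqs h.symm) hbc
      (fun h => hcq h.symm)
  obtain ⟨s, hs, hps⟩ := hp
  obtain ⟨t, ht, hqt⟩ := hq
  have hqs := key s hs hps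
  have hpt : G.Adj p t := by
    by_contra hpt
    exact hqt (key t ht hpt)
  have hst : s ≠ t := by
    rintro rfl
    exact hqt hqs
  -- Now p misses s but not t, and q misses t but not s: the triangle t, s, c with p attached to t
  -- and q attached to s is a bull.
  exact not_bull hb (hK ht hs hst.symm) (hc s hs).symm (hc t ht).symm hpt.symm hqs.symm
    (fun h => hqt h.symm) (fun h => hps h.symm) hcp hcq hpq

/-- A vertex attached to the middle of a long induced path. -/
theorem no_attachment (hb : ¬ bull.IsIndContained G) (he : ¬ graphE.IsIndContained G) {N : ℕ}
    (hN : 5 ≤ N) {f : ℕ → V} (h1 : ∀ i, i < N → G.Adj (f i) (f (i + 1)))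
    (h2 : ∀ i j, i + 2 ≤ j → j ≤ N → (0 < i ∨ j < N) → ¬ G.Adj (f i) (f j)) {z z' : V}
    (hz : ∃ m, G.Adj z (f m) ∧ m ≤ N)
    (hz' : ∀ m ≤ N, G.Adj z (f m) → 2 ≤ m ∧ m + 2 ≤ N) (hzz : G.Adj z z')
    (hf : ∀ m, 0 < m → m < N → ¬ G.Adj z' (f m)) : False := by
  classical
  have hS : ∃ m, G.Adj z (f m) := hz.imp fun m h => h.1
  obtain ⟨m, hm, hmN⟩ := hz
  -- the first and the last neighbor
  set I := Nat.find hS with hI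
  have hI1 : G.Adj z (f I) := Nat.find_spec hS
  have hI2 : ∀ i, i < I → ¬ G.Adj z (f i) := fun i hi => Nat.find_min hS hi
  have hIm : I ≤ m := Nat.find_min' hS hm
  set J := Nat.findGreatest (fun m => G.Adj z (f m)) N with hJ
  have hJ1 : G.Adj z (f J) := Nat.findGreatest_spec (P := fun m => G.Adj z (f m)) hmN hm
  have hmJ : m ≤ J := Nat.le_findGreatest hmN hm
  have hJN : J ≤ N := Nat.findGreatest_le N
  have hJ2 : ∀ i, J < i → i ≤ N → ¬ G.Adj z (f i) := fun i hi hiN => Nat.findGreatest_is_greatest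
    (P := fun m => G.Adj z (f m)) hi hiN
  have hIb := hz' I (by omega) hI1
  have hJb := hz' J hJN hJ1
  clear_value I J
  obtain ⟨I, rfl⟩ : ∃ i, I = i + 2 := ⟨I - 2, by omega⟩
  -- The first neighbor of z is now f (I + 2). If it is the only one, it is the center of an `E`; if
  -- there are exactly two and they are consecutive, they form with z the triangle of a bull; if the
  -- first and last are further apart, z is the center of an `E` with z' attached to it. The ends f
  -- 0 and f N are allowed to be adjacent; since N ≥ 5, no configuration contains both.
  rcases (by omega : J = I + 2 ∨ J = I + 3 ∨ I + 4 ≤ J) with h | h | h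
  · subst h
    exact not_graphE he (h1 I (by omega)) (h1 (I + 1) (by omega)) (h1 (I + 2) (by omega))
      (h1 (I + 3) (by omega)) hI1.symm (h2 _ _ (by omega) (by omega) (by omega))
      (h2 _ _ (by omega) (by omega) (by omega)) (h2 _ _ (by omega) (by omega) (by omega))
      (fun h => hI2 I (by omega) h.symm) (h2 _ _ (by omega) (by omega) (by omega))
      (h2 _ _ (by omega) (by omega) (by omega)) (fun h => hI2 (I + 1) (by omega) h.symm)
      (h2 _ _ (by omega) (by omega) (by omega)) (fun h => hJ2 (I + 3) (by omega) (by omega) h.symm)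
      (fun h => hJ2 (I + 4) (by omega) (by omega) h.symm)
  · subst h
    exact not_bull hb (h1 (I + 2) (by omega)) hJ1.symm hI1.symm (h1 (I + 1) (by omega)).symm
      (h1 (I + 3) (by omega)) (h2 _ _ (by omega) (by omega) (by omega))
      (fun h => h2 (I + 1) (I + 3) (by omega) (by omega) (by omega) h.symm)
      (hI2 _ (by omega)) (hJ2 _ (by omega) (by omega)) (h2 _ _ (by omega) (by omega) (by omega))
  · exact not_graphE he (h1 (I + 1) (by omega)) hI1.symm hJ1 (h1 J (by omega)) hzz
      (fun h => hI2 (I + 1) (by omega) h.symm) (h2 _ _ (by omega) (by omega) (by omega))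
      (h2 _ _ (by omega) (by omega) (by omega)) (fun h => hf (I + 1) (by omega) (by omega) h.symm)
      (h2 _ _ (by omega) (by omega) (by omega)) (h2 _ _ (by omega) (by omega) (by omega))
      (fun h => hf (I + 2) (by omega) (by omega) h.symm) (hJ2 _ (by omega) (by omega))
      (fun h => hf J (by omega) (by omega) h.symm)
      (fun h => hf (J + 1) (by omega) (by omega) h.symm)

/-- The sequence x', x, p 0, ..., p t, y, y' is a path to which `no_attachment` applies, with z
attached to its interior and z' attached to z; t ≥ 1 makes it long enough. Adjacencies among x', y',
z' play no role, so the private neighbors can be inserted for them. -/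
theorem no_path_attachment (hb : ¬ bull.IsIndContained G) (he : ¬ graphE.IsIndContained G)
    {t : ℕ} (ht : 1 ≤ t) {p : ℕ → V} (h1 : ∀ i, i < t → G.Adj (p i) (p (i + 1)))
    (h2 : ∀ i j, i + 2 ≤ j → j ≤ t → ¬ G.Adj (p i) (p j)) {x y z x' y' z' : V}
    (hx : ∀ i ≤ t, G.Adj x (p i) ↔ i = 0) (hy : ∀ i ≤ t, G.Adj y (p i) ↔ i = t)
    (hz : ∃ i ≤ t, G.Adj z (p i)) (hxy : ¬ G.Adj x y) (hxz : ¬ G.Adj x z) (hyz : ¬ G.Adj y z)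
    (hxx : G.Adj x x') (hyy : G.Adj y y') (hzz : G.Adj z z') (hxy' : ¬ G.Adj x y')
    (hxz' : ¬ G.Adj x z') (hyx' : ¬ G.Adj y x') (hyz' : ¬ G.Adj y z') (hzx' : ¬ G.Adj z x')
    (hzy' : ¬ G.Adj z y') (hpx : ∀ i ≤ t, ¬ G.Adj x' (p i)) (hpy : ∀ i ≤ t, ¬ G.Adj y' (p i))
    (hpz : ∀ i ≤ t, ¬ G.Adj z' (p i)) : False := by
  obtain ⟨i, hi, hzi⟩ := hz
  let f : ℕ → V := fun i => if i = 0 then x' else if i = 1 then x else if i ≤ t + 2 then p (i - 2)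
    else if i = t + 3 then y else y'
  have f0 : f 0 = x' := rfl
  have f1 : f 1 = x := rfl
  have f2 : ∀ i ≤ t, f (i + 2) = p i := fun i hi => by simp [f, hi]
  have f3 : f (t + 3) = y := by simp [f]
  have f4 : f (t + 4) = y' := by simp [f]
  have cases : ∀ m ≤ t + 4, m = 0 ∨ m = 1 ∨ (∃ i ≤ t, m = i + 2) ∨ m = t + 3 ∨ m = t + 4 :=
    fun m hm => by
      by_cases h0 : m = 0
      · exact .inl h0
      by_cases h0 : m = 1
      · exact .inr (.inl h0)
      by_cases h0 : m ≤ t + 2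
      · exact .inr (.inr (.inl ⟨m - 2, by omega, by omega⟩))
      omega
  refine no_attachment hb he (N := t + 4) (by omega) (f := f) (fun m hm => ?_)
    (fun m l hml hl hor => ?_) ⟨i + 2, by rwa [f2 i hi], by omega⟩ (fun m hm hzm => ?_) hzz
    (fun m h0 hm => ?_)
  · rcases cases m hm.le with rfl | rfl | ⟨j, hj, rfl⟩ | rfl | rfl
    · rw [f0, f1]; exact hxx.symm
    · rw [f1, f2 0 (by omega)]; exact (hx 0 (by omega)).2 rfl
    · rcases hj.lt_or_eq with hj' | rfl
      · rw [f2 j hj, show j + 2 + 1 = (j + 1) + 2 by omega, f2 (j + 1) hj']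
        exact h1 j hj'
      · rw [f2 j hj, f3]; exact ((hy j hj).2 rfl).symm
    · rw [f3, f4]; exact hyy
    · omega
  · rcases cases m (by omega) with rfl | rfl | ⟨j, hj, rfl⟩ | rfl | rfl <;>
      rcases cases l hl with rfl | rfl | ⟨j', hj', rfl⟩ | rfl | rfl <;> try omega
    · rw [f0, f2 j' hj']; exact hpx j' hj'
    · rw [f0, f3]; exact fun h => hyx' h.symm
    · rw [f1, f2 j' hj', hx j' hj']; omega
    · rw [f1, f3]; exact hxy
    · rw [f1, f4]; exact hxy'
    · rw [f2 j hj, f2 j' hj']; exact h2 j j' (by omega) hj'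
    · rw [f2 j hj, f3, G.adj_comm, hy j hj]; omega
    · rw [f2 j hj, f4, G.adj_comm]; exact hpy j hj
  · rcases cases m hm with rfl | rfl | ⟨j, hj, rfl⟩ | rfl | rfl
    · exact absurd (f0 ▸ hzm) hzx'
    · exact absurd (f1 ▸ hzm).symm hxz
    · omega
    · exact absurd (f3 ▸ hzm).symm hyz
    · exact absurd (f4 ▸ hzm) hzy'
  · rcases cases m hm.le with rfl | rfl | ⟨j, hj, rfl⟩ | rfl | rfl
    · omega
    · rw [f1]; exact fun h => hxz' h.symm
    · rw [f2 j hj]; exact hpz j hj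
    · rw [f3]; exact fun h => hyz' h.symm
    · omega

/-- Private neighbors of vertices attached to an induced path, if they are not attached to it. -/
theorem adj_private_of_path (hb : ¬ bull.IsIndContained G) (he : ¬ graphE.IsIndContained G)
    {t : ℕ} {p : ℕ → V} (h1 : ∀ i, i < t → G.Adj (p i) (p (i + 1)))
    (h2 : ∀ i j, i + 2 ≤ j → j ≤ t → ¬ G.Adj (p i) (p j)) {a q : Fin 3 → V}
    (ha : ∀ x, ∃ i ≤ t, G.Adj (a x) (p i)) (haa : ∀ x y, ¬ G.Adj (a x) (a y))
    (haq : ∀ x y, G.Adj (a x) (q y) ↔ x = y) (hq : ∀ x, ∀ i ≤ t, ¬ G.Adj (q x) (p i)) :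
    G.Adj (q 0) (q 1) := by
  -- The path is shortened at either end as long as all three vertices stay attached to it.
  induction t generalizing p with
  | zero =>
    by_contra h
    have h3 : ∀ x, G.Adj (a x) (p 0) := fun x => by
      obtain ⟨i, hi, h⟩ := ha x
      rwa [Nat.le_zero.1 hi] at h
    have h4 : ∀ x y, G.Adj (q x) (a y) ↔ y = x := fun x y => by rw [G.adj_comm, haq]
    -- For a path with a single vertex: q 0 - a 0 - p 0 - a 1 - q 1 with a 2 attached to p 0.
    exact not_graphE he ((h4 0 0).2 rfl) (h3 0) (h3 1).symm ((haq 1 1).2 rfl) (h3 2).symm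
      (hq 0 0 le_rfl) (by rw [h4]; decide) h (by rw [h4]; decide) (haa _ _)
      (by rw [haq]; decide) (haa _ _) (fun h => hq 1 0 le_rfl h.symm) (haa _ _)
      (by rw [h4]; decide)
  | succ t ih =>
    by_cases hl : ∀ x, ∃ i ≤ t, G.Adj (a x) (p i)
    · exact ih (fun i hi => h1 i (by omega)) (fun i j hij hj => h2 i j hij (by omega)) hl
        fun x i hi => hq x i (by omega)
    by_cases hr : ∀ x, ∃ i ≤ t, G.Adj (a x) (p (i + 1))
    · exact ih (p := fun i => p (i + 1)) (fun i hi => h1 (i + 1) (by omega))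
        (fun i j hij hj => h2 (i + 1) (j + 1) (by omega) (by omega)) hr
        fun x i hi => hq x (i + 1) (by omega)
    push Not at hl hr
    -- The path cannot be shortened: some x is attached to its first vertex only and some y to its
    -- last vertex only. The remaining third vertex z gives the contradiction.
    obtain ⟨y, hy⟩ := hl
    obtain ⟨x, hx⟩ := hr
    exfalso
    have hx' : ∀ i ≤ t + 1, G.Adj (a x) (p i) ↔ i = 0 := by
      have h3 : ∀ i ≤ t + 1, G.Adj (a x) (p i) → i = 0 := fun i hi h => by
        by_contra h0
        obtain ⟨j, rfl⟩ := Nat.exists_eq_succ_of_ne_zero h0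
        exact hx j (by omega) h
      obtain ⟨i, hi, h⟩ := ha x
      exact fun j hj => ⟨h3 j hj, fun hj0 => by rw [hj0]; exact (h3 i hi h) ▸ h⟩
    have hy' : ∀ i ≤ t + 1, G.Adj (a y) (p i) ↔ i = t + 1 := by
      have h3 : ∀ i ≤ t + 1, G.Adj (a y) (p i) → i = t + 1 := fun i hi h => by
        by_contra h0
        exact hy i (by omega) h
      obtain ⟨i, hi, h⟩ := ha y
      exact fun j hj => ⟨h3 j hj, fun hj0 => by rw [hj0]; exact (h3 i hi h) ▸ h⟩
    have hxy : x ≠ y := by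
      rintro rfl
      have := (hx' 0 (by omega)).2 rfl
      have := (hy' 0 (by omega)).1 this
      omega
    obtain ⟨z, hzx, hzy⟩ : ∃ z : Fin 3, z ≠ x ∧ z ≠ y :=
      (by decide : ∀ x y : Fin 3, ∃ z : Fin 3, z ≠ x ∧ z ≠ y) x y
    exact no_path_attachment hb he (by omega) h1 h2 hx' hy' (ha z) (haa x y) (haa x z) (haa y z)
      ((haq x x).2 rfl) ((haq y y).2 rfl) ((haq z z).2 rfl) (by rwa [haq]) (by rw [haq]; tauto)
      (by rw [haq]; tauto) (by rw [haq]; tauto) (by rwa [haq]) (by rwa [haq]) (hq x) (hq y) (hq z)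

end

/-! ### Properties of the cuts and the pieces -/

/-- As long as no fixed point is reached, every step lowers the natural number μ, so `l.length ≥ μ
s` iterations suffice. The components, the clique and the path are all computed in this way. -/
theorem iter_invariant {σ α : Type} {f : σ → σ} {μ : σ → ℕ} {I : σ → Prop} {s : σ} {l : List α}
    (hI : ∀ s, I s → I (f s)) (hμ : ∀ s, I s → f s = s ∨ μ (f s) < μ s) (hs : I s)
    (hl : μ s ≤ l.length) : I (iter f s l) ∧ f (iter f s l) = iter f s l := by
  have key : ∀ l : List α, I (iter f s l) ∧
      (f (iter f s l) = iter f s l ∨ μ (iter f s l) + l.length ≤ μ s) := by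
    intro l
    induction l with
    | nil => exact ⟨hs, .inr le_rfl⟩
    | cons a l ih =>
      obtain ⟨h1, h2⟩ := ih
      have h3 : iter f s (a :: l) = f (iter f s l) := rfl
      rw [h3]
      refine ⟨hI _ h1, ?_⟩
      rcases h2 with h2 | h2
      · rw [h2]; exact .inl h2
      · rcases hμ _ h1 with h4 | h4
        · rw [h4]; exact .inl h4
        · exact .inr (by rw [List.length_cons]; omega)
  obtain ⟨h1, h2⟩ := key l
  refine ⟨h1, h2.elim id fun h2 => ?_⟩
  rcases hμ _ h1 with h4 | h4
  · exact h4
  · omega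

section

variable {n : ℕ} {adj : Fin n → Fin n → Bool}

/-- Connectivity in the graph on `V` without the cuts. -/
def Conn (adj : Fin n → Fin n → Bool) (cs : List (Cut n)) (V : List (Fin n)) :
    Fin n → Fin n → Prop :=
  Relation.ReflTransGen fun x y => x ∈ V ∧ y ∈ V ∧ adjCut adj cs x y = true

theorem adjCut_symm (hs : ∀ u v, adj u v = adj v u) (cs : List (Cut n)) (u v : Fin n) :
    adjCut adj cs u v = adjCut adj cs v u := by
  simp only [adjCut, hs u v, Bool.or_comm]

theorem Conn.symm (hs : ∀ u v, adj u v = adj v u) {cs : List (Cut n)} {V : List (Fin n)}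
    {u v : Fin n} (h : Conn adj cs V u v) : Conn adj cs V v u := by
  induction h with
  | refl => exact .refl
  | tail _ h ih => exact .head ⟨h.2.1, h.1, adjCut_symm hs cs _ _ ▸ h.2.2⟩ ih

theorem Conn.mem {cs : List (Cut n)} {V : List (Fin n)} {S : Fin n → Prop} {u v : Fin n}
    (h : Conn adj cs V u v) (hS : ∀ x y, S x → x ∈ V → y ∈ V → adjCut adj cs x y = true → S y)
    (hu : S u) : S v := by
  induction h with
  | refl => exact hu
  | tail _ h ih => exact hS _ _ ih h.1 h.2.1 h.2.2

theorem mem_expand {cs : List (Cut n)} {V S : List (Fin n)} {w : Fin n} :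
    w ∈ expand adj cs V S ↔ w ∈ V ∧ (w ∈ S ∨ ∃ s ∈ S, adjCut adj cs s w = true) := by
  simp [expand]

theorem sublist_filter_of_forall {α : Type} {S V : List α} {p : α → Bool} (h : S.Sublist V)
    (hp : ∀ a ∈ S, p a = true) : S.Sublist (V.filter p) := by
  have h1 := h.filter p
  rwa [List.filter_eq_self.2 hp] at h1

/-- The computed sublist of V grows strictly until it is stable, which takes at most |V| rounds; a
stable set is closed under adjacency and so contains everything connected to v. -/
theorem reach_spec' {cs : List (Cut n)} {V : List (Fin n)} {v : Fin n} (hv : v ∈ V) :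
    (reach adj cs V v).Sublist V ∧ ∀ w, w ∈ reach adj cs V v ↔ Conn adj cs V v w := by
  have hsub : ∀ S : List (Fin n), S.Sublist V → S.Sublist (expand adj cs V S) := fun S hS =>
    sublist_filter_of_forall hS fun a ha => by simp [ha]
  obtain ⟨⟨h1, h2, h3⟩, h4⟩ := iter_invariant (f := expand adj cs V) (l := V) (s := [v])
    (μ := fun S => V.length - S.length)
    (I := fun S => S.Sublist V ∧ v ∈ S ∧ ∀ w ∈ S, Conn adj cs V v w)
    (fun S ⟨h1, h2, h3⟩ => ⟨List.filter_sublist, (hsub S h1).subset h2, fun w hw => by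
      obtain ⟨hwV, hw | ⟨s, hs, hsw⟩⟩ := mem_expand.1 hw
      · exact h3 w hw
      · exact (h3 s hs).tail ⟨h1.subset hs, hwV, hsw⟩⟩)
    (fun S ⟨h1, h2, h3⟩ => by
      by_cases hl : (expand adj cs V S).length ≤ S.length
      · exact .inl ((hsub S h1).eq_of_length_le hl).symm
      · have : (expand adj cs V S).length ≤ V.length := List.length_filter_le _ _
        exact .inr (by omega))
    ⟨by simpa using hv, by simp, fun w hw => by rw [List.mem_singleton.1 hw]; exact .refl⟩
    (Nat.sub_le _ _)
  refine ⟨h1, fun w => ⟨h3 w, fun hw => ?_⟩⟩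
  refine hw.mem (S := fun w => w ∈ reach adj cs V v) (fun x y hx hxV hy hxy => ?_) h2
  change y ∈ iter _ _ _
  rw [← h4]
  exact mem_expand.2 ⟨hy, .inr ⟨x, hx, hxy⟩⟩

theorem piecesOf_cons (cs : List (Cut n)) (V V' : List (Fin n)) (v : Fin n) :
    piecesOf adj cs V (v :: V') =
      if (piecesOf adj cs V V').any fun W => decide (v ∈ W) then piecesOf adj cs V V'
      else reach adj cs V v :: piecesOf adj cs V V' := rfl

theorem exists_of_mem_piecesOf {cs : List (Cut n)} {V V' W : List (Fin n)}
    (hW : W ∈ piecesOf adj cs V V') : ∃ v ∈ V', W = reach adj cs V v := by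
  induction V' with
  | nil => simp [piecesOf] at hW
  | cons v V' ih =>
    rw [piecesOf_cons] at hW
    split at hW
    · obtain ⟨w, h1, h2⟩ := ih hW
      exact ⟨w, by simp [h1], h2⟩
    · rcases List.mem_cons.1 hW with rfl | hW
      · exact ⟨v, by simp, rfl⟩
      · obtain ⟨w, h1, h2⟩ := ih hW
        exact ⟨w, by simp [h1], h2⟩

theorem exists_mem_piecesOf {cs : List (Cut n)} {V V' : List (Fin n)} (hV : V' ⊆ V) {v : Fin n}
    (hv : v ∈ V') : ∃ W ∈ piecesOf adj cs V V', v ∈ W := by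
  induction V' with
  | nil => simp at hv
  | cons w V' ih =>
    have h1 : v ∈ V' → ∃ W ∈ piecesOf adj cs V V', v ∈ W := ih fun x hx => hV (by simp [hx])
    rw [piecesOf_cons]
    split
    · rename_i h2
      rcases List.mem_cons.1 hv with rfl | hv
      · simpa using h2
      · exact h1 hv
    · rcases List.mem_cons.1 hv with rfl | hv
      · exact ⟨_, List.mem_cons_self, ((reach_spec' (hV (by simp))).2 _).2 .refl⟩
      · obtain ⟨W, h3, h4⟩ := h1 hv
        exact ⟨W, List.mem_cons_of_mem _ h3, h4⟩

theorem conn_of_mem_piecesOf (hs : ∀ u v, adj u v = adj v u) {cs : List (Cut n)}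
    {V V' W : List (Fin n)} (hV : V' ⊆ V) (hW : W ∈ piecesOf adj cs V V') {u : Fin n}
    (hu : u ∈ W) (v : Fin n) : v ∈ W ↔ Conn adj cs V u v := by
  obtain ⟨w, hw, rfl⟩ := exists_of_mem_piecesOf hW
  have h1 := (reach_spec' (adj := adj) (cs := cs) (hV hw)).2
  rw [h1] at hu ⊢
  exact ⟨fun h => (hu.symm hs).trans h, fun h => hu.trans h⟩

theorem sublist_of_mem_piecesOf {cs : List (Cut n)} {V V' W : List (Fin n)} (hV : V' ⊆ V)
    (hW : W ∈ piecesOf adj cs V V') : W.Sublist V := by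
  obtain ⟨w, hw, rfl⟩ := exists_of_mem_piecesOf hW
  exact (reach_spec' (hV hw)).1

theorem pairwise_piecesOf (hs : ∀ u v, adj u v = adj v u) {cs : List (Cut n)}
    {V V' : List (Fin n)} (hV : V' ⊆ V) : (piecesOf adj cs V V').Pairwise List.Disjoint := by
  induction V' with
  | nil => simp [piecesOf]
  | cons v V' ih =>
    have hV' : V' ⊆ V := fun x hx => hV (by simp [hx])
    rw [piecesOf_cons]
    split
    · exact ih hV'
    · rename_i h1
      refine List.pairwise_cons.2 ⟨fun W hW x hx hxW => h1 ?_, ih hV'⟩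
      rw [(reach_spec' (hV (by simp))).2] at hx
      simp only [List.any_eq_true, decide_eq_true_eq]
      exact ⟨W, hW, (conn_of_mem_piecesOf hs hV' hW hxW v).2 (hx.symm hs)⟩

theorem big_iff {V W : List (Fin n)} : big V W = true ↔ V.length < 2 * W.length := by
  simp only [big, Bool.not_eq_true', List.isEmpty_eq_false_iff, ne_eq, List.drop_eq_nil_iff,
    List.length_append]
  omega

theorem mem_nb {u w : Fin n} {D : List (Fin n)} : w ∈ nb adj u D ↔ w ∈ D ∧ adj u w = true := by
  simp [nb]

theorem mem_nonNb {u w : Fin n} {D : List (Fin n)} :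
    w ∈ nonNb adj u D ↔ w ∈ D ∧ adj u w = false ∧ u ≠ w := by
  simp [nonNb]

theorem mem_diff {C D : List (Fin n)} {w : Fin n} : w ∈ diff C D ↔ w ∈ D ∧ w ∉ C := by
  simp [diff]

theorem length_diff {C D : List (Fin n)} (hC : C.Sublist D) (hD : D.Nodup) :
    (diff C D).length + C.length = D.length := by
  have h1 := List.length_eq_length_filter_add (l := D) fun w => decide (w ∈ C)
  have h2 : (D.filter fun w => decide (w ∈ C)).length = C.length := by
    refine List.Perm.length_eq ((List.perm_ext_iff_of_nodup (hD.filter _) (hD.sublist hC)).2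
      fun a => ?_)
    simp only [List.mem_filter, decide_eq_true_eq]
    exact ⟨fun h => h.2, fun h => ⟨hC.subset h, h⟩⟩
  unfold diff
  omega

theorem adjCut_nil (u v : Fin n) : adjCut adj [] u v = adj u v := by
  simp [adjCut]

theorem adj_of_adjCut {cs : List (Cut n)} {u v : Fin n} (h : adjCut adj cs u v = true) :
    adj u v = true := by
  simp only [adjCut, Bool.and_eq_true] at h
  exact h.1

theorem not_sep_of_adjCut {cs : List (Cut n)} {u v : Fin n} (h : adjCut adj cs u v = true)
    {c : Cut n} (hc : c ∈ cs) : ¬ (u ∈ c.1 ∧ v ∈ c.2) ∧ ¬ (v ∈ c.1 ∧ u ∈ c.2) := by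
  simp only [adjCut, Cut.sep, Bool.and_eq_true, Bool.not_eq_true', List.any_eq_false,
    Bool.or_eq_true, decide_eq_true_eq] at h
  have := h.2 c hc
  tauto

/-! ### The clique -/

variable {G : SimpleGraph (Fin n)} {V : List (Fin n)}

/-- Start with the empty clique and D = V. Adding v to K replaces D by its neighbors of v, which
loses at least v itself. At the fixed point no vertex of D can be added, and this is the last
conjunct. -/
theorem cliquePart_spec (ha : ∀ u v, adj u v = true ↔ G.Adj u v) (hV : V ≠ []) :
    (cliquePart adj V).Sublist V ∧ big V (cliquePart adj V) = true ∧
      (∃ K : Set (Fin n), G.IsClique K ∧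
        ∀ w, w ∈ cliquePart adj V ↔ w ∈ V ∧ ∀ s ∈ K, G.Adj w s) ∧
      ∀ u ∈ cliquePart adj V, big V (nb adj u (cliquePart adj V)) = false := by
  obtain ⟨⟨h1, h2, h3⟩, h4⟩ := iter_invariant (f := cliqueStep adj V) (l := V) (s := V)
    (μ := List.length)
    (I := fun D => D.Sublist V ∧ big V D = true ∧ ∃ K : Set (Fin n), G.IsClique K ∧
      (∀ s ∈ K, s ∈ V) ∧ ∀ w, w ∈ D ↔ w ∈ V ∧ ∀ s ∈ K, G.Adj w s)
    (fun D ⟨h1, h2, K, hK, hKV, hD⟩ => by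
      unfold cliqueStep
      split
      · exact ⟨h1, h2, K, hK, hKV, hD⟩
      · rename_i v l hv
        have hv' : v ∈ bigNb adj V D D := hv ▸ List.mem_cons_self
        obtain ⟨hvD, hvb⟩ := List.mem_filter.1 hv'
        refine ⟨List.filter_sublist.trans h1, hvb, insert v K, ?_, ?_, fun w => ?_⟩
        · exact hK.insert fun s hs _ => ((hD v).1 hvD).2 s hs
        · rintro s (rfl | hs)
          · exact h1.subset hvD
          · exact hKV s hs
        · rw [mem_nb, hD, ha]
          constructor
          · rintro ⟨⟨h3, h4⟩, h5⟩
            refine ⟨h3, ?_⟩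
            rintro s (rfl | hs)
            · exact h5.symm
            · exact h4 s hs
          · rintro ⟨h3, h4⟩
            exact ⟨⟨h3, fun s hs => h4 s (.inr hs)⟩, (h4 v (.inl rfl)).symm⟩)
    (fun D _ => by
      unfold cliqueStep
      split
      · exact .inl rfl
      · rename_i v l hv
        have hv' : v ∈ bigNb adj V D D := hv ▸ List.mem_cons_self
        right
        refine List.length_filter_lt_length_iff_exists.2 ⟨v, (List.mem_filter.1 hv').1, ?_⟩
        rw [ha]
        exact G.loopless.irrefl v)
    ⟨.refl V, big_iff.2 (by have := List.length_pos_iff.2 hV; omega), ∅, by simp, by simp, by simp⟩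
    le_rfl
  refine ⟨h1, h2, ?_, fun u hu => ?_⟩
  · obtain ⟨K, hK, _, hD⟩ := h3
    exact ⟨K, hK, hD⟩
  · by_contra hb
    have hu' : u ∈ bigNb adj V (cliquePart adj V) (cliquePart adj V) :=
      List.mem_filter.2 ⟨hu, by simpa using hb⟩
    change cliqueStep adj V (cliquePart adj V) = cliquePart adj V at h4
    unfold cliqueStep at h4
    split at h4
    · rename_i h5
      rw [h5] at hu'
      simp at hu'
    · rename_i v l hv
      have hv' : v ∈ bigNb adj V (cliquePart adj V) (cliquePart adj V) := hv ▸ List.mem_cons_self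
      have h5 : v ∈ nb adj v (cliquePart adj V) := by
        rw [h4]
        exact (List.mem_filter.1 hv').1
      exact G.loopless.irrefl v ((ha _ _).1 (mem_nb.1 h5).2)

end

/-! ### The path -/

section

variable {n : ℕ} {adj : Fin n → Fin n → Bool} {G : SimpleGraph (Fin n)} {V : List (Fin n)}

/-- A walk that starts in a component never leaves it, so connectivity in N yields connectivity in
W, as needed to iterate the construction of the path. -/
theorem conn_inside {N W : List (Fin n)} (hs : ∀ u v, adj u v = adj v u)
    (hW : W ∈ piecesOf adj [] N N) {x y : Fin n} (hx : x ∈ W) (hy : y ∈ W) :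
    Conn adj [] W x y := by
  have h := (conn_of_mem_piecesOf hs (List.Subset.refl N) hW hx y).1 hy
  clear hy
  induction h with
  | refl => exact .refl
  | tail h1 h2 ih =>
    have h3 := (conn_of_mem_piecesOf hs (List.Subset.refl N) hW hx _).2 h1
    have h4 := (conn_of_mem_piecesOf hs (List.Subset.refl N) hW hx _).2 (h1.tail h2)
    exact ih.tail ⟨h3, h4, h2.2.2⟩

theorem mem_of_adj_of_mem_piecesOf {N W : List (Fin n)} (hs : ∀ u v, adj u v = adj v u)
    (hW : W ∈ piecesOf adj [] N N) {x y : Fin n} (hx : x ∈ W) (hy : y ∈ N)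
    (hxy : adj x y = true) : y ∈ W :=
  (conn_of_mem_piecesOf hs (List.Subset.refl N) hW hx y).2
    (.single ⟨(sublist_of_mem_piecesOf (List.Subset.refl N) hW).subset hx, hy, by rwa [adjCut_nil]⟩)

/-- The invariant of the construction of the path: `s.1` is a connected set that is separated from
the rest of `D` by the neighborhood of an induced path that, with `s.2`, is extended by one more
vertex. -/
structure PathInvariant (G : SimpleGraph (Fin n)) (adj : Fin n → Fin n → Bool)
    (V D : List (Fin n)) (s : List (Fin n) × Fin n) : Prop where
  sublist : s.1.Sublist D
  big : big V s.1 = true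
  mem : s.2 ∈ D
  conn : ∀ x ∈ s.1, ∀ y ∈ s.1, Conn adj [] s.1 x y
  start : s.2 ∈ s.1 ∨ ∃ w ∈ s.1, G.Adj s.2 w
  path : ∃ (t : ℕ) (p : ℕ → Fin n), p t = s.2 ∧ (∀ i < t, G.Adj (p i) (p (i + 1))) ∧
    (∀ i j, i + 2 ≤ j → j ≤ t → ¬ G.Adj (p i) (p j)) ∧
    (∀ i < t, ∀ c ∈ s.1, ¬ G.Adj (p i) c) ∧
    ∀ w ∈ D, w ∉ s.1 → (∃ c ∈ s.1, G.Adj w c) → ∃ i < t, G.Adj w (p i)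

theorem mem_bigComps {C W : List (Fin n)} :
    W ∈ bigComps adj V C ↔ W ∈ piecesOf adj [] C C ∧ big V W = true := by
  simp [bigComps, bigs]

/-- If no neighbor of `s.2` in `s.1` had a neighbor in C, the complement of C in `s.1` would be
closed under adjacency. It is nonempty, as it contains `s.2` or a neighbor of it, which contradicts
the connectivity of `s.1`. So the path can always be extended towards a large component. -/
theorem PathInvariant.exists_touching (ha : ∀ u v, adj u v = true ↔ G.Adj u v)
    {D : List (Fin n)} {s : List (Fin n) × Fin n} (h : PathInvariant G adj V D s)
    {C : List (Fin n)} (hC : C ∈ bigComps adj V (nonNb adj s.2 s.1)) :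
    touching adj C (nb adj s.2 s.1) ≠ [] := by
  have hs : ∀ u v, adj u v = adj v u := fun u v => by
    rw [Bool.eq_iff_iff, ha, ha, G.adj_comm]
  obtain ⟨hC, hb⟩ := mem_bigComps.1 hC
  have hCN := (sublist_of_mem_piecesOf (List.Subset.refl _) hC).subset
  intro h0
  have key : ∀ x y, x ∉ C → x ∈ s.1 → y ∈ s.1 → adjCut adj [] x y = true → y ∉ C := by
    intro x y hx hxs hys hxy hy
    rw [adjCut_nil] at hxy
    have hyN := mem_nonNb.1 (hCN hy)
    by_cases hux : adj s.2 x = true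
    · have h1 : x ∈ touching adj C (nb adj s.2 s.1) := by
        refine List.mem_filter.2 ⟨mem_nb.2 ⟨hxs, hux⟩, ?_⟩
        have h2 : y ∈ nb adj x C := mem_nb.2 ⟨hy, hxy⟩
        cases h3 : nb adj x C with
        | nil => rw [h3] at h2; simp at h2
        | cons _ _ => rfl
      rw [h0] at h1
      simp at h1
    · by_cases hux' : s.2 = x
      · rw [hux', hxy] at hyN
        simp at hyN
      · refine hx (mem_of_adj_of_mem_piecesOf hs hC hy (mem_nonNb.2 ⟨hxs, by simpa using hux,
          hux'⟩) (by rw [hs]; exact hxy))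
  have h1 : ∃ x ∈ s.1, x ∉ C := by
    rcases h.start with h1 | ⟨w, h1, h2⟩
    · exact ⟨_, h1, fun h2 => (mem_nonNb.1 (hCN h2)).2.2 rfl⟩
    · refine ⟨w, h1, fun h3 => ?_⟩
      have := (mem_nonNb.1 (hCN h3)).2.1
      rw [(ha _ _).2 h2] at this
      simp at this
  obtain ⟨x, hx, hxC⟩ := h1
  have h2 : C ≠ [] := by
    rintro rfl
    have := big_iff.1 hb
    simp at this
  obtain ⟨y, hy⟩ := List.exists_mem_of_ne_nil _ h2
  exact (h.conn x hx y (mem_nonNb.1 (hCN hy)).1).mem (S := fun x => x ∉ C) key hxC hy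

theorem mem_touching {C D : List (Fin n)} {w : Fin n} :
    w ∈ touching adj C D ↔ w ∈ D ∧ ∃ c ∈ C, adj w c = true := by
  simp [touching, nb, List.filter_eq_nil_iff]

theorem PathInvariant.step (ha : ∀ u v, adj u v = true ↔ G.Adj u v)
    {D : List (Fin n)} {s : List (Fin n) × Fin n} (h : PathInvariant G adj V D s) :
    PathInvariant G adj V D (pathStep adj V s) := by
  have hs : ∀ u v, adj u v = adj v u := fun u v => by
    rw [Bool.eq_iff_iff, ha, ha, G.adj_comm]
  unfold pathStep
  split
  · exact h
  rename_i C l hC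
  split
  · exact h
  rename_i w l' hw
  have hC' : C ∈ bigComps adj V (nonNb adj s.2 s.1) := hC ▸ List.mem_cons_self
  have hw' : w ∈ touching adj C (nb adj s.2 s.1) := hw ▸ List.mem_cons_self
  clear hC hw
  obtain ⟨hC, hb⟩ := mem_bigComps.1 hC'
  have hCN := sublist_of_mem_piecesOf (List.Subset.refl _) hC
  obtain ⟨hw1, c, hc, hwc⟩ := mem_touching.1 hw'
  obtain ⟨hw1, hw2⟩ := mem_nb.1 hw1
  have hCs : C.Sublist s.1 := hCN.trans List.filter_sublist
  obtain ⟨t, p, hp, h1, h2, h3, h4⟩ := h.path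
  obtain ⟨p', q1, q2⟩ : ∃ p' : ℕ → Fin n, (∀ i ≤ t, p' i = p i) ∧ p' (t + 1) = w :=
    ⟨fun i => if i ≤ t then p i else w, fun i hi => if_pos hi, if_neg (by omega)⟩
  refine ⟨hCs.trans h.sublist, hb, h.sublist.subset hw1, fun x hx y hy => conn_inside hs hC hx hy,
    .inr ⟨c, hc, (ha _ _).1 hwc⟩, t + 1, p', q2, ?_, ?_, ?_, ?_⟩
  · intro i hi
    rcases (Nat.lt_succ_iff.1 hi).lt_or_eq with hi | rfl
    · rw [q1 i hi.le, q1 (i + 1) hi]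
      exact h1 i hi
    · rw [q1 i le_rfl, q2, hp]
      exact (ha _ _).1 hw2
  · intro i j hij hj
    rw [q1 i (by omega)]
    rcases hj.lt_or_eq with hj | rfl
    · rw [q1 j (by omega)]
      exact h2 i j hij (by omega)
    · rw [q2]
      exact h3 i (by omega) w hw1
  · intro i hi x hx
    rw [q1 i (by omega)]
    rcases (Nat.lt_succ_iff.1 hi).lt_or_eq with hi | rfl
    · exact h3 i hi x (hCs.subset hx)
    · rw [hp, ← ha]
      simp [(mem_nonNb.1 (hCN.subset hx)).2.1]
  -- A vertex with a neighbor in the new component C either lay in the old set, and then it is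
  -- adjacent to the old end `s.2`, because otherwise it would belong to C; or it lay outside, and
  -- then the old path already dominates it.
  · rintro x hx hxC ⟨y, hy, hxy⟩
    by_cases hxs : x ∈ s.1
    · by_cases hux : G.Adj x s.2
      · exact ⟨t, by omega, by rwa [q1 t le_rfl, hp]⟩
      · have hyN := mem_nonNb.1 (hCN.subset hy)
        by_cases hux' : s.2 = x
        · rw [hux', (ha _ _).2 hxy] at hyN
          simp at hyN
        · refine absurd (mem_of_adj_of_mem_piecesOf hs hC hy (mem_nonNb.2 ⟨hxs, ?_, hux'⟩) ?_) hxC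
          · rw [Bool.eq_false_iff, ne_eq, ha]
            exact fun h => hux h.symm
          · rw [ha]
            exact hxy.symm
    · obtain ⟨i, hi, h5⟩ := h4 x hx hxs ⟨y, hCs.subset hy, hxy⟩
      exact ⟨i, by omega, by rwa [q1 i hi.le]⟩

/-- Initially the path consists of u alone and nothing has to be dominated, since u :: C is a
component of D. Each extension shrinks the component, because the new end w is a neighbor of the old
end and is left out. -/
theorem pathPart_spec (ha : ∀ u v, adj u v = true ↔ G.Adj u v) {D C : List (Fin n)} {u : Fin n}
    (hDV : D.Sublist V) (hC : u :: C ∈ bigComps adj V D) :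
    PathInvariant G adj V D (pathPart adj V (u :: C) u) ∧
      bigComps adj V (nonNb adj (pathPart adj V (u :: C) u).2 (pathPart adj V (u :: C) u).1) = [] := by
  have hs : ∀ u v, adj u v = adj v u := fun u v => by
    rw [Bool.eq_iff_iff, ha, ha, G.adj_comm]
  obtain ⟨hC', hb⟩ := mem_bigComps.1 hC
  have hCD := sublist_of_mem_piecesOf (List.Subset.refl _) hC'
  have step : ∀ s, PathInvariant G adj V D s →
      bigComps adj V (nonNb adj s.2 s.1) = [] ∧ pathStep adj V s = s ∨
        (pathStep adj V s).1.length < s.1.length := by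
    intro s h
    unfold pathStep
    split
    · exact .inl ⟨by assumption, rfl⟩
    · rename_i C l hC
      have hC' : C ∈ bigComps adj V (nonNb adj s.2 s.1) := hC ▸ List.mem_cons_self
      split
      · exact absurd (by assumption) (h.exists_touching ha hC')
      · right
        rename_i w l' hw
        have hw' : w ∈ touching adj C (nb adj s.2 s.1) := hw ▸ List.mem_cons_self
        have hw1 := mem_nb.1 (mem_touching.1 hw').1
        refine (sublist_of_mem_piecesOf (List.Subset.refl _)
          (mem_bigComps.1 hC').1).length_le.trans_lt ?_
        exact List.length_filter_lt_length_iff_exists.2 ⟨w, hw1.1, by simp [hw1.2]⟩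
  obtain ⟨h1, h2⟩ := iter_invariant (f := pathStep adj V) (l := V) (s := (u :: C, u))
    (μ := fun s => s.1.length) (I := PathInvariant G adj V D) (fun s h => h.step ha)
    (fun s h => (step s h).imp (fun h => h.2) id)
    ⟨hCD, hb, hCD.subset (by simp), fun x hx y hy => conn_inside hs hC' hx hy, .inl (by simp), 0,
      fun _ => u, rfl, by simp, by omega, by simp, fun w hw hwC ⟨c, hc, hwc⟩ => absurd
        (mem_of_adj_of_mem_piecesOf hs hC' hc hw ((ha _ _).2 hwc.symm)) hwC⟩
    (hCD.trans hDV).length_le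
  refine ⟨h1, (step _ h1).elim (fun h => h.1) fun h => ?_⟩
  rw [h2] at h
  exact absurd h (lt_irrefl _)

/-! ### The sizes of the pieces -/

theorem length_le_of_subset {W S : List (Fin n)} (hW : W.Nodup) (h : W ⊆ S) :
    W.length ≤ S.length :=
  (List.subperm_of_subset hW h).length_le

/-- No piece crosses a cut, so each one lies in one of V \ D, D \ C, N(u) ∩ C, {u} and C without the
closed neighborhood of u, or in D itself if no path was needed. V \ D and D \ C are small because D
and C are large; the last two sets need not be small, but have no large components. -/
theorem pieces_halved (ha : ∀ u v, adj u v = true ↔ G.Adj u v) (hV : V.Nodup)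
    (h2 : 2 ≤ V.length) {W : List (Fin n)} (hW : W ∈ pieces adj V) : 2 * W.length ≤ V.length := by
  have hs : ∀ u v, adj u v = adj v u := fun u v => by
    rw [Bool.eq_iff_iff, ha, ha, G.adj_comm]
  have hW0 := hW
  obtain ⟨v, hv, rfl⟩ := exists_of_mem_piecesOf hW
  have hWn : (reach adj (cuts adj V) V v).Nodup :=
    hV.sublist (sublist_of_mem_piecesOf (List.Subset.refl V) hW)
  have hsub : ∀ S : List (Fin n), v ∈ S → (∀ x y, x ∈ S → x ∈ V → y ∈ V →
      adjCut adj (cuts adj V) x y = true → y ∈ S) → 2 * S.length ≤ V.length →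
      2 * (reach adj (cuts adj V) V v).length ≤ V.length := fun S hvS hS hSV => by
    have := length_le_of_subset hWn (S := S) fun w hw => (((reach_spec' hv).2 w).1 hw).mem hS hvS
    omega
  obtain ⟨hDV, hDb, -, hDn⟩ := cliquePart_spec (adj := adj) (V := V) ha (by rintro rfl; simp at h2)
  have hcut : cuts adj V = (cliquePart adj V, diff (cliquePart adj V) V) ::
    innerCuts adj V (cliquePart adj V) := rfl
  set D := cliquePart adj V with hD
  rw [big_iff] at hDb
  have hmemD : ∀ x y, x ∈ V → y ∈ V → adjCut adj (cuts adj V) x y = true → (x ∈ D ↔ y ∈ D) := by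
    intro x y hx hy hxy
    have := not_sep_of_adjCut hxy (hcut ▸ List.mem_cons_self)
    simp only [mem_diff] at this
    tauto
  by_cases hvD : v ∈ D
  swap
  · refine hsub (diff D V) (mem_diff.2 ⟨hv, hvD⟩) (fun x y hx hxV hy hxy => ?_) ?_
    · rw [mem_diff] at hx ⊢
      exact ⟨hy, fun h => hx.2 ((hmemD x y hxV hy hxy).2 h)⟩
    · have := length_diff hDV hV
      omega
  have hcomp : ∀ N : List (Fin n), v ∈ N → bigComps adj V N = [] → (∀ x y, x ∈ N → y ∈ V →
      adjCut adj (cuts adj V) x y = true → y ∈ N) →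
      2 * (reach adj (cuts adj V) V v).length ≤ V.length := by
    intro N hvN hN hcl
    obtain ⟨U, hU, hvU⟩ := exists_mem_piecesOf (adj := adj) (cs := []) (List.Subset.refl N) hvN
    have hUN := sublist_of_mem_piecesOf (List.Subset.refl _) hU
    refine hsub U hvU (fun x y hx hxV hy hxy => ?_) ?_
    · exact mem_of_adj_of_mem_piecesOf hs hU hx (hcl x y (hUN.subset hx) hy hxy)
        (adj_of_adjCut hxy)
    · by_contra h
      have : U ∈ bigComps adj V N := mem_bigComps.2 ⟨hU, big_iff.2 (by omega)⟩
      rw [hN] at this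
      simp at this
  unfold innerCuts at hcut
  split at hcut
  · rename_i h
    exact hcomp D hvD h fun x y hx hy hxy => (hmemD x y (hDV.subset hx) hy hxy).1 hx
  · rename_i l h
    have : [] ∈ bigComps adj V D := h ▸ List.mem_cons_self
    have := big_iff.1 (mem_bigComps.1 this).2
    simp at this
  · rename_i u C l h
    obtain ⟨hI, hN⟩ := pathPart_spec ha hDV (h ▸ List.mem_cons_self : u :: C ∈ bigComps adj V D)
    generalize pathPart adj V (u :: C) u = s at hI hN hcut
    obtain ⟨C, u⟩ := s
    have hCV : C.Sublist V := hI.sublist.trans hDV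
    have hCb : V.length < 2 * C.length := big_iff.1 hI.big
    have hc1 : ∀ x y, x ∈ D → y ∈ V → adjCut adj (cuts adj V) x y = true → (x ∈ C ↔ y ∈ C) := by
      intro x y hx hy hxy
      have h3 := (hmemD x y (hDV.subset hx) hy hxy).1 hx
      have := not_sep_of_adjCut hxy (c := (diff C D, C)) (by rw [hcut]; simp)
      simp only [mem_diff] at this
      tauto
    have hc2 : ∀ x y, x ∈ C → y ∈ V → adjCut adj (cuts adj V) x y = true →
        (x ∈ nb adj u C ↔ y ∈ nb adj u C) := by
      intro x y hx hy hxy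
      have h3 := (hc1 x y (hI.sublist.subset hx) hy hxy).1 hx
      have := not_sep_of_adjCut hxy (c := (nb adj u C, diff (nb adj u C) C)) (by rw [hcut]; simp)
      simp only [mem_diff] at this
      tauto
    by_cases hvC : v ∈ C
    swap
    · refine hsub (diff C D) (mem_diff.2 ⟨hvD, hvC⟩) (fun x y hx hxV hy hxy => ?_) ?_
      · rw [mem_diff] at hx ⊢
        exact ⟨(hmemD x y hxV hy hxy).1 hx.1, fun h => hx.2 ((hc1 x y hx.1 hy hxy).2 h)⟩
      · have : (diff C D).length + C.length = D.length := length_diff hI.sublist (hV.sublist hDV)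
        have := hDV.length_le
        omega
    -- The neighborhood of u in C is part of its neighborhood in D, which is small by the maximality
    -- of the clique.
    by_cases hvN : v ∈ nb adj u C
    · refine hsub (nb adj u C) hvN (fun x y hx hxV hy hxy =>
        (hc2 x y (mem_nb.1 hx).1 hy hxy).1 hx) ?_
      have h3 := hDn u hI.mem
      rw [Bool.eq_false_iff, ne_eq, big_iff] at h3
      have h4 : (nb adj u C).length ≤ (nb adj u D).length := (hI.sublist.filter _).length_le
      omega
    -- If u itself lies in C, it is isolated: all its edges inside C cross the third cut.
    by_cases hvu : v = u
    · subst hvu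
      refine hsub [v] (by simp) (fun x y hx hxV hy hxy => ?_) (by simpa using h2)
      rw [List.mem_singleton] at hx
      subst hx
      refine absurd ((hc2 x y hvC hy hxy).2 (mem_nb.2 ⟨?_, adj_of_adjCut hxy⟩)) hvN
      exact (hc1 x y hvD hy hxy).1 hvC
    · refine hcomp (nonNb adj u C) (mem_nonNb.2 ⟨hvC, ?_, fun h => hvu h.symm⟩) hN
        fun x y hx hy hxy => ?_
      · rw [Bool.eq_false_iff]
        exact fun h => hvN (mem_nb.2 ⟨hvC, h⟩)
      · obtain ⟨hx1, hx2, hx3⟩ := mem_nonNb.1 hx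
        have h3 := (hc1 x y (hI.sublist.subset hx1) hy hxy).1 hx1
        have hxn : x ∉ nb adj u C := fun h => by simp [(mem_nb.1 h).2] at hx2
        refine mem_nonNb.2 ⟨h3, ?_, ?_⟩
        · rw [Bool.eq_false_iff]
          exact fun h => hxn ((hc2 x y hx1 hy hxy).2 (mem_nb.2 ⟨h3, h⟩))
        · rintro rfl
          rw [hs, adj_of_adjCut hxy] at hx2
          simp at hx2

end

/-! ### The number of guesses -/

section

variable {n k : ℕ} {adj : Fin n → Fin n → Bool} {hadj : Fin k → Fin k → Bool}
  {rv : Fin n → Fin k → ℚ} {G : SimpleGraph (Fin n)} {H : SimpleGraph (Fin k)} {V : List (Fin n)}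

/-- If three pairwise nonadjacent vertices on the first side of the cut have private neighbors on
the second side, then these are adjacent. -/
def Cut.Good (G : SimpleGraph (Fin n)) (c : Cut n) : Prop :=
  ∀ a q : Fin 3 → Fin n, (∀ x, a x ∈ c.1) → (∀ x, q x ∈ c.2) → (∀ x y, ¬ G.Adj (a x) (a y)) →
    (∀ x y, G.Adj (a x) (q y) ↔ x = y) → G.Adj (q 0) (q 1)

theorem Cut.good_of_clique (hb : ¬ bull.IsIndContained G) (he : ¬ graphE.IsIndContained G)
    {c : Cut n} {K : Set (Fin n)} (hK : G.IsClique K) (h1 : ∀ a ∈ c.1, ∀ s ∈ K, G.Adj a s)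
    (h2 : ∀ q ∈ c.2, ∃ s ∈ K, ¬ G.Adj q s) : c.Good G := by
  intro a q ha hq haa haq
  have h3 : ∀ x y, x ≠ y → ¬ G.Adj (a x) (q y) := fun x y h => by rwa [haq]
  exact adj_private_of_clique hb he hK (h1 _ (ha 0)) (h1 _ (ha 1)) (h1 _ (ha 2)) (haa _ _)
    (haa _ _) (haa _ _) ((haq 0 0).2 rfl) (h3 1 0 (by decide)) (h3 2 0 (by decide))
    (h3 0 1 (by decide)) ((haq 1 1).2 rfl) (h3 2 1 (by decide)) (h2 _ (hq 0)) (h2 _ (hq 1))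

/-- Vertices outside D miss some vertex of the clique K that D is complete to, so the first cut is
of clique type. The last cut is also of this type, for the clique {u}. The cut (D \ C, C) is of path
type: vertices of D \ C with a private neighbor in C are attached to the path, and C is not. -/
theorem good_of_mem_cuts (hb : ¬ bull.IsIndContained G) (he : ¬ graphE.IsIndContained G)
    (ha : ∀ u v, adj u v = true ↔ G.Adj u v) (hV : V ≠ []) {c : Cut n} (hc : c ∈ cuts adj V) :
    c.1.Sublist V ∧ c.2.Sublist V ∧ c.Good G := by
  obtain ⟨hDV, -, ⟨K, hK, hDK⟩, -⟩ := cliquePart_spec (adj := adj) (V := V) ha hV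
  rcases List.mem_cons.1 hc with rfl | hc
  · refine ⟨hDV, List.filter_sublist, Cut.good_of_clique hb he hK
      (fun a ha => ((hDK a).1 ha).2) fun q hq => ?_⟩
    obtain ⟨h1, h2⟩ := mem_diff.1 hq
    rw [hDK] at h2
    push Not at h2
    exact h2 h1
  · generalize cliquePart adj V = D at *
    unfold innerCuts at hc
    split at hc
    · simp at hc
    · simp at hc
    · rename_i u C l h
      obtain ⟨hI, -⟩ := pathPart_spec ha hDV (h ▸ List.mem_cons_self : u :: C ∈ bigComps adj V D)
      generalize pathPart adj V (u :: C) u = s at hI hc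
      obtain ⟨C, u⟩ := s
      have hCV : C.Sublist V := hI.sublist.trans hDV
      rcases List.mem_cons.1 hc with rfl | hc
      · refine ⟨List.filter_sublist.trans hDV, hCV, fun a q haC hq haa haq => ?_⟩
        obtain ⟨t, p, -, h1, h2, h3, h4⟩ := hI.path
        have h5 : ∀ x, ∃ i < t, G.Adj (a x) (p i) := fun x => by
          obtain ⟨h6, h7⟩ := mem_diff.1 (haC x)
          exact h4 _ h6 h7 ⟨q x, hq x, (haq x x).2 rfl⟩
        obtain ⟨i, hi, -⟩ := h5 0
        -- The end p t is left out, since it may have neighbors in C; the index is meaningful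
        -- because some vertex is attached before it, so t is positive.
        refine adj_private_of_path hb he (t := t - 1) (p := p) (fun i hi => h1 i (by omega))
          (fun i j hij hj => h2 i j hij (by omega)) (fun x => ?_) haa haq
          fun x i hi h => h3 i (by omega) _ (hq x) h.symm
        obtain ⟨i, hi, h⟩ := h5 x
        exact ⟨i, by omega, h⟩
      · rw [List.mem_singleton] at hc
        subst hc
        refine ⟨List.filter_sublist.trans hCV, List.filter_sublist.trans hCV,
          Cut.good_of_clique hb he (K := {u}) (by simp) (fun a haC s hs => ?_) fun q hq => ?_⟩
        · rw [Set.mem_singleton_iff.1 hs]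
          exact ((ha _ _).1 (mem_nb.1 haC).2).symm
        · obtain ⟨h1, h2⟩ := mem_diff.1 hq
          refine ⟨u, rfl, fun h => h2 (mem_nb.2 ⟨h1, (ha _ _).2 h.symm⟩)⟩

theorem length_cuts (V : List (Fin n)) : (cuts adj V).length ≤ 3 := by
  unfold cuts innerCuts
  split <;> simp

theorem irredundant_iff {Y X X' : List (Fin n)} : irredundant adj Y X X' = true ↔
    ∀ a ∈ X', (∀ b ∈ X, adj a b = false) ∧
      ∃ q ∈ Y, adj a q = true ∧ ∀ b ∈ X, a ≠ b → adj b q = false := by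
  simp only [irredundant, hasPrivate, otherAdj, nb, Bool.not_eq_true', List.any_eq_false,
    Bool.not_eq_true, Bool.and_eq_true, List.isEmpty_iff,
    List.filter_eq_nil_iff, List.any_eq_true, Bool.not_eq_false, decide_eq_false_iff_not,
    not_and]

theorem irredundant_mono {Y X X' : List (Fin n)} (h : irredundant adj Y X X = true)
    (hX : X' ⊆ X) : irredundant adj Y X' X' = true := by
  rw [irredundant_iff] at h ⊢
  intro a ha
  obtain ⟨h1, q, hq, h2, h3⟩ := h a (hX ha)
  exact ⟨fun b hb => h1 b (hX hb), q, hq, h2, fun b hb => h3 b (hX hb)⟩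

theorem mem_addVertex {Y : List (Fin n)} {u : Fin n} {Xs : List (List (Fin n))}
    {X : List (Fin n)} : X ∈ addVertex adj Y u Xs ↔
      ∃ X' ∈ Xs, X = u :: X' ∧ irredundant adj Y (u :: X') (u :: X') = true := by
  induction Xs with
  | nil => simp [addVertex]
  | cons Z Xs ih =>
    simp only [addVertex, List.foldr_cons] at ih ⊢
    split <;> simp_all

theorem irredundantSets_cons (Y P : List (Fin n)) (u : Fin n) :
    irredundantSets adj Y (u :: P) =
      addVertex adj Y u (irredundantSets adj Y P) ++ irredundantSets adj Y P := rfl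

theorem mem_irredundantSets {Y P X : List (Fin n)} (hX : X.Sublist P)
    (h : irredundant adj Y X X = true) : X ∈ irredundantSets adj Y P := by
  induction P generalizing X with
  | nil => rw [List.sublist_nil.1 hX]; simp [irredundantSets]
  | cons u P ih =>
    rw [irredundantSets_cons, List.mem_append, mem_addVertex]
    cases hX with
    | cons _ hX => exact .inr (ih hX h)
    | cons_cons _ hX =>
      exact .inl ⟨_, ih hX (irredundant_mono h (List.subset_cons_self _ _)), rfl, h⟩

theorem irredundant_of_mem_irredundantSets {Y P X : List (Fin n)}
    (hX : X ∈ irredundantSets adj Y P) : irredundant adj Y X X = true := by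
  induction P with
  | nil => simp [irredundantSets] at hX; subst hX; rfl
  | cons u P ih =>
    rw [irredundantSets_cons, List.mem_append, mem_addVertex] at hX
    rcases hX with ⟨X', -, rfl, h⟩ | hX
    · exact h
    · exact ih hX

theorem addVertex_sublist (Y : List (Fin n)) (u : Fin n) (Xs : List (List (Fin n))) :
    (addVertex adj Y u Xs).Sublist (Xs.map fun X => u :: X) := by
  induction Xs with
  | nil => exact .refl _
  | cons Z Xs ih =>
    simp only [addVertex, List.foldr_cons, List.map_cons] at ih ⊢
    split
    · exact ih.cons_cons _
    · exact ih.cons _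

/-- Counting by whether u is chosen gives (p+1)^j + (p+1)^(j+1) ≤ (p+2)^(j+1), where p is the length
of the tail. -/
theorem length_irredundantSets_filter (Y P : List (Fin n)) (j : ℕ) :
    ((irredundantSets adj Y P).filter fun X => decide (X.length ≤ j)).length ≤
      (P.length + 1) ^ j := by
  induction P generalizing j with
  | nil => simp [irredundantSets]
  | cons u P ih =>
    rw [irredundantSets_cons, List.filter_append, List.length_append, List.length_cons]
    have h1 := ((addVertex_sublist (adj := adj) Y u (irredundantSets adj Y P)).filter
      fun X => decide (X.length ≤ j)).length_le
    rw [List.filter_map, List.length_map] at h1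
    cases j with
    | zero =>
      have h2 : ((fun X : List (Fin n) => decide (X.length ≤ 0)) ∘ fun X => u :: X) =
          fun _ => false := by
        funext X; simp
      rw [h2, List.filter_false] at h1
      have h3 := ih 0
      rw [pow_zero] at h3 ⊢
      rw [List.length_nil] at h1
      omega
    | succ j =>
      have h2 : ((fun X : List (Fin n) => decide (X.length ≤ j + 1)) ∘ fun X => u :: X) =
          fun X => decide (X.length ≤ j) := by
        funext X; simp
      rw [h2] at h1
      have h3 := ih j
      have h4 := ih (j + 1)
      have h5 : (P.length + 1) ^ j ≤ (P.length + 1 + 1) ^ j := Nat.pow_le_pow_left (by omega) j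
      have h6 := Nat.mul_le_mul_left (P.length + 1) h5
      rw [pow_succ] at h4 ⊢
      nlinarith

/-- For any two elements of X a third one completes the triple in `Cut.Good`, so the chosen private
neighbors are pairwise adjacent. They form a clique with |X| elements. The summand 2 covers the sets
that are too small to contain a triple. -/
theorem length_le_of_irredundant (ha : ∀ u v, adj u v = true ↔ G.Adj u v) {c : Cut n}
    (hc : c.Good G) {X : List (Fin n)} (hX : X.Nodup) (hXc : X ⊆ c.1)
    (h : irredundant adj c.2 X X = true) : X.length ≤ G.cliqueNum + 2 := by
  by_contra! hl
  rw [irredundant_iff] at h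
  have ha' : ∀ u v, adj u v = false ↔ ¬ G.Adj u v := fun u v => by
    rw [← ha, Bool.not_eq_true]
  choose! h1 q hq h2 h3 using h
  have hadj : ∀ a ∈ X.toFinset, ∀ b ∈ X.toFinset, a ≠ b → G.Adj (q a) (q b) := by
    intro a haX b hbX hab
    obtain ⟨d, hd, hda, hdb⟩ : ∃ d ∈ X.toFinset, d ≠ a ∧ d ≠ b := by
      have h4 : ({a, b} : Finset (Fin n)).card < X.toFinset.card := by
        rw [List.toFinset_card_of_nodup hX]
        exact Finset.card_le_two.trans_lt (by omega)
      obtain ⟨d, hd, hd'⟩ := Finset.exists_mem_notMem_of_card_lt_card h4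
      simp at hd'
      exact ⟨d, hd, hd'⟩
    rw [List.mem_toFinset] at haX hbX hd
    have h4 : ∀ x, ![a, b, d] x ∈ X := by
      intro x; fin_cases x <;> assumption
    have h5 : Function.Injective ![a, b, d] := by
      intro x y
      fin_cases x <;> fin_cases y <;> simp [hab, hab.symm, hda, hda.symm, hdb, hdb.symm]
    refine hc ![a, b, d] (fun x => q (![a, b, d] x)) (fun x => hXc (h4 x)) (fun x => hq _ (h4 x))
      (fun x y => (ha' _ _).1 (h1 _ (h4 x) _ (h4 y))) fun x y => ⟨fun h => ?_, ?_⟩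
    · by_contra hxy
      exact (ha' _ _).1 (h3 _ (h4 y) _ (h4 x) (fun h => hxy (h5 h).symm)) h
    · rintro rfl
      exact (ha _ _).1 (h2 _ (h4 x))
  have hinj : Set.InjOn q X.toFinset := fun a haX b hbX hab => by
    by_contra h
    have := hadj a haX b hbX h
    rw [hab] at this
    exact G.loopless.irrefl _ this
  have hcl : G.IsClique (X.toFinset.image q : Finset (Fin n)) := by
    intro x hx y hy hxy
    simp only [Finset.coe_image, Set.mem_image, Finset.mem_coe] at hx hy
    obtain ⟨a, haX, rfl⟩ := hx
    obtain ⟨b, hbX, rfl⟩ := hy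
    exact hadj a haX b hbX fun h => hxy (by rw [h])
  have := hcl.card_le_cliqueNum
  rw [Finset.card_image_of_injOn hinj, List.toFinset_card_of_nodup hX] at this
  omega

theorem length_irredundantSets (hb : ¬ bull.IsIndContained G) (he : ¬ graphE.IsIndContained G)
    (ha : ∀ u v, adj u v = true ↔ G.Adj u v) (hV : V ≠ []) (hVn : V.Nodup) {c : Cut n}
    (hc : c ∈ cuts adj V) :
    (irredundantSets adj c.2 c.1).length ≤ (n + 1) ^ (G.cliqueNum + 2) := by
  obtain ⟨h1, -, h2⟩ := good_of_mem_cuts hb he ha hV hc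
  have h3 := length_irredundantSets_filter (adj := adj) c.2 c.1 (G.cliqueNum + 2)
  rw [List.filter_eq_self.2] at h3
  · refine h3.trans (Nat.pow_le_pow_left (Nat.succ_le_succ ?_) _)
    simpa using (hVn.sublist h1).length_le_card
  · intro X hX
    have h4 := sublist_of_mem_irredundantSets hX
    exact decide_eq_true (length_le_of_irredundant ha h2 (hVn.sublist (h4.trans h1)) h4.subset
      (irredundant_of_mem_irredundantSets hX))

theorem length_refineSets (c : Cut n) (a : Fin k) (Os : List (List (Opt n k)))
    (Xs : List (List (Fin n))) :
    (refineSets adj hadj c a Os Xs).length = Xs.length * Os.length := by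
  induction Xs with
  | nil => simp [refineSets]
  | cons X Xs ih =>
    simp only [refineSets, List.foldr_cons, List.length_append, refineAll, List.length_map,
      List.length_cons] at ih ⊢
    rw [ih]
    ring

theorem length_refinements (O : List (Opt n k)) (ts : List (Cut n × Fin k)) {L : ℕ}
    (hts : ∀ t ∈ ts, (irredundantSets adj t.1.2 t.1.1).length ≤ L) :
    (refinements adj hadj O ts).length ≤ L ^ ts.length := by
  induction ts with
  | nil => simp [refinements]
  | cons t ts ih =>
    have h1 : refinements adj hadj O (t :: ts) = refineSets adj hadj t.1 t.2
      (refinements adj hadj O ts) (irredundantSets adj t.1.2 t.1.1) := rfl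
    rw [h1, length_refineSets, List.length_cons, pow_succ, mul_comm]
    exact Nat.mul_le_mul (ih fun t ht => hts t (by simp [ht])) (hts t (by simp))

end

/-! ### Correctness -/

section

variable {n k : ℕ} {adj : Fin n → Fin n → Bool} {hadj : Fin k → Fin k → Bool}
  {rv : Fin n → Fin k → ℚ} {G : SimpleGraph (Fin n)} {H : SimpleGraph (Fin k)} {V : List (Fin n)}

/-- A set of options that describes a partial `H`-coloring of `G`. -/
def Consistent (G : SimpleGraph (Fin n)) (H : SimpleGraph (Fin k)) (T : Opt n k → Prop) : Prop :=
  ∀ o o', T o → T o' → (o.1 = o'.1 → o.2 = o'.2) ∧ (G.Adj o.1 o'.1 → H.Adj o.2 o'.2)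

theorem Consistent.mono {T T' : Opt n k → Prop} (h : Consistent G H T) (hT : ∀ o, T' o → T o) :
    Consistent G H T' :=
  fun o o' ho ho' => h o o' (hT o ho) (hT o' ho')

theorem compatible_iff {c : Cut n} {a : Fin k} {X : List (Fin n)} {o : Opt n k} :
    compatible adj hadj c a X o = true ↔
      (o.1 ∈ c.2 → (∃ x ∈ X, adj o.1 x = true) → hadj a o.2 = true) ∧
      (o.1 ∈ c.1 → o.2 = a → ∀ q ∈ c.2, adj o.1 q = true → ∃ x ∈ X, adj q x = true) := by
  have h1 : ∀ q : Fin n, (nb adj q X).isEmpty = true ↔ ¬ ∃ x ∈ X, adj q x = true := by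
    intro q
    simp [nb, List.filter_eq_nil_iff]
  have h2 : ∀ q : Fin n, (nb adj q X).isEmpty = false ↔ ∃ x ∈ X, adj q x = true := by
    intro q
    rw [← not_iff_not, Bool.not_eq_false, h1]
  have h3 : undominated adj c.2 X o.1 = true ↔
      ¬ ∀ q ∈ c.2, adj o.1 q = true → ∃ x ∈ X, adj q x = true := by
    simp only [undominated, List.any_eq_true, Bool.and_eq_true, h1]
    push Not
    rfl
  simp only [compatible, Bool.not_eq_true', Bool.or_eq_false_iff, Bool.and_eq_false_iff,
    decide_eq_false_iff_not, Bool.not_eq_false', h1]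
  rw [← Bool.not_eq_true (undominated adj c.2 X o.1), h3]
  generalize (∃ x ∈ X, adj o.1 x = true) = A
  generalize (∀ q ∈ c.2, adj o.1 q = true → ∃ x ∈ X, adj q x = true) = B
  tauto

/-- For every set of options there is a guess with which it is compatible. -/
theorem exists_compatible (ha : ∀ u v, adj u v = true ↔ G.Adj u v)
    (hh : ∀ a b, hadj a b = true ↔ H.Adj a b) {T : Opt n k → Prop} (hT : Consistent G H T)
    (c : Cut n) (a : Fin k) :
    ∃ X ∈ irredundantSets adj c.2 c.1, ∀ o, T o → compatible adj hadj c a X o = true := by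
  classical
  have hs : ∀ u v, adj u v = adj v u := fun u v => by
    rw [Bool.eq_iff_iff, ha, ha, G.adj_comm]
  have ha' : ∀ u v, adj u v = false ↔ ¬ G.Adj u v := fun u v => by
    rw [← ha, Bool.not_eq_true]
  set A : List (Fin n) := c.1.filter fun v => decide (T (v, a)) with hA
  have hmem : ∀ v, v ∈ A ↔ v ∈ c.1 ∧ T (v, a) := fun v => by simp [hA]
  -- The guess is a shortest sublist of the color class A with the same neighbors in `c.2`. It is
  -- stable because A is: H has no loop at a.
  have hex : ∃ m, ∃ X : List (Fin n), X.length = m ∧ X.Sublist A ∧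
      ∀ q ∈ c.2, ∀ v ∈ A, adj v q = true → ∃ x ∈ X, adj x q = true :=
    ⟨_, A, rfl, .refl A, fun q _ v hv h => ⟨v, hv, h⟩⟩
  obtain ⟨X, hXm, hXA, hX⟩ := Nat.find_spec hex
  refine ⟨X, mem_irredundantSets (hXA.trans List.filter_sublist) (irredundant_iff.2
    fun x hx => ⟨fun y hy => ?_, ?_⟩), fun o ho => compatible_iff.2 ⟨fun h1 h2 => ?_,
      fun h1 h2 q hq h3 => ?_⟩⟩
  · rw [ha']
    intro hxy
    exact H.loopless.irrefl a ((hT _ _ ((hmem x).1 (hXA.subset hx)).2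
      ((hmem y).1 (hXA.subset hy)).2).2 hxy)
  -- By minimality, some vertex q loses all its neighbors when x is removed; this q is a private
  -- neighbor of x.
  · have h1 : (X.erase x).length < Nat.find hex := by
      have := List.length_pos_of_mem hx
      rw [List.length_erase_of_mem hx, ← hXm]
      omega
    have h2 := Nat.find_min hex h1
    push Not at h2
    obtain ⟨q, hq, v, hv, hvq, h3⟩ := h2 _ rfl (List.erase_sublist.trans hXA)
    obtain ⟨y, hy, hyq⟩ := hX q hq v hv hvq
    refine ⟨q, hq, ?_, fun b hb hxb => ?_⟩
    · by_cases hyx : y = x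
      · rwa [← hyx]
      · exact absurd hyq (h3 y ((List.mem_erase_of_ne hyx).2 hy))
    · rw [Bool.eq_false_iff]
      exact h3 b ((List.mem_erase_of_ne (Ne.symm hxb)).2 hb)
  · obtain ⟨x, hx, hox⟩ := h2
    rw [hh]
    exact (hT _ _ ((hmem x).1 (hXA.subset hx)).2 ho).2 ((ha _ _).1 hox).symm
  · obtain ⟨x, hx, hxq⟩ := hX q hq o.1 ((hmem _).2 ⟨h1, by rw [← h2]; exact ho⟩) h3
    exact ⟨x, hx, by rwa [hs]⟩

theorem refinements_cons (O : List (Opt n k)) (t : Cut n × Fin k) (ts : List (Cut n × Fin k)) :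
    refinements adj hadj O (t :: ts) = refineSets adj hadj t.1 t.2 (refinements adj hadj O ts)
      (irredundantSets adj t.1.2 t.1.1) := rfl

theorem exists_refinement (ha : ∀ u v, adj u v = true ↔ G.Adj u v)
    (hh : ∀ a b, hadj a b = true ↔ H.Adj a b) {T : Opt n k → Prop} (hT : Consistent G H T)
    {O : List (Opt n k)} (hO : ∀ o, T o → o ∈ O) (ts : List (Cut n × Fin k)) :
    ∃ O' ∈ refinements adj hadj O ts, ∀ o, T o → o ∈ O' := by
  induction ts with
  | nil => exact ⟨O, by simp [refinements], hO⟩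
  | cons t ts ih =>
    obtain ⟨O', h1, h2⟩ := ih
    obtain ⟨X, h3, h4⟩ := exists_compatible ha hh hT t.1 t.2
    refine ⟨_, (refinements_cons O t ts).symm ▸ exists_of_mem_refineSets.2 ⟨X, h3, O', h1, rfl⟩,
      fun o ho => List.mem_filter.2 ⟨h2 o ho, h4 o ho⟩⟩

theorem exists_compatible_of_mem_refinements {O O' : List (Opt n k)} {ts : List (Cut n × Fin k)}
    (h : O' ∈ refinements adj hadj O ts) {t : Cut n × Fin k} (ht : t ∈ ts) :
    ∃ X, ∀ o ∈ O', compatible adj hadj t.1 t.2 X o = true := by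
  induction ts generalizing O' with
  | nil => simp at ht
  | cons s ts ih =>
    rw [refinements_cons] at h
    obtain ⟨X, h1, O1, h2, rfl⟩ := exists_of_mem_refineSets.1 h
    rcases List.mem_cons.1 ht with rfl | ht
    · exact ⟨X, fun o ho => (List.mem_filter.1 ho).2⟩
    · obtain ⟨Y, hY⟩ := ih h2 ht
      exact ⟨Y, fun o ho => hY o (List.mem_filter.1 ho).1⟩

theorem mem_product {α β : Type} {m : List β} {l : List α} {x : α × β} :
    x ∈ product m l ↔ x.1 ∈ l ∧ x.2 ∈ m := by
  induction l with
  | nil => simp [product]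
  | cons a l ih =>
    have h1 : product m (a :: l) = m.map (fun b => (a, b)) ++ product m l := rfl
    rw [h1, List.mem_append, ih]
    obtain ⟨x, y⟩ := x
    simp only [List.mem_map, Prod.mk.injEq, List.mem_cons]
    constructor
    · rintro (⟨b, hb, rfl, rfl⟩ | h)
      · exact ⟨.inl rfl, hb⟩
      · exact ⟨.inr h.1, h.2⟩
    · rintro ⟨rfl | h, hy⟩
      · exact .inl ⟨y, hy, rfl, rfl⟩
      · exact .inr ⟨h, hy⟩

theorem length_product {α β : Type} (m : List β) (l : List α) :
    (product m l).length = l.length * m.length := by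
  induction l with
  | nil => simp [product]
  | cons a l ih =>
    have h1 : product m (a :: l) = m.map (fun b => (a, b)) ++ product m l := rfl
    rw [h1, List.length_append, ih, List.length_map, List.length_cons]
    ring

/-- After refining, options on different sides of a cut are not in conflict. -/
theorem adj_of_mem_refinements (ha : ∀ u v, adj u v = true ↔ G.Adj u v)
    (hh : ∀ a b, hadj a b = true ↔ H.Adj a b) {O O' : List (Opt n k)} {cs : List (Cut n)}
    (h : O' ∈ refinements adj hadj O (product (List.finRange k) cs)) {c : Cut n} (hc : c ∈ cs)
    {o o' : Opt n k} (ho : o ∈ O') (ho' : o' ∈ O') (h1 : o.1 ∈ c.1) (h2 : o'.1 ∈ c.2)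
    (hoo : G.Adj o.1 o'.1) : H.Adj o.2 o'.2 := by
  obtain ⟨X, hX⟩ := exists_compatible_of_mem_refinements h
    (mem_product.2 ⟨hc, List.mem_finRange o.2⟩ : (c, o.2) ∈ product (List.finRange k) cs)
  rw [← hh]
  -- For the color of o, compatibility of o says that the neighbor on the other side is adjacent to
  -- X, and compatibility of o' then forces its color to be adjacent to that color.
  exact (compatible_iff.1 (hX o' ho')).1 h2
    ((compatible_iff.1 (hX o ho)).2 h1 rfl _ h2 ((ha _ _).2 hoo))

/-! ### Optimality -/

theorem value_cons (o : Opt n k) (S : List (Opt n k)) :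
    value rv (o :: S) = rv o.1 o.2 + value rv S := rfl

theorem value_append (S S' : List (Opt n k)) :
    value rv (S ++ S') = value rv S + value rv S' := by
  induction S with
  | nil => simp [value]
  | cons o S ih => rw [List.cons_append, value_cons, value_cons, ih, add_assoc]

theorem best_spec' (Ss : List (List (Opt n k))) :
    0 ≤ value rv (best rv Ss) ∧ ∀ S ∈ Ss, value rv S ≤ value rv (best rv Ss) := by
  induction Ss with
  | nil => simp [best, value]
  | cons S Ss ih =>
    have h1 : best rv (S :: Ss) =
      if value rv S ≤ value rv (best rv Ss) then best rv Ss else S := rfl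
    rw [h1]
    split
    · rename_i h
      exact ⟨ih.1, fun S' hS' => (List.mem_cons.1 hS').elim (fun e => e ▸ h) (ih.2 S')⟩
    · rename_i h
      exact ⟨ih.1.trans (le_of_not_ge h), fun S' hS' => (List.mem_cons.1 hS').elim
        (fun e => e ▸ le_rfl) fun e => (ih.2 S' e).trans (le_of_not_ge h)⟩

/-- `S` is a solution with options from `O` of largest revenue. -/
structure Optimal (G : SimpleGraph (Fin n)) (H : SimpleGraph (Fin k)) (rv : Fin n → Fin k → ℚ)
    (O S : List (Opt n k)) : Prop where
  subset : S ⊆ O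
  nodup : S.Nodup
  consistent : Consistent G H (· ∈ S)
  le : ∀ T : Finset (Opt n k), (∀ o ∈ T, o ∈ O) → Consistent G H (· ∈ T) →
    ∑ o ∈ T, rv o.1 o.2 ≤ value rv S

theorem Optimal.length_le {O S : List (Opt n k)} (h : Optimal G H rv O S) :
    S.length ≤ O.length :=
  (List.subperm_of_subset h.nodup h.subset).length_le

/-- With at most one vertex, a consistent set contains at most one option, and a single option is
consistent as G has no loops. -/
theorem optimal_singletons {O : List (Opt n k)} (hV : V.length ≤ 1) (hO : ∀ o ∈ O, o.1 ∈ V) :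
    Optimal G H rv O (best rv (O.map fun o => [o])) := by
  obtain ⟨h0, hb⟩ := best_spec' (rv := rv) (O.map fun o => [o])
  have hm := best_mem (rv := rv) (O.map fun o => [o])
  have h1 : best rv (O.map fun o => [o]) = [] ∨
      ∃ o ∈ O, best rv (O.map fun o => [o]) = [o] := by
    rcases List.mem_cons.1 hm with hm | hm
    · exact .inl hm
    · obtain ⟨o, ho, h⟩ := List.mem_map.1 hm
      exact .inr ⟨o, ho, h.symm⟩
  have h2 : ∀ T : Finset (Opt n k), (∀ o ∈ T, o ∈ O) → Consistent G H (· ∈ T) →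
      ∑ o ∈ T, rv o.1 o.2 ≤ value rv (best rv (O.map fun o => [o])) := by
    intro T hT hc
    rcases T.eq_empty_or_nonempty with rfl | ⟨o, ho⟩
    · simpa using h0
    · have h3 : T = {o} := by
        refine Finset.eq_singleton_iff_unique_mem.2 ⟨ho, fun o' ho' => ?_⟩
        have h4 : o'.1 = o.1 := by
          match V, hV with
          | [], _ => exact absurd (hO o (hT o ho)) (by simp)
          | [v], _ =>
            rw [List.mem_singleton.1 (hO o (hT o ho)), List.mem_singleton.1 (hO o' (hT o' ho'))]
        exact Prod.ext h4 ((hc o' o ho' ho).1 h4)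
      rw [h3, Finset.sum_singleton]
      have := hb [o] (List.mem_map.2 ⟨o, hT o ho, rfl⟩)
      simpa [value] using this
  rcases h1 with h1 | ⟨o, ho, h1⟩
  · exact ⟨by simp [h1], by simp [h1], by rw [h1]; intro o o' ho; simp at ho, h2⟩
  · refine ⟨by simpa [h1] using ho, by simp [h1], ?_, h2⟩
    rw [h1]
    intro o1 o2 h3 h4
    rw [List.mem_singleton.1 h3, List.mem_singleton.1 h4]
    exact ⟨fun _ => rfl, fun h => absurd h (G.loopless.irrefl _)⟩

theorem mem_optionsOn {W : List (Fin n)} {O : List (Opt n k)} {o : Opt n k} :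
    o ∈ optionsOn W O ↔ o ∈ O ∧ o.1 ∈ W := by
  simp [optionsOn]

theorem solveAll_cons (sol : List (Fin n) → List (Opt n k) → List (Opt n k))
    (O : List (Opt n k)) (W : List (Fin n)) (ps : List (List (Fin n))) :
    solveAll sol O (W :: ps) = sol W (optionsOn W O) ++ solveAll sol O ps := rfl

theorem mem_solveAll {sol : List (Fin n) → List (Opt n k) → List (Opt n k)}
    {O : List (Opt n k)} {ps : List (List (Fin n))} {o : Opt n k} :
    o ∈ solveAll sol O ps ↔ ∃ W ∈ ps, o ∈ sol W (optionsOn W O) := by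
  induction ps with
  | nil => simp [solveAll]
  | cons W ps ih => rw [solveAll_cons, List.mem_append, ih]; simp

/-- Disjointness excludes two colors for one vertex, and `hadj` excludes conflicts along edges
between different sets. For the upper bound, a competing set of options is split according to the
elements of `ps`, and its revenue is the sum over the parts. -/
theorem optimal_solveAll {sol : List (Fin n) → List (Opt n k) → List (Opt n k)}
    {O : List (Opt n k)} {ps : List (List (Fin n))}
    (hsol : ∀ W ∈ ps, Optimal G H rv (optionsOn W O) (sol W (optionsOn W O)))
    (hps : ps.Pairwise List.Disjoint) (hO : ∀ o ∈ O, ∃ W ∈ ps, o.1 ∈ W)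
    (hadj : ∀ W ∈ ps, ∀ o ∈ O, ∀ o' ∈ O, o.1 ∈ W → o'.1 ∉ W → G.Adj o.1 o'.1 → H.Adj o.2 o'.2) :
    Optimal G H rv O (solveAll sol O ps) where
  subset := fun o ho => by
    obtain ⟨W, hW, ho⟩ := mem_solveAll.1 ho
    exact (mem_optionsOn.1 ((hsol W hW).subset ho)).1
  nodup := by
    clear hO hadj
    induction ps with
    | nil => simp [solveAll]
    | cons W ps ih =>
      rw [List.pairwise_cons] at hps
      refine (hsol W (by simp)).nodup.append (ih (fun W' h => hsol W' (by simp [h])) hps.2)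
        fun o ho ho' => ?_
      obtain ⟨W', hW', ho'⟩ := mem_solveAll.1 ho'
      exact hps.1 W' hW' (mem_optionsOn.1 ((hsol W (by simp)).subset ho)).2
        (mem_optionsOn.1 ((hsol W' (by simp [hW'])).subset ho')).2
  consistent := fun o o' ho ho' => by
    obtain ⟨W, hW, ho⟩ := mem_solveAll.1 ho
    obtain ⟨W', hW', ho'⟩ := mem_solveAll.1 ho'
    by_cases h : W = W'
    · subst h
      exact (hsol W hW).consistent o o' ho ho'
    · obtain ⟨h1, h2⟩ := mem_optionsOn.1 ((hsol W hW).subset ho)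
      obtain ⟨h3, h4⟩ := mem_optionsOn.1 ((hsol W' hW').subset ho')
      have h5 : o'.1 ∉ W := fun h6 => by
        obtain ⟨i, hi, rfl⟩ := List.mem_iff_getElem.1 hW
        obtain ⟨j, hj, rfl⟩ := List.mem_iff_getElem.1 hW'
        rcases lt_trichotomy i j with hij | rfl | hij
        · exact List.pairwise_iff_getElem.1 hps i j hi hj hij h6 h4
        · exact h rfl
        · exact List.pairwise_iff_getElem.1 hps j i hj hi hij h4 h6
      exact ⟨fun h6 => absurd (h6 ▸ h2) h5, hadj W hW o h1 o' h3 h2 h5⟩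
  le := fun T hT hc => by
    classical
    have hT' : ∀ o ∈ T, ∃ W ∈ ps, o.1 ∈ W := fun o ho => hO o (hT o ho)
    clear hO hadj hps
    induction ps generalizing T with
    | nil =>
      rw [Finset.eq_empty_of_forall_notMem (s := T) fun o ho => by simpa using hT' o ho]
      simp [solveAll, value]
    | cons W ps ih =>
      rw [solveAll_cons, value_append, ← Finset.sum_filter_add_sum_filter_not T fun o => o.1 ∈ W]
      refine add_le_add ((hsol W (by simp)).le _ (fun o ho => ?_) (hc.mono fun o ho => ?_))
        (ih (fun W' h => hsol W' (by simp [h])) _ (fun o ho => hT o (Finset.mem_filter.1 ho).1)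
          (hc.mono fun o ho => (Finset.mem_filter.1 ho).1) fun o ho => ?_)
      · rw [Finset.mem_filter] at ho
        exact mem_optionsOn.2 ⟨hT o ho.1, ho.2⟩
      · exact (Finset.mem_filter.1 ho).1
      · rw [Finset.mem_filter] at ho
        obtain ⟨W', hW', h⟩ := hT' o ho.1
        rcases List.mem_cons.1 hW' with rfl | hW'
        · exact absurd h ho.2
        · exact ⟨W', hW', h⟩

theorem optimal_best {O : List (Opt n k)} {Ss : List (List (Opt n k))}
    (h1 : ∀ S ∈ Ss, S ⊆ O ∧ S.Nodup ∧ Consistent G H (· ∈ S))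
    (h2 : ∀ T : Finset (Opt n k), (∀ o ∈ T, o ∈ O) → Consistent G H (· ∈ T) →
      ∃ S ∈ Ss, ∑ o ∈ T, rv o.1 o.2 ≤ value rv S) : Optimal G H rv O (best rv Ss) := by
  have h3 : best rv Ss ⊆ O ∧ (best rv Ss).Nodup ∧ Consistent G H (· ∈ best rv Ss) := by
    rcases List.mem_cons.1 (best_mem (rv := rv) Ss) with h | h
    · rw [h]
      exact ⟨by simp, by simp, fun o o' ho => by simp at ho⟩
    · exact h1 _ h
  refine ⟨h3.1, h3.2.1, h3.2.2, fun T hT hc => ?_⟩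
  obtain ⟨S, hS, h⟩ := h2 T hT hc
  exact h.trans ((best_spec' Ss).2 S hS)

/-- An edge between different pieces is separated by one of the cuts, in one of the two directions,
and the refinement has settled it. -/
theorem optimal_solveAll_pieces (ha : ∀ u v, adj u v = true ↔ G.Adj u v)
    (hh : ∀ a b, hadj a b = true ↔ H.Adj a b)
    {sol : List (Fin n) → List (Opt n k) → List (Opt n k)} {O O' : List (Opt n k)}
    (hO : ∀ o ∈ O, o.1 ∈ V)
    (hO' : O' ∈ refinements adj hadj O (product (List.finRange k) (cuts adj V)))
    (hsol : ∀ W ∈ pieces adj V, Optimal G H rv (optionsOn W O') (sol W (optionsOn W O'))) :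
    Optimal G H rv O' (solveAll sol O' (pieces adj V)) := by
  have hs : ∀ u v, adj u v = adj v u := fun u v => by
    rw [Bool.eq_iff_iff, ha, ha, G.adj_comm]
  have hOO : ∀ o ∈ O', o.1 ∈ V := fun o ho => hO o ((sublist_of_mem_refinements hO').subset ho)
  refine optimal_solveAll hsol (pairwise_piecesOf hs (List.Subset.refl V))
    (fun o ho => exists_mem_piecesOf (List.Subset.refl V) (hOO o ho))
    fun W hW o ho o' ho' hoW hoW' hoo => ?_
  have h1 : adjCut adj (cuts adj V) o.1 o'.1 ≠ true := fun h => hoW'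
    ((conn_of_mem_piecesOf hs (List.Subset.refl V) hW hoW _).2 (.single ⟨hOO o ho, hOO o' ho', h⟩))
  simp only [adjCut, (ha _ _).2 hoo, Bool.true_and, ne_eq, Bool.not_eq_true', Bool.not_eq_false,
    List.any_eq_true, Bool.or_eq_true, Cut.sep, Bool.and_eq_true, decide_eq_true_eq] at h1
  obtain ⟨c, hc, ⟨h2, h3⟩ | ⟨h2, h3⟩⟩ := h1
  · exact adj_of_mem_refinements ha hh hO' hc ho ho' h2 h3 hoo
  · exact (adj_of_mem_refinements ha hh hO' hc ho' ho h2 h3 hoo.symm).symm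

/-- Refinements only remove options, so every candidate is a valid solution; each competing solution
survives in some refinement, whose optimum is at least as good. The halving of the pieces matches
the decrease of d. -/
theorem optimal_solve (ha : ∀ u v, adj u v = true ↔ G.Adj u v)
    (hh : ∀ a b, hadj a b = true ↔ H.Adj a b) {d : ℕ} {O : List (Opt n k)} (hV : V.Nodup)
    (hd : V.length ≤ 2 ^ d) (hO : ∀ o ∈ O, o.1 ∈ V) :
    Optimal G H rv O (solve adj hadj rv d V O) := by
  induction d generalizing V O with
  | zero => exact optimal_singletons (by simpa using hd) hO
  | succ d ih =>
    rw [solve]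
    split
    · exact optimal_singletons (by assumption) hO
    · rename_i h2
      have key : ∀ O' ∈ refinements adj hadj O (product (List.finRange k) (cuts adj V)),
          Optimal G H rv O' (solveAll (solve adj hadj rv d) O' (pieces adj V)) := by
        intro O' hO'
        refine optimal_solveAll_pieces ha hh hO hO' fun W hW => ih ?_ ?_ ?_
        · exact hV.sublist (sublist_of_mem_piecesOf (List.Subset.refl V) hW)
        · have := pieces_halved ha hV (by omega) hW
          rw [pow_succ] at hd
          omega
        · exact fun o ho => (mem_optionsOn.1 ho).2
      refine optimal_best (fun S hS => ?_) fun T hT hc => ?_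
      · obtain ⟨O', hO', rfl⟩ := List.mem_map.1 hS
        have := key O' hO'
        exact ⟨fun o ho => (sublist_of_mem_refinements hO').subset (this.subset ho), this.nodup,
          this.consistent⟩
      · obtain ⟨O', hO', h⟩ := exists_refinement ha hh hc hT
          (product (List.finRange k) (cuts adj V))
        exact ⟨_, List.mem_map.2 ⟨O', hO', rfl⟩, (key O' hO').le T h hc⟩

end

/-! ### The number of steps -/

section

variable {n k M : ℕ} {adj : Fin n → Fin n → Bool} {hadj : Fin k → Fin k → Bool}
  {rv : Fin n → Fin k → ℚ} {G : SimpleGraph (Fin n)} {H : SimpleGraph (Fin k)}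

theorem Bounds.change {Q Q' : ℕ} (h : Bounds n k M Q) (hQ : 1 ≤ Q') : Bounds n k M Q' :=
  ⟨h.hM, hQ, h.hn, h.hk⟩

theorem bestSingletons_wp {Q : ℕ} (h : Bounds n k M Q) (O : List (Opt n k)) (hO : O.length < M)
    {j : ℕ} (hj : 8 ≤ j)
    {s t : Term} {ρ : List Value}
    (hs : wp (prog hadj) (Q * M ^ j) s ρ fun v => v = env adj hadj rv)
    (ht : wp (prog hadj) (Q * M ^ j) t ρ fun v => v = enc O) :
    wp (prog hadj) (Q * M ^ j) (.call iBest (.pair s (.call iSingletons (.pair .nil t)))) ρ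
      fun v => v = enc (best rv (O.map fun o => [o])) := by
  have hM := h.hM
  refine wp_call (wp_pair hs (wp_call (wp_pair rfl ht)
    ((singletons_spec h O hO).up j h.hM (by omega)))) ?_
  refine (best_spec h (L := M) (O.map fun o => [o]) (by simpa using hO) fun S hS => ?_).mono ?_
  · obtain ⟨o, -, rfl⟩ := List.mem_map.1 hS
    simp only [List.length_singleton]
    omega
  · calc M * Q * M ^ 7 = Q * M ^ 8 := by ring
      _ ≤ Q * M ^ j := Nat.mul_le_mul_left _ (Nat.pow_le_pow_right (by omega) hj)

/-- This solves the recurrence: each level multiplies the cost by L * L * M ^ 4, where L exceeds the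
number of sequences of guesses. `optimal_solve` enters as well, since it bounds the lengths of the
partial solutions. -/
theorem solve_spec (hb : ¬ bull.IsIndContained G) (he : ¬ graphE.IsIndContained G)
    (ha : ∀ u v, adj u v = true ↔ G.Adj u v) (hh : ∀ a b, hadj a b = true ↔ H.Adj a b)
    (h : Bounds n k M 1) (hn : n + 1 < M) (hk : 3 * k < M) (hk1 : 1 ≤ k) {L : ℕ}
    (hL : ((n + 1) ^ (G.cliqueNum + 2)) ^ (3 * k) < L) {d : ℕ} {V : List (Fin n)}
    {O : List (Opt n k)} (hV : V.Nodup) (hd : V.length ≤ 2 ^ d) (hO : O.length < M)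
    (hOV : ∀ o ∈ O, o.1 ∈ V) :
    Calls (prog hadj) ((L * L * M ^ 4) ^ d * M ^ 29) iSolve
      (.pair (.pair (env adj hadj rv) (enc (List.finRange k))) (.pair (enc V) (enc O)))
      (enc (solve adj hadj rv d V O)) := by
  have hM := h.hM
  have hL1 : 1 ≤ L := by omega
  have hlen : ∀ W : List (Fin n), W.Nodup → W.length ≤ n := fun W hW => by
    simpa using hW.length_le_card
  induction d generalizing V O with
  | zero =>
    refine (Calls.body 28 rfl h.hM h.hQ (by decide) ?_).mono (by simp)
    refine wp_match (l := V) rfl (fun v l hl => wp_match (l := l) rfl (fun v' l' hl' => ?_)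
      fun _ => bestSingletons_wp h O hO (by decide) rfl rfl)
      fun _ => bestSingletons_wp h O hO (by decide) rfl rfl
    subst hl' hl
    simp at hd
  | succ d ih =>
    have hq : 1 ≤ (L * L * M ^ 4) ^ d :=
      Nat.pow_pos (Nat.mul_pos (Nat.mul_pos hL1 hL1) (Nat.pow_pos (by omega)))
    generalize hQd : (L * L * M ^ 4) ^ d = Qd at ih hq
    have hA : 1 ≤ L * (L * Qd) := Nat.mul_pos hL1 (Nat.mul_pos hL1 hq)
    have hLQ : 1 ≤ L * Qd := Nat.mul_pos hL1 hq
    have hB := h.change hA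
    -- The exponent grows from 29 to 31 by the loop over the pieces, to 32 by the loop over the
    -- guesses, which also costs a factor L, and to 33 by the body. The second factor L is required
    -- by `refinements_spec`.
    refine (Calls.body (Q := L * (L * Qd)) 32 rfl h.hM hA (by decide) ?_).mono
      (le_of_eq (by rw [pow_succ _ d, hQd]; ring))
    refine wp_match (l := V) rfl (fun v l hl => wp_match (l := l) rfl (fun v' l' hl' => ?_)
      fun hl' => ?_) fun hl => ?_
    · have h2 : 2 ≤ V.length := by rw [hl, hl']; simp
      have hV0 : V ≠ [] := by rw [hl]; simp
      have hVM : V.length + 1 < M := by have := hlen V hV; omega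
      clear hl hl'
      rw [show solve adj hadj rv (d + 1) V O = best rv ((refinements adj hadj O
        (product (List.finRange k) (cuts adj V))).map fun O' =>
          solveAll (solve adj hadj rv d) O' (pieces adj V)) by
        rw [solve, if_neg (by omega)]]
      set ts := product (List.finRange k) (cuts adj V) with hts
      have hsub : ∀ c ∈ cuts adj V, c.1.Sublist V ∧ c.2.Sublist V := fun c hc =>
        ⟨(good_of_mem_cuts hb he ha hV0 hc).1, (good_of_mem_cuts hb he ha hV0 hc).2.1⟩
      have hcs : SmallCuts M (cuts adj V) := by
        refine ⟨by have := length_cuts (adj := adj) V; omega, fun c hc => ?_⟩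
        have h3 := (hsub c hc).1.length_le
        have h4 := (hsub c hc).2.length_le
        omega
      have htl : ts.length ≤ 3 * k := by
        rw [hts, length_product, List.length_finRange]
        exact Nat.mul_le_mul_right _ (length_cuts V)
      have hirr : ∀ t ∈ ts, (irredundantSets adj t.1.2 t.1.1).length ≤
          (n + 1) ^ (G.cliqueNum + 2) := fun t ht =>
        length_irredundantSets hb he ha hV0 hV (mem_product.1 ht).1
      have hpow : 1 ≤ (n + 1) ^ (G.cliqueNum + 2) := Nat.pow_pos (by omega)
      have hps : (pieces adj V).length < M := (length_piecesOf _ _ _).trans_lt (by omega)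
      have hpiece : ∀ O' ∈ refinements adj hadj O ts, ∀ W ∈ pieces adj V,
          W.Nodup ∧ W.length ≤ 2 ^ d ∧ W.length < M ∧ O'.length < M ∧
            (optionsOn W O').length < M := by
        intro O' hO' W hW
        have h3 := pieces_halved ha hV h2 hW
        rw [pow_succ] at hd
        have h4 : O'.length < M := (sublist_of_mem_refinements hO').length_le.trans_lt hO
        exact ⟨hV.sublist (sublist_of_mem_piecesOf (List.Subset.refl V) hW), by omega, by omega,
          h4, (List.length_filter_le _ _).trans_lt h4⟩
      have hsolveAll : ∀ O' ∈ refinements adj hadj O ts,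
          Calls (prog hadj) (Qd * M ^ 31) iSolveAll
            (.pair (.pair (.pair (env adj hadj rv) (enc (List.finRange k))) (enc O'))
              (enc (pieces adj V)))
            (enc (solveAll (solve adj hadj rv d) O' (pieces adj V))) := by
        intro O' hO'
        refine Calls.foldPoly 29 rfl h.hM hq (by decide) hps (fun ρ => rfl) fun W t hWt ρ => ?_
        obtain ⟨h3, h4, h5, h6, h7⟩ := hpiece O' hO' W (hWt.subset (by simp))
        have h8 : ∀ o ∈ optionsOn W O', o.1 ∈ W := fun o ho => (mem_optionsOn.1 ho).2
        refine wp_call (wp_pair rfl (wp_call (wp_pair rfl (wp_pair rfl (wp_call rfl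
          ((optionsOn_spec (h.change hq) W O' h5 h6).up 29 h.hM (by decide)))))
            (ih h3 h4 h7 h8))) ((app_spec (h.change hq) _ _ ?_).up 29 h.hM (by decide))
        exact (optimal_solve ha hh h3 h4 h8).length_le.trans_lt h7
      have href : ∀ ts', ts' <:+ ts → (refinements adj hadj O ts').length < L := by
        intro ts' hts'
        refine (length_refinements O ts' fun t ht => hirr t (hts'.subset ht)).trans_lt
          (lt_of_le_of_lt (Nat.pow_le_pow_right hpow (hts'.length_le.trans htl)) hL)
      have hpk : (n + 1) ^ (G.cliqueNum + 2) < L :=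
        (Nat.le_self_pow (by omega) _).trans_lt hL
      have hmap := Calls.mapBig (P := prog hadj) (f := iMapSolve) (L := L) 31
        (e := .pair (.pair (env adj hadj rv) (enc (List.finRange k))) (enc (pieces adj V)))
        (l := refinements adj hadj O ts)
        (g := fun O' => solveAll (solve adj hadj rv d) O' (pieces adj V)) rfl h.hM hq (by decide)
        (href ts List.suffix_rfl) fun O' hO' r t ρ => wp_call rfl (hsolveAll O' hO')
      refine wp_let (wp_call rfl ((cuts_spec hB V (by omega)).up 32 h.hM (by decide))) ?_
      refine wp_call (wp_pair rfl (wp_call (wp_pair (wp_pair rfl (wp_call rfl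
        ((pieces_spec hB V V (cuts adj V) hcs (by omega) (by omega)).up 32 h.hM (by decide))))
        (wp_call (wp_pair rfl (wp_call rfl ((product_spec hB (List.finRange k) (cuts adj V)
          (by rw [List.length_finRange]; exact h.hk) hcs.1).up 32 h.hM (by decide))))
          ((refinements_spec (h.change hq) O ts hO (by omega) (fun t ht => ?_)
            (fun t ht => (hirr t ht).trans_lt hpk) href).up 32 h.hM (by decide))))
        (hmap.mono ?_)))
        ((best_spec (h.change hLQ) (L := L) _ ?_ fun S hS => ?_).up 32 h.hM (by decide))
      · have h3 := hsub t.1 (mem_product.1 ht).1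
        have h4 := h3.1.length_le
        have h5 := h3.2.length_le
        omega
      · exact Nat.mul_le_mul_right _ (Nat.le_mul_of_pos_left _ hL1)
      · rw [List.length_map]
        exact href ts List.suffix_rfl
      · obtain ⟨O', hO', rfl⟩ := List.mem_map.1 hS
        exact (optimal_solveAll_pieces ha hh hOV hO' fun W hW =>
          optimal_solve ha hh (hpiece O' hO' W hW).1 (hpiece O' hO' W hW).2.1
            fun o ho => (mem_optionsOn.1 ho).2).length_le.trans_lt
              ((sublist_of_mem_refinements hO').length_le.trans_lt hO)
    · rw [show solve adj hadj rv (d + 1) V O = best rv (O.map fun o => [o]) by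
        rw [solve, if_pos (by rw [hl, hl']; simp)]]
      exact bestSingletons_wp hB O hO (by decide) rfl rfl
    · rw [show solve adj hadj rv (d + 1) V O = best rv (O.map fun o => [o]) by
        rw [solve, if_pos (by rw [hl]; simp)]]
      exact bestSingletons_wp hB O hO (by decide) rfl rfl

end

section

variable {n k M : ℕ} {adj : Fin n → Fin n → Bool} {hadj : Fin k → Fin k → Bool}
  {rv : Fin n → Fin k → ℚ} {G : SimpleGraph (Fin n)} {H : SimpleGraph (Fin k)}

/-! ### The table of the adjacency relation of `H` -/

theorem eval_constT_encodeList {P : Program} {B : ℕ} {l : List Value}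
    (hl : ∀ v ∈ l, ∀ ρ, ∃ t ≤ B, Eval P ρ (constT v) v t) (ρ : List Value) :
    ∃ t ≤ l.length * (B + 1) + 1, Eval P ρ (constT (encodeList l)) (encodeList l) t := by
  induction l with
  | nil => exact ⟨1, by simp, .nil⟩
  | cons v l ih =>
    obtain ⟨s, hs, h1⟩ := hl v (by simp) ρ
    obtain ⟨t, ht, h2⟩ := ih fun w hw => hl w (by simp [hw])
    refine ⟨_, ?_, .pair h1 h2⟩
    rw [List.length_cons, add_mul]
    omega

theorem eval_constT_encodeBool {P : Program} (b : Bool) (ρ : List Value) :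
    ∃ t ≤ 3, Eval P ρ (constT (encodeBool b)) (encodeBool b) t := by
  cases b
  · exact ⟨1, by decide, .nil⟩
  · exact ⟨_, le_rfl, .pair .nil .nil⟩

/-- H is fixed, so its adjacency matrix is a constant of the program: an entry takes at most 3
steps, and each cell of a list one step more. -/
theorem table_calls (a : Value) :
    Calls (prog hadj) (k * (k * 4 + 2) + 1) iTable a (matrix hadj) := by
  obtain ⟨t, ht, h⟩ := eval_constT_encodeList (P := prog hadj) (B := k * 4 + 1)
    (l := List.ofFn fun u => encodeList (List.ofFn fun v => enc (hadj u v))) (by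
      intro v hv ρ
      obtain ⟨u, rfl⟩ := List.mem_ofFn.1 hv
      obtain ⟨t, ht, h⟩ := eval_constT_encodeList (P := prog hadj) (B := 3)
        (l := List.ofFn fun v => enc (hadj u v)) (by
          intro v hv ρ
          obtain ⟨w, rfl⟩ := List.mem_ofFn.1 hv
          exact eval_constT_encodeBool _ _) ρ
      exact ⟨t, by simpa using ht, h⟩) [a]
  exact ⟨_, t, rfl, h, by simpa using ht⟩

theorem main_spec (hb : ¬ bull.IsIndContained G) (he : ¬ graphE.IsIndContained G)
    (ha : ∀ u v, adj u v = true ↔ G.Adj u v) (hh : ∀ a b, hadj a b = true ↔ H.Adj a b)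
    (h : Bounds n k M 1) (hn : n + 1 < M) (hk : 3 * k < M) (hk1 : 1 ≤ k) (hnk : n * k < M)
    (hkk : k * (k * 4 + 2) + 1 ≤ M) {L : ℕ}
    (hL : ((n + 1) ^ (G.cliqueNum + 2)) ^ (3 * k) < L) {d : ℕ} (hd : n ≤ 2 ^ d) :
    Calls (prog hadj) ((L * L * M ^ 4) ^ d * M ^ 30) iMain (.pair (matrix adj) (matrix rv))
      (enc ((List.finRange n).map (colorIn (solve adj hadj rv d (List.finRange n)
        (product (List.finRange k) (List.finRange n)))))) := by
  have hM := h.hM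
  have hq : 1 ≤ (L * L * M ^ 4) ^ d :=
    Nat.pow_pos (Nat.mul_pos (Nat.mul_pos (by omega) (by omega)) (Nat.pow_pos (by omega)))
  have hB := h.change hq
  have hO : (product (List.finRange k) (List.finRange n)).length < M := by
    simpa [length_product] using hnk
  have hOV : ∀ o ∈ product (List.finRange k) (List.finRange n), o.1 ∈ List.finRange n :=
    fun o _ => List.mem_finRange _
  have hr1 := range_spec (hadj := hadj) hB (List.ofFn fun u => List.ofFn fun v => adj u v)
    (by simpa using h.hn)
  have hr2 := range_spec (hadj := hadj) hB (List.ofFn fun u => List.ofFn fun v => hadj u v)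
    (by simpa using h.hk)
  rw [← matrix_eq, List.length_ofFn] at hr1 hr2
  refine Calls.body 29 rfl h.hM hq (by decide) ?_
  have htab := (table_calls (hadj := hadj) .nil).mono (B' := (L * L * M ^ 4) ^ d * M ^ 29)
    (hkk.trans ((Nat.le_self_pow (by decide) M).trans (Nat.le_mul_of_pos_left _ hq)))
  refine wp_let (a := env adj hadj rv) (wp_pair rfl (wp_pair rfl (wp_call rfl htab))) ?_
  refine wp_let (wp_call rfl (hr1.up 29 h.hM (by decide))) ?_
  refine wp_let (wp_call rfl (hr2.up 29 h.hM (by decide))) ?_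
  refine wp_call (wp_pair (wp_call (wp_pair rfl (wp_pair rfl (wp_call rfl
    ((product_spec hB (List.finRange k) (List.finRange n) (by simpa using h.hk)
      (by simpa using h.hn)).up 29 h.hM (by decide)))))
    (solve_spec hb he ha hh h hn hk hk1 hL (List.nodup_finRange n) (by simpa using hd) hO hOV))
    rfl) ((out_spec hB _ _ ?_ (by simpa using h.hn)).up 29 h.hM (by decide))
  exact (optimal_solve ha hh (List.nodup_finRange n) (by simpa using hd) hOV).length_le.trans_lt hO

/-! ### The output -/

theorem mem_of_colorIn {S : List (Opt n k)} {v : Fin n} {a : Fin k} (h : colorIn S v = some a) :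
    (v, a) ∈ S := by
  induction S with
  | nil => simp [colorIn] at h
  | cons o S ih =>
    simp only [colorIn, List.foldr_cons] at h ih
    split at h
    · rename_i h1
      rw [h1, ← Option.some_inj.1 h]
      exact List.mem_cons_self
    · exact List.mem_cons_of_mem _ (ih h)

/-- Only the first option for v is read off; consistency says that there is no other color. -/
theorem colorIn_eq_some {S : List (Opt n k)} (hS : Consistent G H (· ∈ S)) {v : Fin n} {a : Fin k} :
    colorIn S v = some a ↔ (v, a) ∈ S := by
  refine ⟨mem_of_colorIn, fun h => ?_⟩
  have h1 : colorIn S v ≠ none := by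
    clear hS
    induction S with
    | nil => simp at h
    | cons o S ih =>
      simp only [colorIn, List.foldr_cons] at ih ⊢
      split
      · simp
      · rename_i h1
        rcases List.mem_cons.1 h with rfl | h
        · exact absurd rfl h1
        · exact ih h
  obtain ⟨b, hb⟩ := Option.ne_none_iff_exists'.1 h1
  exact hb.trans (congrArg some ((hS _ _ (mem_of_colorIn hb) h).1 rfl))

/-- The partial coloring described by a set of options. -/
def coloringOf (S : List (Opt n k)) (hS : Consistent G H (· ∈ S)) : PartialColoring G H where
  X := Finset.univ.filter fun v => (colorIn S v).isSome
  c :=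
    { toFun := fun v => (colorIn S v.1).get (by simpa using v.2)
      map_rel' := fun {u v} huv =>
        (hS _ _ (mem_of_colorIn (Option.some_get (by simpa using u.2)).symm)
          (mem_of_colorIn (Option.some_get (by simpa using v.2)).symm)).2 huv }

theorem colorOf_coloringOf (S : List (Opt n k)) (hS : Consistent G H (· ∈ S)) (v : Fin n) :
    (coloringOf S hS).colorOf v = colorIn S v := by
  unfold PartialColoring.colorOf
  split
  · exact Option.some_get _
  · rename_i h
    have h1 : ¬ (colorIn S v).isSome := by simpa [coloringOf] using h
    exact (Option.not_isSome_iff_eq_none.1 h1).symm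

/-- The options used by a partial coloring. -/
def PartialColoring.options (S : PartialColoring G H) : Finset (Opt n k) :=
  Finset.univ.image fun v : {v // v ∈ S.X} => (v.1, S.c v)

theorem PartialColoring.mem_options {S : PartialColoring G H} {o : Opt n k} :
    o ∈ S.options ↔ S.colorOf o.1 = some o.2 := by
  obtain ⟨v, a⟩ := o
  simp only [options, Finset.mem_image, Finset.mem_univ, true_and, Prod.mk.injEq, colorOf]
  constructor
  · rintro ⟨⟨w, hw⟩, rfl, rfl⟩
    rw [dif_pos hw]
  · intro h
    split at h
    · rename_i hv
      exact ⟨⟨v, hv⟩, rfl, Option.some_inj.1 h⟩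
    · exact absurd h (by simp)

theorem PartialColoring.sum_options (S : PartialColoring G H) (rev : Fin n → Fin k → ℚ≥0) :
    ∑ o ∈ S.options, (rev o.1 o.2 : ℚ) = (S.revenue rev : ℚ) := by
  rw [options, Finset.sum_image fun v _ w _ h => Subtype.ext (Prod.mk.inj h).1, revenue]
  push_cast
  rfl

theorem PartialColoring.consistent_options (S : PartialColoring G H) :
    Consistent G H (· ∈ S.options) := by
  intro o o' ho ho'
  simp only [options, Finset.mem_image, Finset.mem_univ, true_and] at ho ho'
  obtain ⟨v, rfl⟩ := ho
  obtain ⟨w, rfl⟩ := ho'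
  refine ⟨fun h => by rw [Subtype.ext h], fun h => S.c.map_rel' h⟩

theorem value_eq_sum {S : List (Opt n k)} (hS : S.Nodup) :
    value rv S = ∑ o ∈ S.toFinset, rv o.1 o.2 := by
  rw [List.sum_toFinset _ hS]
  clear hS
  induction S with
  | nil => rfl
  | cons o S ih => rw [value_cons, ih, List.map_cons, List.sum_cons]

theorem isOptimal_coloringOf {rev : Fin n → Fin k → ℚ≥0} {S O : List (Opt n k)}
    (h : Optimal G H (fun v a => (rev v a : ℚ)) O S) (hO : ∀ o, o ∈ O) :
    (coloringOf S h.consistent).IsOptimal rev := by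
  intro S'
  have h1 := h.le S'.options (fun o _ => hO o) S'.consistent_options
  have h2 : (coloringOf S h.consistent).options = S.toFinset := by
    ext o
    rw [PartialColoring.mem_options, colorOf_coloringOf, colorIn_eq_some h.consistent,
      List.mem_toFinset]
  rw [value_eq_sum h.nodup, ← h2, S'.sum_options rev,
    (coloringOf S h.consistent).sum_options rev] at h1
  exact_mod_cast h1

/-! ### The bound on the number of steps -/

/-- All factors are powers of two at most: M ≤ 2^(2d+12k) and L ≤ 2^(19dwk). The d levels of
recursion turn the exponent of L into a multiple of k * w * d ^ 2. -/
theorem steps_le {n k w d M L : ℕ} (hk : 1 ≤ k) (hw : 1 ≤ w) (hd : 1 ≤ d) (hn : n ≤ 2 ^ d)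
    (hM : M = 1000 * (n + 1) * (k + 1) ^ 2) (hL : L = ((n + 1) ^ (w + 2)) ^ (3 * k) + 1) :
    (L * L * M ^ 4) ^ d * M ^ 31 ≤ 2 ^ (622 * (k * w * d ^ 2)) := by
  have hn1 : n + 1 ≤ 2 ^ (2 * d) := by
    have h1 : 2 ^ (d + 1) ≤ 2 ^ (2 * d) := Nat.pow_le_pow_right (by decide) (by omega)
    have h2 : 1 ≤ 2 ^ d := Nat.one_le_two_pow
    rw [pow_succ] at h1
    omega
  have hk2 : k + 1 ≤ 2 ^ k := Nat.lt_two_pow_self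
  have hMle : M ≤ 2 ^ (2 * d + 12 * k) := by
    calc M ≤ 2 ^ 10 * 2 ^ (2 * d) * (2 ^ k) ^ 2 := by
          rw [hM]
          exact Nat.mul_le_mul (Nat.mul_le_mul (by norm_num) hn1) (Nat.pow_le_pow_left hk2 2)
      _ = 2 ^ (10 + 2 * d + k * 2) := by rw [← pow_mul, ← pow_add, ← pow_add]
      _ ≤ _ := Nat.pow_le_pow_right (by decide) (by omega)
  have hdwk : 1 ≤ d * w * k := Nat.mul_pos (Nat.mul_pos hd hw) hk
  have hLle : L ≤ 2 ^ (19 * (d * w * k)) := by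
    have h1 : ((n + 1) ^ (w + 2)) ^ (3 * k) ≤ 2 ^ (18 * (d * w * k)) := by
      calc ((n + 1) ^ (w + 2)) ^ (3 * k) ≤ ((2 ^ (2 * d)) ^ (3 * w)) ^ (3 * k) :=
            Nat.pow_le_pow_left ((Nat.pow_le_pow_left hn1 _).trans
              (Nat.pow_le_pow_right (Nat.pow_pos (by decide)) (by omega))) _
        _ = _ := by rw [← pow_mul, ← pow_mul]; congr 1; ring
    have h2 : 2 ^ (18 * (d * w * k) + 1) ≤ 2 ^ (19 * (d * w * k)) :=
      Nat.pow_le_pow_right (by decide) (by omega)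
    have h3 : 1 ≤ 2 ^ (18 * (d * w * k)) := Nat.one_le_two_pow
    rw [pow_succ] at h2
    omega
  calc (L * L * M ^ 4) ^ d * M ^ 31
      ≤ (2 ^ (19 * (d * w * k)) * 2 ^ (19 * (d * w * k)) * (2 ^ (2 * d + 12 * k)) ^ 4) ^ d *
        (2 ^ (2 * d + 12 * k)) ^ 31 := by gcongr
    _ = 2 ^ ((38 * (d * w * k) + (2 * d + 12 * k) * 4) * d + (2 * d + 12 * k) * 31) := by
        rw [← pow_mul, ← pow_mul, ← pow_add, ← pow_add, ← pow_mul, ← pow_add]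
        congr 1
        ring
    _ ≤ _ := by
        -- The exponent is 38kwd² + 8d² + 48kd + 62d + 372k; each monomial is at most kwd² because
        -- k, w, d ≥ 1, and the coefficients add up to 528.
        refine Nat.pow_le_pow_right (by decide) ?_
        have hkw : 1 ≤ k * w := Nat.mul_pos hk hw
        have h1 : d * d ≤ k * w * (d * d) := Nat.le_mul_of_pos_left _ hkw
        have h2 : k * d ≤ k * d * (w * d) := Nat.le_mul_of_pos_right _ (Nat.mul_pos hw hd)
        have h3 : d ≤ d * (k * w * d) := Nat.le_mul_of_pos_right _ (Nat.mul_pos hkw hd)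
        have h4 : k ≤ k * (w * (d * d)) :=
          Nat.le_mul_of_pos_right _ (Nat.mul_pos hw (Nat.mul_pos hd hd))
        nlinarith

theorem bounds_of_eq {n k M : ℕ} (hM : M = 1000 * (n + 1) * (k + 1) ^ 2) :
    1000 ≤ M ∧ n + 1 < M ∧ 3 * k < M ∧ n * k < M ∧ k * (k * 4 + 2) + 1 ≤ M := by
  subst hM
  refine ⟨?_, ?_, ?_, ?_, ?_⟩ <;>
    nlinarith [Nat.zero_le n, Nat.zero_le k, Nat.zero_le (k * k), Nat.zero_le (n * k),
      Nat.zero_le (n * (k * k))]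

theorem le_two_pow_of_eq {n k M : ℕ} (hk : 1 ≤ k) (hn : n ≤ 1)
    (hM : M = 1000 * (n + 1) * (k + 1) ^ 2) : M ≤ 2 ^ (13 * k) := by
  have hk2 : k + 1 ≤ 2 ^ k := Nat.lt_two_pow_self
  have h1 : 1000 * (n + 1) ≤ 2 ^ 11 := by norm_num; omega
  calc M ≤ 2 ^ 11 * (2 ^ k) ^ 2 := by
        rw [hM]
        exact Nat.mul_le_mul h1 (Nat.pow_le_pow_left hk2 2)
    _ = 2 ^ (11 + k * 2) := by rw [← pow_mul, ← pow_add]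
    _ ≤ _ := Nat.pow_le_pow_right (by decide) (by omega)

/-- Rounding up the logarithm at most doubles it, as it is at least 1 for n ≥ 2. Squaring gives the
factor 4, and 4 * 622 = 2488. -/
theorem two_pow_le_rpow {n k w : ℕ} (hn : 2 ≤ n) :
    ((2 ^ (622 * (k * w * Nat.clog 2 n ^ 2)) : ℕ) : ℝ) ≤
      (n : ℝ) ^ (((2488 : ℕ) : ℝ) * (k : ℝ) * (w : ℝ) * Real.logb 2 (n : ℝ)) := by
  have hn0 : (0 : ℝ) < n := by exact_mod_cast (by omega : 0 < n)
  set x := Real.logb 2 (n : ℝ) with hx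
  have hnx : (n : ℝ) = 2 ^ x := (Real.rpow_logb (by norm_num) (by norm_num) hn0).symm
  have hx1 : 1 ≤ x := by
    rw [hx, Real.le_logb_iff_rpow_le (by norm_num) hn0, Real.rpow_one]
    exact_mod_cast hn
  have hd : (Nat.clog 2 n : ℝ) ≤ 2 * x := by
    have h1 : ((Nat.clog 2 n - 1 : ℕ) : ℝ) ≤ x := by
      rw [hx, Real.le_logb_iff_rpow_le (by norm_num) hn0, Real.rpow_natCast]
      exact_mod_cast (Nat.pow_pred_clog_lt_self (by decide) (by omega)).le
    have h2 : (Nat.clog 2 n : ℝ) ≤ ((Nat.clog 2 n - 1 : ℕ) : ℝ) + 1 := by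
      exact_mod_cast (by omega : Nat.clog 2 n ≤ Nat.clog 2 n - 1 + 1)
    linarith
  rw [Nat.cast_pow, ← Real.rpow_natCast, hnx, ← Real.rpow_mul (by norm_num)]
  push_cast
  refine Real.rpow_le_rpow_of_exponent_le (by norm_num) ?_
  have h1 : (Nat.clog 2 n : ℝ) ^ 2 ≤ (2 * x) ^ 2 := by gcongr
  have h2 := mul_le_mul_of_nonneg_left h1 (by positivity : (0 : ℝ) ≤ 622 * (k * w))
  nlinarith

end

end MaxPartialHColoring

theorem mainTheorem8 :
    ∃ τ : ℕ, ∀ k : ℕ, 1 ≤ k → ∀ H : SimpleGraph (Fin k),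
      ∃ P : MaxPartialHColoring.Program,
        ∀ (n : ℕ) (G : SimpleGraph (Fin n)) (rev : Fin n → Fin k → ℚ≥0),
          ¬ MaxPartialHColoring.bull.IsIndContained G →
          ¬ MaxPartialHColoring.graphE.IsIndContained G →
          ∃ (S : MaxPartialHColoring.PartialColoring G H) (t : ℕ),
            S.IsOptimal rev ∧
            P.Runs (MaxPartialHColoring.encodeInstance G rev)
              (MaxPartialHColoring.encodeSolution S) t ∧
            (2 ≤ n →
              (t : ℝ) ≤ (n : ℝ) ^ ((τ : ℝ) * (k : ℝ) * (G.cliqueNum : ℝ) * Real.logb 2 (n : ℝ))) ∧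
            (n ≤ 1 → t ≤ 2 ^ (τ * k)) := by
  classical
  open MaxPartialHColoring in
  refine ⟨2488, fun k hk H => ⟨prog fun a b => decide (H.Adj a b), fun n G rev hb he => ?_⟩⟩
  have ha : ∀ u v, decide (G.Adj u v) = true ↔ G.Adj u v := fun u v => decide_eq_true_iff
  have hh : ∀ a b, decide (H.Adj a b) = true ↔ H.Adj a b := fun a b => decide_eq_true_iff
  -- M has to exceed the number of vertices, of options (n * k) and of pairs of a cut and a color (3
  -- * k), and to bound the time for the table of H.
  obtain ⟨M, hM⟩ : ∃ M, M = 1000 * (n + 1) * (k + 1) ^ 2 := ⟨_, rfl⟩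
  obtain ⟨L, hL⟩ : ∃ L, L = ((n + 1) ^ (G.cliqueNum + 2)) ^ (3 * k) + 1 := ⟨_, rfl⟩
  obtain ⟨hM1, hM2, hM3, hM4, hM5⟩ := bounds_of_eq hM
  have hd : n ≤ 2 ^ Nat.clog 2 n := Nat.le_pow_clog (by decide) n
  have hopt := optimal_solve (rv := fun v a => (rev v a : ℚ)) (d := Nat.clog 2 n)
    (O := product (List.finRange k) (List.finRange n)) ha hh (List.nodup_finRange n)
    (by simpa using hd) fun o _ => List.mem_finRange _
  obtain ⟨body, t, h1, h2, h3⟩ := main_spec (M := M) (rv := fun v a => (rev v a : ℚ)) hb he ha hh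
    ⟨hM1, le_rfl, Nat.lt_of_succ_lt hM2, lt_of_le_of_lt (Nat.le_mul_of_pos_left k three_pos) hM3⟩
    hM2 hM3 hk hM4 hM5 (L := L) (by rw [hL]; exact Nat.lt_succ_self _) hd
  have hM0 : 0 < M := lt_of_lt_of_le (by decide) hM1
  have hL0 : 0 < L := hL ▸ Nat.succ_pos _
  have hq : 1 ≤ (L * L * M ^ 4) ^ Nat.clog 2 n * M ^ 30 :=
    Nat.mul_pos (Nat.pow_pos (Nat.mul_pos (Nat.mul_pos hL0 hL0) (Nat.pow_pos hM0)))
      (Nat.pow_pos hM0)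
  -- The two additional steps are the initial call and its argument; one more factor M absorbs them.
  have ht : 1 + t + 1 ≤ (L * L * M ^ 4) ^ Nat.clog 2 n * M ^ 31 := by
    rw [pow_succ _ 30, ← mul_assoc]
    generalize (L * L * M ^ 4) ^ Nat.clog 2 n * M ^ 30 = A at h3 hq
    have h4 := Nat.mul_le_mul_left A hM1
    clear hM hL
    omega
  refine ⟨coloringOf _ hopt.consistent, 1 + t + 1, isOptimal_coloringOf hopt fun o =>
    mem_product.2 ⟨List.mem_finRange _, List.mem_finRange _⟩, ?_, fun hn => ?_, fun hn => ?_⟩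
  · have h4 : encodeSolution (coloringOf _ hopt.consistent) = Enc.enc ((List.finRange n).map
        (colorIn (solve (fun u v => decide (G.Adj u v)) (fun a b => decide (H.Adj a b))
          (fun v a => (rev v a : ℚ)) (Nat.clog 2 n) (List.finRange n)
          (product (List.finRange k) (List.finRange n))))) := by
      simp only [encodeSolution, colorOf_coloringOf, List.ofFn_eq_map, Enc.enc, List.map_map]
      rfl
    rw [h4]
    have h5 : encodeInstance G rev = .pair (matrix fun u v => decide (G.Adj u v))
        (matrix fun v a => (rev v a : ℚ)) := by
      simp only [encodeInstance, matrix]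
      congr!
    rw [h5]
    exact .call h1 (.var rfl) h2
  · have hw : 1 ≤ G.cliqueNum := by
      have h6 : G.IsClique (({⟨0, by omega⟩} : Finset (Fin n)) : Set (Fin n)) := by simp
      simpa using h6.card_le_cliqueNum
    refine le_trans ?_ (two_pow_le_rpow hn)
    exact_mod_cast ht.trans (steps_le hk hw (Nat.clog_pos (by decide) hn) hd hM hL)
  -- With at most one vertex there is no recursion, and M ^ 31 ≤ 2^(403k) remains.
  · have h6 : Nat.clog 2 n = 0 := Nat.clog_of_right_le_one hn 2
    rw [h6, pow_zero, one_mul] at ht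
    refine ht.trans ?_
    have h7 := le_two_pow_of_eq hk hn hM
    calc M ^ 31 ≤ (2 ^ (13 * k)) ^ 31 := Nat.pow_le_pow_left h7 31
      _ = 2 ^ (13 * k * 31) := by rw [← pow_mul]
      _ ≤ _ := Nat.pow_le_pow_right (by decide) (by omega)
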